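/- Let $D$ be the space of càdlàg functions $w:[0,1]\to\mathbb R$ with $\|w\|=\sup_{t\in[0,1]}|w(t)|$. Let $M^1$ be the class of continuous, twice Fréchet differentiable $g:D\to\mathbb R$ such that $$\|g\|_{M^1}:=\sup_{w}\frac{|g(w)|}{1+\|w\|^3}+\sup_w\|Dg(w)\|+\sup_w\|D^2g(w)\|+\sup_{w,\,h\ne0}\frac{\|D^2g(w+h)-D^2g(w)\|}{\|h\|}<\infty ,$$ where a $k$-linear form $B$ on $D$ has norm $\|B\|=\sup_{\|h\|=1}|B[h,\dots,h]|$. Let $n\ge2$ and let $X=(X_{ij})_{1\le i,j\le n}$ be an array of independent real random variables with $\mathbb E|X_{ij}|^3<\infty$, means $c_{ij}$ and variances $\sigma_{ij}^2$, where $\sum_jc_{ij}=0$ for every $i$ and $\sum_ic_{ij}=0$ for every $j$. Let $\pi$ be a uniform random permutation of $\{1,\dots,n\}$ independent of $X$, let $$s_n^2=\frac1n\sum_{i,j=1}^n\sigma_{ij}^2+\frac1{n-1}\sum_{i,j=1}^nc_{ij}^2,\qquad s_n>0,\qquad Y_n(t)=\frac1{s_n}\sum_{i=1}^{\lfloor nt\rfloor}X_{i\pi(i)},\quad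 t\in[0,1].$$ Let $X''$ be an independent copy of $X$, let $(Z_{ij})$ be i.i.d. standard normal variables independent of $X$ and $X''$, and let $$\hat Z_i=\frac1{\sqrt{n-1}}\sum_{l=1}^nX''_{il}\Big(Z_{il}-\frac1n\sum_{j=1}^nZ_{jl}\Big),\qquad D_n(t)=\frac1{s_n}\sum_{i=1}^{\lfloor nt\rfloor}\hat Z_i,\quad t\in[0,1].$$ **Theorem.** (a) $\operatorname{Cov}(Y_n(t),Y_n(u))=\operatorname{Cov}(D_n(t),D_n(u))$ for all $t,u\in[0,1]$, and for every $g\in M^1$ the variables $g(Y_n)$ and $g(D_n)$ are integrable and $$\begin{aligned}&|\mathbb Eg(Y_n)-\mathbb Eg(D_n)|\\ \le{}&\frac{\|g\|_{M^1}}{n^3(n-1)s_n^3}\sum_{1\le i,j,k,l,u\le n}\Big\{3\mathbb E|X_{ik}|^3+5\mathbb E|X_{ik}|\,\mathbb E|X_{il}|^2+7\mathbb E|X_{ik}|^2\,\mathbb E|X_{jl}|+5\mathbb E|X_{ik}|^2\,\mathbb E|X_{jk}|\\ &+16\mathbb E|X_{ik}|\,\mathbb E|X_{il}|\,\mathbb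 E|X_{jl}|+2\mathbb E|X_{iu}|\,\mathbb E|X_{ik}|\,\mathbb E|X_{il}|+4\mathbb E|X_{iu}|\,\mathbb E|X_{il}|\,\mathbb E|X_{jk}|\\ &+6\mathbb E|X_{uk}|\,\mathbb E|X_{ik}|\,\mathbb E|X_{jl}|+2\mathbb E|X_{uk}|\,\mathbb E|X_{ik}|\,\mathbb E|X_{jk}|\\ &+\frac1n\big(2\mathbb E|X_{ik}|+2\mathbb E|X_{jl}|+2\mathbb E|X_{uk}|+2\mathbb E|X_{ul}|\big)\sum_{r=1}^n\big(\mathbb E|X_{ir}|^2+|c_{ir}c_{jr}|\big)\Big\}\\ &+\frac{2\|g\|_{M^1}}{\sqrt n}+\frac{4\|g\|_{M^1}}{3ns_n^2}\sum_{i,j=1}^n\sigma_{ij}^2 .\end{aligned}$$ (b) For all real $\beta$ and $c>0$ there is a constant $C$, depending only on $\beta$ and $c$, such that for every $n\ge2$ and every array as above with $\mathbb E|X_{ij}|^3\le\beta$ for all $i,j$ and $s_n\ge c\sqrt n$, $$|\mathbb Eg(Y_n)-\mathbb Eg(D_n)|\le\frac{C\|g\|_{M^1}}{\sqrt n}\qquad\text{for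 every }g\in M^1 .$$ -/

import Mathlib

open MeasureTheory ProbabilityTheory Filter Topology
open scoped ENNReal NNReal

universe v

noncomputable section

/-! ### The space of càdlàg functions on `[0,1]` with the supremum norm -/

/-- A function on `[0,1]` is càdlàg: right-continuous with left limits. At `t = 1` the first and at
`t = 0` the second condition is void. -/
def IsCadlag (f : unitInterval → ℝ) : Prop :=
  ∀ t, ContinuousWithinAt f (Set.Ici t) t ∧ ∃ l, Tendsto f (𝓝[<] t) (𝓝 l)

/-- A càdlàg function on `[0,1]` is automatically bounded. -/
theorem IsCadlag.memℓp {f : unitInterval → ℝ} (hf : IsCadlag f) :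
    Memℓp (E := fun _ : unitInterval => ℝ) f ∞ := by
  have key : ∃ C, ∀ t ∈ (Set.univ : Set unitInterval), ‖f t‖ ≤ C := by
    refine isCompact_univ.induction_on (p := fun s => ∃ C, ∀ t ∈ s, ‖f t‖ ≤ C) ⟨0, by simp⟩ ?_ ?_ ?_
    · rintro s t hst ⟨C, hC⟩
      exact ⟨C, fun x hx => hC x (hst hx)⟩
    · rintro s t ⟨C, hC⟩ ⟨C', hC'⟩
      refine ⟨max C C', fun x hx => ?_⟩
      rcases hx with hx | hx
      · exact (hC x hx).trans (le_max_left _ _)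
      · exact (hC' x hx).trans (le_max_right _ _)
    · intro t _
      obtain ⟨hr, l, hl⟩ := hf t
      have h1 : ∀ᶠ x in 𝓝[≥] t, ‖f x‖ ≤ ‖f t‖ + 1 :=
        (hr.norm.eventually (gt_mem_nhds (lt_add_one _))).mono fun x hx => hx.le
      have h2 : ∀ᶠ x in 𝓝[<] t, ‖f x‖ ≤ ‖l‖ + 1 :=
        (hl.norm.eventually (gt_mem_nhds (lt_add_one _))).mono fun x hx => hx.le
      have h3 : ∀ᶠ x in 𝓝 t, ‖f x‖ ≤ max (‖f t‖ + 1) (‖l‖ + 1) := by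
        rw [← nhdsLT_sup_nhdsGE t, eventually_sup]
        exact ⟨h2.mono fun x hx => hx.trans (le_max_right _ _),
          h1.mono fun x hx => hx.trans (le_max_left _ _)⟩
      exact ⟨_, by rw [nhdsWithin_univ]; exact h3, _, fun x hx => hx⟩
  obtain ⟨C, hC⟩ := key
  exact memℓp_infty ⟨C, by rintro _ ⟨t, rfl⟩; exact hC t trivial⟩

/-- The càdlàg functions as a subspace of the bounded functions on `[0,1]`. -/
def cadlagSubmodule : Submodule ℝ (lp (fun _ : unitInterval => ℝ) ∞) where
  carrier := {f | IsCadlag f}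
  add_mem' := by
    intro f g hf hg t
    obtain ⟨l, hl⟩ := (hf t).2
    obtain ⟨m, hm⟩ := (hg t).2
    exact ⟨(hf t).1.add (hg t).1, l + m, hl.add hm⟩
  zero_mem' := fun t => ⟨continuousWithinAt_const, 0, tendsto_const_nhds⟩
  smul_mem' := by
    intro c f hf t
    obtain ⟨l, hl⟩ := (hf t).2
    exact ⟨(hf t).1.const_smul c, c • l, hl.const_smul c⟩

/-- `D = D([0,1], ℝ)`, a normed space under `‖w‖ = sup_{t ∈ [0,1]} |w t|`. -/
abbrev CadlagSpace : Type := cadlagSubmodule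

theorem CadlagSpace.norm_eq_iSup (w : CadlagSpace) : ‖w‖ = ⨆ t : unitInterval, |w.1 t| :=
  lp.norm_eq_ciSup w.1

/-! ### The test function classes -/

/-- The norm `sup_{‖h‖ = 1} |B[h, h]|` of a bilinear form. -/
def diagNorm (B : CadlagSpace →L[ℝ] CadlagSpace →L[ℝ] ℝ) : ℝ≥0∞ :=
  ⨆ (h : CadlagSpace) (_ : ‖h‖ = 1), ‖B h h‖ₑ

/-- The second Fréchet derivative. -/
def secondDeriv (f : CadlagSpace → ℝ) (w : CadlagSpace) :
    CadlagSpace →L[ℝ] CadlagSpace →L[ℝ] ℝ :=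
  fderiv ℝ (fderiv ℝ f) w

/-- `‖f‖_L = sup_w |f(w)| / (1 + ‖w‖³)`. -/
def normL (f : CadlagSpace → ℝ) : ℝ≥0∞ :=
  ⨆ w : CadlagSpace, ENNReal.ofReal (|f w| / (1 + ‖w‖ ^ 3))

/-- The class `M`: continuous `f` with `‖f‖_L < ∞`, twice Fréchet differentiable, with Lipschitz
second derivative. -/
structure MemM (f : CadlagSpace → ℝ) : Prop where
  continuous : Continuous f
  normL_lt_top : normL f < ∞
  differentiable : Differentiable ℝ f
  differentiable_fderiv : Differentiable ℝ (fderiv ℝ f)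
  lipschitz : ∃ k : ℝ≥0, ∀ w h : CadlagSpace,
    diagNorm (secondDeriv f (w + h) - secondDeriv f w) ≤ k * ‖h‖ₑ

/-- `‖g‖_{M¹}` as an extended nonnegative number. -/
def eNormM1 (g : CadlagSpace → ℝ) : ℝ≥0∞ :=
  normL g + (⨆ w, ‖fderiv ℝ g w‖ₑ) + (⨆ w, diagNorm (secondDeriv g w)) +
    ⨆ (w : CadlagSpace) (h : CadlagSpace) (_ : h ≠ 0),
      diagNorm (secondDeriv g (w + h) - secondDeriv g w) / ‖h‖ₑ

/-- The class `M¹`. -/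
def MemM1 (g : CadlagSpace → ℝ) : Prop := MemM g ∧ eNormM1 g < ∞

/-- `‖g‖_{M¹}` as a real number, for `g` in `M¹`. -/
def normM1 (g : CadlagSpace → ℝ) : ℝ := (eNormM1 g).toReal

/-! ### Step paths -/

theorem isCadlag_indicator (a : ℝ) :
    IsCadlag (fun t : unitInterval => if a ≤ (t : ℝ) then (1 : ℝ) else 0) := by
  intro t
  constructor
  · by_cases h : a ≤ (t : ℝ)
    · refine (continuousWithinAt_const (b := (1 : ℝ))).congr (fun x hx => ?_) (if_pos h)
      exact if_pos (h.trans (Subtype.coe_le_coe.2 hx))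
    · have hev : ∀ᶠ x : unitInterval in 𝓝[≥] t, ¬ a ≤ (x : ℝ) := by
        apply eventually_nhdsWithin_of_eventually_nhds
        filter_upwards [(isOpen_Iio.preimage continuous_subtype_val).mem_nhds
          (show t ∈ Subtype.val ⁻¹' Set.Iio a from not_le.1 h)] with x hx
        exact not_le.2 hx
      exact (continuousWithinAt_const (b := (0 : ℝ))).congr_of_eventuallyEq
        (hev.mono fun x hx => if_neg hx) (if_neg h)
  · by_cases h : a < (t : ℝ)
    · refine ⟨1, tendsto_const_nhds.congr' ?_⟩
      apply eventually_nhdsWithin_of_eventually_nhds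
      filter_upwards [(isOpen_Ioi.preimage continuous_subtype_val).mem_nhds
          (show t ∈ Subtype.val ⁻¹' Set.Ioi a from h)] with x hx
      exact (if_pos (le_of_lt hx)).symm
    · refine ⟨0, tendsto_const_nhds.congr' ?_⟩
      filter_upwards [self_mem_nhdsWithin] with x hx
      exact (if_neg (not_le.2 (lt_of_lt_of_le (Subtype.coe_lt_coe.2 hx) (not_lt.1 h)))).symm

/-- The indicator of `[a, 1]` as an element of `D`. -/
def jump (a : ℝ) : CadlagSpace :=
  ⟨⟨fun t => if a ≤ (t : ℝ) then 1 else 0, (isCadlag_indicator a).memℓp⟩, isCadlag_indicator a⟩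

/-- The path `t ↦ a₁ + ⋯ + a_{⌊nt⌋} = ∑ i, a_i 1_{[i/n, 1]}(t)`. The index `i : Fin n` stands for
the number `i + 1`. -/
def stepPath {n : ℕ} (a : Fin n → ℝ) : CadlagSpace :=
  ∑ i : Fin n, a i • jump (((i : ℕ) + 1 : ℝ) / n)

theorem stepPath_apply {n : ℕ} (a : Fin n → ℝ) (t : unitInterval) :
    (stepPath a).1 t = ∑ i : Fin n with i.val + 1 ≤ ⌊(n : ℝ) * t⌋₊, a i := by
  have h1 : (stepPath a).1 t
      = ∑ i : Fin n, a i * (if ((i : ℕ) + 1 : ℝ) / n ≤ (t : ℝ) then 1 else 0) := by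
    unfold stepPath
    rw [AddSubmonoidClass.coe_finsetSum, lp.coeFn_sum, Finset.sum_apply]
    rfl
  rw [h1, Finset.sum_filter]
  refine Finset.sum_congr rfl fun i _ => ?_
  have hn : (0 : ℝ) < n := by exact_mod_cast (Nat.zero_le _).trans_lt i.2
  have : ((i : ℕ) + 1 : ℝ) / n ≤ (t : ℝ) ↔ (i : ℕ) + 1 ≤ ⌊(n : ℝ) * t⌋₊ := by
    rw [div_le_iff₀ hn, Nat.le_floor_iff (mul_nonneg hn.le t.2.1), mul_comm]
    push_cast
    rfl
  simp only [this, mul_ite, mul_one, mul_zero]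

/-! ### The random array and the two processes -/

instance permMeasurableSpace (n : ℕ) : MeasurableSpace (Equiv.Perm (Fin n)) := ⊤

section Model

variable {n : ℕ} {Ω : Type*} [MeasurableSpace Ω]

/-- `X` is an `n × n` array of independent random variables with finite third absolute moments and
means `c i j` with vanishing row and column averages; `π` is a uniform random permutation that is
independent of `X`; `X''` is an independent copy of `X`; and `Z` is an array of i.i.d. standard
normal variables, independent of `X` and `X''`. -/
structure CombinatorialModel (P : Measure Ω) (X : Fin n → Fin n → Ω → ℝ)
    (π : Ω → Equiv.Perm (Fin n)) (X'' Z : Fin n → Fin n → Ω → ℝ) : Prop where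
  measurable_X : ∀ i j, Measurable (X i j)
  indep_X : iIndepFun (fun (p : Fin n × Fin n) => X p.1 p.2) P
  third_moment : ∀ i j, MemLp (X i j) 3 P
  row_mean : ∀ i, ∑ j, ∫ ω, X i j ω ∂P = 0
  col_mean : ∀ j, ∑ i, ∫ ω, X i j ω ∂P = 0
  measurable_perm : Measurable π
  uniform_perm : ∀ τ, P (π ⁻¹' {τ}) = (n.factorial : ℝ≥0∞)⁻¹
  indep_X_perm : IndepFun (fun ω i j => X i j ω) π P
  measurable_copy : ∀ i j, Measurable (X'' i j)
  copy_law : P.map (fun ω i j => X'' i j ω) = P.map (fun ω i j => X i j ω)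
  indep_copy : IndepFun (fun ω i j => X'' i j ω) (fun ω i j => X i j ω) P
  measurable_Z : ∀ i j, Measurable (Z i j)
  law_Z : ∀ i j, P.map (Z i j) = gaussianReal 0 1
  indep_Z : iIndepFun (fun (p : Fin n × Fin n) => Z p.1 p.2) P
  indep_Z_X : IndepFun (fun ω i j => Z i j ω)
    (fun ω => ((fun i j => X i j ω), (fun i j => X'' i j ω))) P

/-- `c_{ij} = E X_{ij}`. -/
def entryMean (P : Measure Ω) (X : Fin n → Fin n → Ω → ℝ) (i j : Fin n) : ℝ :=
  ∫ ω, X i j ω ∂P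

/-- `E |X_{ij}|^k`. -/
def absMoment (P : Measure Ω) (X : Fin n → Fin n → Ω → ℝ) (k : ℕ) (i j : Fin n) : ℝ :=
  ∫ ω, |X i j ω| ^ k ∂P

/-- `s_n`, where `s_n² = (1/n) ∑ σ_{ij}² + (1/(n-1)) ∑ c_{ij}²`. -/
def scale (P : Measure Ω) (X : Fin n → Fin n → Ω → ℝ) : ℝ :=
  Real.sqrt (1 / (n : ℝ) * ∑ i, ∑ j, variance (X i j) P
    + 1 / ((n : ℝ) - 1) * ∑ i, ∑ j, entryMean P X i j ^ 2)

/-- `Y_n(t) = s_n⁻¹ ∑_{i ≤ ⌊nt⌋} X_{i π(i)}`. -/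
def processY (P : Measure Ω) (X : Fin n → Fin n → Ω → ℝ) (π : Ω → Equiv.Perm (Fin n)) (ω : Ω) :
    CadlagSpace :=
  (1 / scale P X) • stepPath (fun i => X i (π ω i) ω)

/-- `Ẑ_i = (n-1)^{-1/2} ∑_l X''_{il} (Z_{il} - (1/n) ∑_j Z_{jl})`. -/
def zHat (X'' Z : Fin n → Fin n → Ω → ℝ) (i : Fin n) (ω : Ω) : ℝ :=
  1 / Real.sqrt ((n : ℝ) - 1) *
    ∑ l, X'' i l ω * (Z i l ω - 1 / (n : ℝ) * ∑ j, Z j l ω)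

/-- `D_n(t) = s_n⁻¹ ∑_{i ≤ ⌊nt⌋} Ẑ_i`. -/
def processD (P : Measure Ω) (X X'' Z : Fin n → Fin n → Ω → ℝ) (ω : Ω) : CadlagSpace :=
  (1 / scale P X) • stepPath (fun i => zHat X'' Z i ω)

/-- The sum of third-order moment terms over `1 ≤ i, j, k, l, u ≤ n`. -/
def thirdOrderSum (P : Measure Ω) (X : Fin n → Fin n → Ω → ℝ) : ℝ :=
  let m := absMoment P X 1
  let m₂ := absMoment P X 2
  let m₃ := absMoment P X 3
  let c := entryMean P X
  ∑ i, ∑ j, ∑ k, ∑ l, ∑ u,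
    (3 * m₃ i k + 5 * (m i k * m₂ i l) + 7 * (m₂ i k * m j l)
      + 5 * (m₂ i k * m j k) + 16 * (m i k * m i l * m j l) + 2 * (m i u * m i k * m i l)
      + 4 * (m i u * m i l * m j k) + 6 * (m u k * m i k * m j l) + 2 * (m u k * m i k * m j k)
      + 1 / (n : ℝ) * (2 * m i k + 2 * m j l + 2 * m u k + 2 * m u l)
        * ∑ r, (m₂ i r + |c i r * c j r|))

end Model

end

/-! Both processes are images of random vectors of `ℝⁿ`, `W = (X_{iπ(i)})_i` and `Ẑ`, under the
linear map that sends `a` to the step path with jumps `a_i / s_n`. It therefore suffices to compare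
`E G(W)` and `E G(Ẑ)`, where `G` is `g` composed with this map. The gradient `f` of `G` has a
bounded Jacobian `H` which is `κ`-Lipschitz for the `ℓ¹` norm, with `κ = 2‖g‖ / s_n³`; the factor 2
is the price of polarization.

The central notion is `ApproxStein`: the identity `E ∑ W_i f_i(W) = ∑ C_ij E H_ij(W)` holds up to an
error `κ ε`. Both vectors satisfy it with the same matrix `C = permCov`. Linear fields have `κ = 0`,
so `C` is exactly the matrix of second moments of both vectors. Constant fields show that the means
vanish, and the equality of covariances follows.

The comparison is a rotation (`ApproxStein.abs_integral_sub_le`). For independent `W` and `Ẑ`, the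
derivative in `θ` of `E G(cos θ W + sin θ Ẑ)` contains the `C`-terms of the two integration by parts
formulas with opposite signs. They cancel, and only errors `κ ε₁ cos² θ sin θ + κ ε₂ sin² θ cos θ`
remain. Integrated over `[0, π/2]` these give `κ (ε₁ + ε₂) / 3`.

For `W` (`approxStein_permLaw`), condition on `π`, expand `f_i` in its own coordinate and use
independence of the rows. This leaves averages over permutations of `c_{iπ(i)}`, or of the second
moment at `(i, π(i))`, times a statistic of the remaining rows. Composing `π` with the transposition
of `i` and a uniform `j` makes `π(i)` almost independent of that statistic. Since the rows of `c`
sum to zero, only the change of the statistic under the transposition survives, and its first order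
part produces the off-diagonal covariances.

For `Ẑ` (`approxStein_mixLaw`), given `X''` the vector is Gaussian, so integration by parts is exact
with a random covariance matrix that is linear in the products `X''_{il} X''_{jl}`. Replacing these
products by their means is cheap, because deleting one or two entries of `X''` moves `Ẑ` only
slightly.

Finally `2/3 (ε₁ + ε₂)` is dominated, term by term, by the moment sum of the theorem
(`permError_add_mixError_le`). Part (b) bounds every moment in that sum by a constant. -/

noncomputable section

/-! ### Smooth fields on `ℝⁿ` -/

section Fields

variable {n : ℕ}

/-- A field `f : ℝⁿ → ℝⁿ` whose Jacobian `H` is bounded and `κ`-Lipschitz for the `ℓ¹` norm. -/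
structure IsSmoothField (κ : ℝ) (f : Fin n → (Fin n → ℝ) → ℝ)
    (H : Fin n → Fin n → (Fin n → ℝ) → ℝ) : Prop where
  nonneg : 0 ≤ κ
  hasFDerivAt : ∀ i x, HasFDerivAt (f i)
    (∑ j, H i j x • ContinuousLinearMap.proj (R := ℝ) (φ := fun _ : Fin n => ℝ) j) x
  bounded : ∃ B, 0 ≤ B ∧ ∀ i j x, |H i j x| ≤ B
  lipschitz : ∀ i j x y, |H i j x - H i j y| ≤ κ * ∑ m, |x m - y m|

namespace IsSmoothField

variable {κ : ℝ} {f : Fin n → (Fin n → ℝ) → ℝ} {H : Fin n → Fin n → (Fin n → ℝ) → ℝ}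

theorem continuous_field (h : IsSmoothField κ f H) (i : Fin n) : Continuous (f i) :=
  continuous_iff_continuousAt.2 fun x => (h.hasFDerivAt i x).continuousAt

theorem continuous_jacobian (h : IsSmoothField κ f H) (i j : Fin n) : Continuous (H i j) := by
  refine continuous_iff_continuousAt.2 fun y => ?_
  rw [ContinuousAt, tendsto_iff_dist_tendsto_zero]
  refine squeeze_zero (fun _ => dist_nonneg) (fun x => h.lipschitz i j x y) ?_
  have : Continuous fun x : Fin n → ℝ => κ * ∑ m, |x m - y m| := by fun_prop
  simpa using this.tendsto y

theorem hasDerivAt_line (h : IsSmoothField κ f H) (i : Fin n) (x v : Fin n → ℝ) (t : ℝ) :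
    HasDerivAt (fun t : ℝ => f i (x + t • v)) (∑ j, v j * H i j (x + t • v)) t := by
  have h1 : HasDerivAt (fun t : ℝ => x + t • v) v t := by
    simpa using ((hasDerivAt_id t).smul_const v).const_add x
  have := (h.hasFDerivAt i (x + t • v)).comp_hasDerivAt t h1
  convert! this using 1
  simp [mul_comm]

theorem growth (h : IsSmoothField κ f H) :
    ∃ B, 0 ≤ B ∧ ∀ i x, |f i x| ≤ B * (1 + ∑ j, |x j|) := by
  obtain ⟨B, hB0, hB⟩ := h.bounded
  refine ⟨B + ∑ i, |f i 0|, by positivity, fun i x => ?_⟩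
  obtain ⟨t, -, ht⟩ := exists_hasDerivAt_eq_slope (fun t : ℝ => f i (0 + t • x))
    (fun t => ∑ j, x j * H i j (0 + t • x)) zero_lt_one
    (fun t _ => (h.hasDerivAt_line i 0 x t).continuousAt.continuousWithinAt)
    (fun t _ => h.hasDerivAt_line i 0 x t)
  have h1 : f i x = f i 0 + ∑ j, x j * H i j (0 + t • x) := by
    rw [ht]; simp
  have h2 : |∑ j, x j * H i j (0 + t • x)| ≤ B * ∑ j, |x j| := by
    refine (Finset.abs_sum_le_sum_abs _ _).trans ?_
    rw [Finset.mul_sum]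
    refine Finset.sum_le_sum fun j _ => ?_
    rw [abs_mul, mul_comm]
    exact mul_le_mul_of_nonneg_right (hB _ _ _) (abs_nonneg _)
  have h3 : |f i 0| ≤ ∑ i, |f i 0| :=
    Finset.single_le_sum (f := fun i => |f i 0|) (fun _ _ => abs_nonneg _) (Finset.mem_univ i)
  have h4 : 0 ≤ ∑ j, |x j| := by positivity
  have h5 : 0 ≤ ∑ i, |f i 0| := by positivity
  rw [h1]
  refine (abs_add_le _ _).trans ?_
  nlinarith [mul_nonneg h5 h4]

/-- By the mean value theorem the increment is `a` times the partial derivative at an intermediate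
point, which lies within `ℓ¹` distance `|a|` of `x`. This gives the constant `κ` instead of the
optimal `κ / 2`. -/
theorem taylor (h : IsSmoothField κ f H) (i j : Fin n) (x : Fin n → ℝ) (a : ℝ) :
    |f i (x + Pi.single j a) - f i x - a * H i j x| ≤ κ * a ^ 2 := by
  obtain ⟨v, hv⟩ : ∃ v : Fin n → ℝ, v = Pi.single j a := ⟨_, rfl⟩
  obtain ⟨t, ht0, ht⟩ := exists_hasDerivAt_eq_slope (fun t : ℝ => f i (x + t • v))
    (fun t => ∑ l, v l * H i l (x + t • v)) zero_lt_one
    (fun t _ => (h.hasDerivAt_line i x v t).continuousAt.continuousWithinAt)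
    (fun t _ => h.hasDerivAt_line i x v t)
  subst hv
  have h1 : f i (x + Pi.single j a) - f i x = a * H i j (x + t • Pi.single j a) := by
    rw [Finset.sum_eq_single j (fun l _ hl => by simp [hl]) (by simp)] at ht
    simpa using ht.symm
  have h2 := h.lipschitz i j (x + t • Pi.single j a) x
  have h3 : ∑ m, |(x + t • (Pi.single j a : Fin n → ℝ)) m - x m| = t * |a| := by
    rw [Finset.sum_eq_single j (fun l _ hl => by simp [hl]) (by simp)]
    simp [abs_mul, abs_of_pos ht0.1]
  rw [h3] at h2
  rw [h1, ← mul_sub, abs_mul]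
  have h4 : κ * (t * |a|) ≤ κ * |a| :=
    mul_le_mul_of_nonneg_left (mul_le_of_le_one_left (abs_nonneg a) ht0.2.le) h.nonneg
  calc |a| * _ ≤ |a| * (κ * |a|) := mul_le_mul_of_nonneg_left (h2.trans h4) (abs_nonneg a)
    _ = κ * a ^ 2 := by rw [← sq_abs a]; ring

/-- Precomposition with an affine map `x ↦ a x + b`. -/
theorem comp_affine (h : IsSmoothField κ f H) (a : ℝ) (b : Fin n → ℝ) :
    IsSmoothField (κ * a ^ 2) (fun i x => f i (a • x + b))
      (fun i j x => a * H i j (a • x + b)) := by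
  obtain ⟨B, hB0, hB⟩ := h.bounded
  refine ⟨mul_nonneg h.nonneg (sq_nonneg a), fun i x => ?_, ⟨|a| * B, by positivity,
    fun i j x => ?_⟩, fun i j x y => ?_⟩
  · have h1 : HasFDerivAt (fun x : Fin n → ℝ => a • x + b)
        (a • ContinuousLinearMap.id ℝ (Fin n → ℝ)) x :=
      ((hasFDerivAt_id x).const_smul a).add_const b
    have := (h.hasFDerivAt i (a • x + b)).comp x h1
    convert! this using 1
    ext v
    simp [Finset.mul_sum]
    refine Finset.sum_congr rfl fun j _ => by ring
  · rw [abs_mul]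
    exact mul_le_mul_of_nonneg_left (hB _ _ _) (abs_nonneg a)
  · rw [← mul_sub, abs_mul]
    have := h.lipschitz i j (a • x + b) (a • y + b)
    have h2 : ∑ m, |(a • x + b) m - (a • y + b) m| = |a| * ∑ m, |x m - y m| := by
      rw [Finset.mul_sum]
      refine Finset.sum_congr rfl fun m _ => ?_
      rw [← abs_mul]; congr 1; simp; ring
    rw [h2] at this
    calc |a| * _ ≤ |a| * (κ * (|a| * ∑ m, |x m - y m|)) :=
          mul_le_mul_of_nonneg_left this (abs_nonneg a)
      _ = _ := by rw [← sq_abs a]; ring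

/-- The linear field `x ↦ x_j e_i`. -/
theorem linear (i₀ j₀ : Fin n) :
    IsSmoothField 0 (fun i x => if i = i₀ then x j₀ else 0)
      (fun i j _ => if i = i₀ ∧ j = j₀ then (1 : ℝ) else 0) := by
  refine ⟨le_rfl, fun i x => ?_, ⟨1, zero_le_one, fun i j x => ?_⟩, fun i j x y => by simp⟩
  · by_cases hi : i = i₀
    · simp only [hi, true_and, if_true, ite_smul, one_smul, zero_smul, Finset.sum_ite_eq',
        Finset.mem_univ]
      exact hasFDerivAt_apply j₀ x
    · simp only [hi, false_and, if_false, zero_smul, Finset.sum_const_zero]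
      exact hasFDerivAt_const _ _
  · split_ifs <;> simp

end IsSmoothField

/-- The law `ν` satisfies the Gaussian integration by parts formula with covariance `C` up to an
error proportional to `ε`. -/
def ApproxStein (ν : Measure (Fin n → ℝ)) (C : Fin n → Fin n → ℝ) (ε : ℝ) : Prop :=
  ∀ (κ : ℝ) (f : Fin n → (Fin n → ℝ) → ℝ) (H : Fin n → Fin n → (Fin n → ℝ) → ℝ),
    IsSmoothField κ f H →
    |∫ x, ∑ i, x i * f i x ∂ν - ∑ i, ∑ j, C i j * ∫ x, H i j x ∂ν| ≤ κ * ε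

/-- A linear field has `κ = 0`, so the approximate formula is exact for it, whatever `ε` is. -/
theorem ApproxStein.integral_mul {ν : Measure (Fin n → ℝ)} [IsProbabilityMeasure ν]
    {C : Fin n → Fin n → ℝ} {ε : ℝ} (h : ApproxStein ν C ε) (i j : Fin n) :
    ∫ x, x i * x j ∂ν = C i j := by
  have := h 0 _ _ (IsSmoothField.linear i j)
  simp only [zero_mul, abs_nonpos_iff, mul_ite, mul_zero, Finset.sum_ite_eq', Finset.mem_univ,
    if_true, integral_const, probReal_univ, smul_eq_mul, one_mul] at this
  rw [sub_eq_zero.1 this]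
  rw [Finset.sum_eq_single i (fun k _ hk => by simp [hk]) (by simp)]
  simp

end Fields

/-! ### Gaussian integration by parts -/

theorem integrable_gaussianReal_iff {φ : ℝ → ℝ} :
    Integrable φ (gaussianReal 0 1) ↔ Integrable (fun t => φ t * gaussianPDFReal 0 1 t) := by
  rw [gaussianReal_of_var_ne_zero _ one_ne_zero,
    integrable_withDensity_iff_integrable_smul' (measurable_gaussianPDF _ _)
      (ae_of_all _ fun _ => gaussianPDF_lt_top)]
  simp [mul_comm]

theorem hasDerivAt_gaussianPDFReal (t : ℝ) :
    HasDerivAt (gaussianPDFReal 0 1) (-(t * gaussianPDFReal 0 1 t)) t := by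
  have h1 : HasDerivAt (fun t : ℝ => -(t - 0) ^ 2 / (2 * ((1 : ℝ≥0) : ℝ))) (-t) t := by
    have := (((hasDerivAt_id t).sub_const 0).pow 2).neg.div_const (2 * ((1 : ℝ≥0) : ℝ))
    convert! this using 1
    simp
    ring
  have := (h1.exp).const_mul (√(2 * Real.pi * ((1 : ℝ≥0) : ℝ)))⁻¹
  rw [gaussianPDFReal_def]
  convert! this using 1
  ring

/-- The standard normal density `p` satisfies `p' = -t p`; integrate by parts over the line. The
three integrability hypotheses make the boundary terms vanish. -/
theorem integral_id_mul_gaussianReal {F F' : ℝ → ℝ} (hF : ∀ t, HasDerivAt F (F' t) t)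
    (hFi : Integrable F (gaussianReal 0 1)) (hF'i : Integrable F' (gaussianReal 0 1))
    (hFt : Integrable (fun t => t * F t) (gaussianReal 0 1)) :
    ∫ t, t * F t ∂gaussianReal 0 1 = ∫ t, F' t ∂gaussianReal 0 1 := by
  rw [integrable_gaussianReal_iff] at hFi hF'i hFt
  have h := integral_mul_deriv_eq_deriv_mul_of_integrable (u := F) (u' := F')
    (v := gaussianPDFReal 0 1) (v' := fun t => -(t * gaussianPDFReal 0 1 t))
    (fun t _ => hF t) (fun t _ => hasDerivAt_gaussianPDFReal t)
    (by refine hFt.neg.congr (ae_of_all _ fun t => ?_); simp; ring) hF'i hFi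
  rw [integral_gaussianReal_eq_integral_smul one_ne_zero,
    integral_gaussianReal_eq_integral_smul one_ne_zero]
  simp only [smul_eq_mul]
  have e1 : ∀ t, gaussianPDFReal 0 1 t * (t * F t) = -(F t * -(t * gaussianPDFReal 0 1 t)) :=
    fun t => by ring
  simp_rw [e1, integral_neg, h, neg_neg, mul_comm (F' _)]

/-! ### Gaussian-type interpolation between two laws -/

section Interpolation

variable {n : ℕ} {κ ε₁ ε₂ : ℝ} {f : Fin n → (Fin n → ℝ) → ℝ}
  {H : Fin n → Fin n → (Fin n → ℝ) → ℝ} {μ ν : Measure (Fin n → ℝ)} {C : Fin n → Fin n → ℝ}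

/-- With the second component `y` frozen, `x ↦ f (a x + b y)` is a smooth field with Jacobian `a H`
and Lipschitz constant `κ a²`. The bound is uniform in `y`, hence survives integration over `ν`. -/
theorem ApproxStein.rotated_left [IsProbabilityMeasure μ] [IsProbabilityMeasure ν]
    (hμ : ApproxStein μ C ε₁) (hf : IsSmoothField κ f H) (a b : ℝ)
    (hint : Integrable (fun p : (Fin n → ℝ) × (Fin n → ℝ) =>
      ∑ i, p.1 i * f i (a • p.1 + b • p.2)) (μ.prod ν)) :
    |∫ p, ∑ i, p.1 i * f i (a • p.1 + b • p.2) ∂μ.prod ν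
      - a * ∑ i, ∑ j, C i j * ∫ p, H i j (a • p.1 + b • p.2) ∂μ.prod ν| ≤ κ * a ^ 2 * ε₁ := by
  obtain ⟨B, hB0, hB⟩ := hf.bounded
  have hHi : ∀ i j, Integrable (fun p : (Fin n → ℝ) × (Fin n → ℝ) =>
      H i j (a • p.1 + b • p.2)) (μ.prod ν) := fun i j =>
    Integrable.of_bound (((hf.continuous_jacobian i j).comp (by fun_prop)).aestronglyMeasurable) B
      (ae_of_all _ fun p => hB _ _ _)
  have key : ∀ y, |∫ x, ∑ i, x i * f i (a • x + b • y) ∂μ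
      - a * ∑ i, ∑ j, C i j * ∫ x, H i j (a • x + b • y) ∂μ| ≤ κ * a ^ 2 * ε₁ := fun y => by
    have := hμ _ _ _ (hf.comp_affine a (b • y))
    simp only [integral_const_mul] at this
    convert this using 3
    simp only [Finset.mul_sum]
    refine Finset.sum_congr rfl fun i _ => Finset.sum_congr rfl fun j _ => by ring
  have hHy : ∀ i j, Integrable (fun y => ∫ x, H i j (a • x + b • y) ∂μ) ν := fun i j =>
    (hHi i j).integral_prod_right
  have e : ∫ p, ∑ i, p.1 i * f i (a • p.1 + b • p.2) ∂μ.prod ν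
      - a * ∑ i, ∑ j, C i j * ∫ p, H i j (a • p.1 + b • p.2) ∂μ.prod ν
      = ∫ y, (∫ x, ∑ i, x i * f i (a • x + b • y) ∂μ
        - a * ∑ i, ∑ j, C i j * ∫ x, H i j (a • x + b • y) ∂μ) ∂ν := by
    rw [integral_prod_symm _ hint, integral_sub hint.integral_prod_right, integral_const_mul]
    · congr 2
      rw [integral_finsetSum _ fun i _ => integrable_finsetSum _ fun j _ => (hHy i j).const_mul _]
      refine Finset.sum_congr rfl fun i _ => ?_
      rw [integral_finsetSum _ fun j _ => (hHy i j).const_mul _]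
      refine Finset.sum_congr rfl fun j _ => ?_
      rw [integral_const_mul, integral_prod_symm _ (hHi i j)]
    · exact (integrable_finsetSum _ fun i _ =>
        integrable_finsetSum _ fun j _ => (hHy i j).const_mul _).const_mul _
  rw [e]
  have := norm_integral_le_of_norm_le_const (μ := ν)
    (ae_of_all _ fun y => (Real.norm_eq_abs _).trans_le (key y))
  simpa using this

theorem ApproxStein.rotated_right [IsProbabilityMeasure μ] [IsProbabilityMeasure ν]
    (hν : ApproxStein ν C ε₂) (hf : IsSmoothField κ f H) (a b : ℝ)
    (hint : Integrable (fun p : (Fin n → ℝ) × (Fin n → ℝ) =>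
      ∑ i, p.2 i * f i (a • p.1 + b • p.2)) (μ.prod ν)) :
    |∫ p, ∑ i, p.2 i * f i (a • p.1 + b • p.2) ∂μ.prod ν
      - b * ∑ i, ∑ j, C i j * ∫ p, H i j (a • p.1 + b • p.2) ∂μ.prod ν| ≤ κ * b ^ 2 * ε₂ := by
  have hint' : Integrable (fun p : (Fin n → ℝ) × (Fin n → ℝ) =>
      ∑ i, p.1 i * f i (b • p.1 + a • p.2)) (ν.prod μ) := by
    refine hint.swap.congr (ae_of_all _ fun p => ?_)
    simp [add_comm]
  have := hν.rotated_left (ν := μ) hf b a hint'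
  rw [← integral_prod_swap] at this
  have e : ∀ i j, ∫ p, H i j (b • p.1 + a • p.2) ∂ν.prod μ
      = ∫ p, H i j (a • p.1 + b • p.2) ∂μ.prod ν := fun i j => by
    rw [← integral_prod_swap]; simp [add_comm]
  simp_rw [e] at this
  simpa [add_comm] using this

/-- Interpolation along the circle `cos θ x + sin θ y`. A rotation is used because differentiation
replaces the coefficients by `-sin θ` and `cos θ`. After integration by parts these yield `-sin θ
cos θ` and `cos θ sin θ` times the same covariance term, which cancel because both laws share `C`.
-/
theorem ApproxStein.abs_integral_sub_le [IsProbabilityMeasure μ] [IsProbabilityMeasure ν]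
    (hμ : ApproxStein μ C ε₁) (hν : ApproxStein ν C ε₂) (hf : IsSmoothField κ f H)
    (hμi : ∀ i, Integrable (fun x : Fin n → ℝ => x i) μ)
    (hνi : ∀ i, Integrable (fun x : Fin n → ℝ => x i) ν)
    {G : (Fin n → ℝ) → ℝ} (hG : ∀ x, HasFDerivAt G
      (∑ i, f i x • ContinuousLinearMap.proj (R := ℝ) (φ := fun _ : Fin n => ℝ) i) x)
    (hGμ : Integrable G μ) {B : ℝ} (hB : ∀ i x, |f i x| ≤ B) :
    |∫ x, G x ∂μ - ∫ x, G x ∂ν| ≤ κ / 3 * (ε₁ + ε₂) := by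
  let U : ℝ → (Fin n → ℝ) × (Fin n → ℝ) → (Fin n → ℝ) :=
    fun θ p => Real.cos θ • p.1 + Real.sin θ • p.2
  have hU : ∀ θ, Continuous (U θ) := fun θ => by fun_prop
  have h1 : ∀ i, Integrable (fun p : (Fin n → ℝ) × (Fin n → ℝ) => p.1 i) (μ.prod ν) :=
    fun i => (hμi i).comp_fst ν
  have h2 : ∀ i, Integrable (fun p : (Fin n → ℝ) × (Fin n → ℝ) => p.2 i) (μ.prod ν) :=
    fun i => (hνi i).comp_snd μ
  have hfm : ∀ i θ, AEStronglyMeasurable (fun p => f i (U θ p)) (μ.prod ν) := fun i θ =>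
    ((hf.continuous_field i).comp (hU θ)).aestronglyMeasurable
  have hf1 : ∀ i θ, Integrable (fun p => p.1 i * f i (U θ p)) (μ.prod ν) := fun i θ =>
    (h1 i).mul_bdd (hfm i θ) (ae_of_all _ fun p => hB i _)
  have hf2 : ∀ i θ, Integrable (fun p => p.2 i * f i (U θ p)) (μ.prod ν) := fun i θ =>
    (h2 i).mul_bdd (hfm i θ) (ae_of_all _ fun p => hB i _)
  have hGc : Continuous G := continuous_iff_continuousAt.2 fun x => (hG x).continuousAt
  let G' : ℝ → (Fin n → ℝ) × (Fin n → ℝ) → ℝ := fun θ p =>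
    ∑ i, (-Real.sin θ * p.1 i + Real.cos θ * p.2 i) * f i (U θ p)
  have hderiv : ∀ p θ, HasDerivAt (fun θ => G (U θ p)) (G' θ p) θ := fun p θ => by
    have hu : HasDerivAt (fun θ => U θ p) (-Real.sin θ • p.1 + Real.cos θ • p.2) θ :=
      ((Real.hasDerivAt_cos θ).smul_const p.1).add ((Real.hasDerivAt_sin θ).smul_const p.2)
    have := (hG (U θ p)).comp_hasDerivAt θ hu
    convert! this using 1
    simp [G', mul_comm]
  have hbound : ∀ p θ, ‖G' θ p‖ ≤ ∑ i, (|p.1 i| + |p.2 i|) * B := fun p θ => by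
    refine (norm_sum_le _ _).trans (Finset.sum_le_sum fun i _ => ?_)
    rw [norm_mul]
    refine mul_le_mul ?_ (hB i _) (norm_nonneg _) (by positivity)
    refine (norm_add_le _ _).trans (add_le_add ?_ ?_)
    · rw [norm_mul, norm_neg]
      exact mul_le_of_le_one_left (abs_nonneg _) (Real.abs_sin_le_one θ)
    · rw [norm_mul]
      exact mul_le_of_le_one_left (abs_nonneg _) (Real.abs_cos_le_one θ)
  have hbi : Integrable (fun p : (Fin n → ℝ) × (Fin n → ℝ) =>
      ∑ i, (|p.1 i| + |p.2 i|) * B) (μ.prod ν) :=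
    integrable_finsetSum _ fun i _ => (((h1 i).abs).add (h2 i).abs).mul_const B
  have hG0 : Integrable (fun p => G (U 0 p)) (μ.prod ν) := by
    simpa [U] using hGμ.comp_fst ν
  have hGm : ∀ θ, AEStronglyMeasurable (fun p => G (U θ p)) (μ.prod ν) := fun θ =>
    (hGc.comp (hU θ)).aestronglyMeasurable
  -- Integrability of `G` is assumed under `μ` only, that is, at `θ = 0`. It is carried to every `θ`
  -- by the uniform bound on the derivative in `θ`.
  have hGθ : ∀ θ, Integrable (fun p => G (U θ p)) (μ.prod ν) := fun θ => by
    have hd : Integrable (fun p => G (U θ p) - G (U 0 p)) (μ.prod ν) := by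
      refine (hbi.const_mul |θ|).mono' ((hGm θ).sub (hGm 0)) (ae_of_all _ fun p => ?_)
      have := Convex.norm_image_sub_le_of_norm_hasDerivWithin_le (s := Set.univ)
        (fun t _ => (hderiv p t).hasDerivWithinAt) (fun t _ => hbound p t) convex_univ
        (Set.mem_univ 0) (Set.mem_univ θ)
      simpa [mul_comm] using this
    refine (hd.add hG0).congr (ae_of_all _ fun p => ?_)
    simp
  let h : ℝ → ℝ := fun θ => ∫ p, G (U θ p) ∂μ.prod ν
  have hh : ∀ θ, HasDerivAt h (∫ p, G' θ p ∂μ.prod ν) θ := fun θ =>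
    (hasDerivAt_integral_of_dominated_loc_of_deriv_le (s := Set.univ) univ_mem
      (.of_forall hGm) (hGθ θ)
      (by
        refine Continuous.aestronglyMeasurable ?_
        refine continuous_finsetSum _ fun i _ => ?_
        exact (by fun_prop : Continuous fun p : (Fin n → ℝ) × (Fin n → ℝ) =>
          -Real.sin θ * p.1 i + Real.cos θ * p.2 i).mul ((hf.continuous_field i).comp (hU θ)))
      (ae_of_all _ fun p t _ => hbound p t) hbi (ae_of_all _ fun p t _ => hderiv p t)).2
  -- The antiderivative, vanishing at `0`, of the error `κ (ε₁ cos² θ sin θ + ε₂ sin² θ cos θ)`. Its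
  -- value at `π / 2` is the claimed bound.
  let φ : ℝ → ℝ := fun θ =>
    κ / 3 * (ε₁ * (1 - Real.cos θ ^ 3) + ε₂ * Real.sin θ ^ 3)
  have hφ : ∀ θ, HasDerivAt φ
      (κ * (ε₁ * (Real.cos θ ^ 2 * Real.sin θ) + ε₂ * (Real.sin θ ^ 2 * Real.cos θ))) θ :=
      fun θ => by
    have a1 := (((Real.hasDerivAt_cos θ).pow 3).const_sub 1).const_mul ε₁
    have a2 := ((Real.hasDerivAt_sin θ).pow 3).const_mul ε₂
    convert! (a1.add a2).const_mul (κ / 3) using 1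
    push_cast
    ring
  have hd : ∀ θ ∈ Set.Ico 0 (Real.pi / 2), ‖∫ p, G' θ p ∂μ.prod ν‖ ≤
      κ * (ε₁ * (Real.cos θ ^ 2 * Real.sin θ) + ε₂ * (Real.sin θ ^ 2 * Real.cos θ)) := by
    intro θ hθ
    have hs : 0 ≤ Real.sin θ :=
      Real.sin_nonneg_of_nonneg_of_le_pi hθ.1 (by linarith [hθ.2, Real.pi_pos])
    have hc : 0 ≤ Real.cos θ := Real.cos_nonneg_of_neg_pi_div_two_le_of_le
      (by linarith [hθ.1, Real.pi_pos]) hθ.2.le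
    have hi1 : Integrable (fun p => ∑ i, p.1 i * f i (U θ p)) (μ.prod ν) :=
      integrable_finsetSum _ fun i _ => hf1 i θ
    have hi2 : Integrable (fun p => ∑ i, p.2 i * f i (U θ p)) (μ.prod ν) :=
      integrable_finsetSum _ fun i _ => hf2 i θ
    have b1 := hμ.rotated_left hf (Real.cos θ) (Real.sin θ) hi1
    have b2 := hν.rotated_right hf (Real.cos θ) (Real.sin θ) hi2
    have e : ∫ p, G' θ p ∂μ.prod ν = -Real.sin θ * ∫ p, ∑ i, p.1 i * f i (U θ p) ∂μ.prod ν
        + Real.cos θ * ∫ p, ∑ i, p.2 i * f i (U θ p) ∂μ.prod ν := by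
      rw [← integral_const_mul, ← integral_const_mul,
        ← integral_add (hi1.const_mul _) (hi2.const_mul _)]
      refine integral_congr_ae (ae_of_all _ fun p => ?_)
      simp only [G', Finset.mul_sum, ← Finset.sum_add_distrib]
      refine Finset.sum_congr rfl fun i _ => by ring
    rw [e, Real.norm_eq_abs]
    change |∫ p, ∑ i, p.1 i * f i (U θ p) ∂μ.prod ν - _| ≤ _ at b1
    change |∫ p, ∑ i, p.2 i * f i (U θ p) ∂μ.prod ν - _| ≤ _ at b2
    rw [abs_le] at b1 b2 ⊢
    -- Weighting the two estimates by `sin θ` and `cos θ`, both nonnegative on the quarter circle,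
    -- lets the covariance terms cancel in the final linear arithmetic.
    have c1 := mul_le_mul_of_nonneg_left b1.1 hs
    have c2 := mul_le_mul_of_nonneg_left b1.2 hs
    have c3 := mul_le_mul_of_nonneg_left b2.1 hc
    have c4 := mul_le_mul_of_nonneg_left b2.2 hc
    constructor <;> linarith
  have main := image_norm_le_of_norm_deriv_right_le_deriv_boundary
    (f := fun θ => h θ - h 0) (a := 0) (b := Real.pi / 2)
    (fun θ _ => ((hh θ).sub_const _).continuousAt.continuousWithinAt)
    (fun θ _ => ((hh θ).sub_const _).hasDerivWithinAt) (by simp [φ]) hφ hd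
    (Set.right_mem_Icc.2 (by positivity))
  have e0 : h 0 = ∫ x, G x ∂μ := by
    simp only [h, U, Real.cos_zero, Real.sin_zero, one_smul, zero_smul, add_zero]
    rw [integral_fun_fst (μ := μ) (ν := ν) G]; simp
  have e1 : h (Real.pi / 2) = ∫ x, G x ∂ν := by
    simp only [h, U, Real.cos_pi_div_two, Real.sin_pi_div_two, one_smul, zero_smul, zero_add]
    rw [integral_fun_snd (μ := μ) (ν := ν) G]; simp
  rw [e0, e1, Real.norm_eq_abs, abs_sub_comm] at main
  simpa [φ] using main

end Interpolation

/-! ### Averages over a uniform permutation -/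

section PermAvg

variable {n : ℕ}

/-- The average of `F` over all permutations of `Fin n`. -/
def permAvg (F : Equiv.Perm (Fin n) → ℝ) : ℝ := (n.factorial : ℝ)⁻¹ * ∑ τ, F τ

theorem permAvg_add (F G : Equiv.Perm (Fin n) → ℝ) :
    permAvg (fun τ => F τ + G τ) = permAvg F + permAvg G := by
  simp only [permAvg, Finset.sum_add_distrib, mul_add]

theorem permAvg_sub (F G : Equiv.Perm (Fin n) → ℝ) :
    permAvg (fun τ => F τ - G τ) = permAvg F - permAvg G := by
  simp only [permAvg, Finset.sum_sub_distrib, mul_sub]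

theorem permAvg_const_mul (a : ℝ) (F : Equiv.Perm (Fin n) → ℝ) :
    permAvg (fun τ => a * F τ) = a * permAvg F := by
  simp only [permAvg, ← Finset.mul_sum]; ring

theorem permAvg_sum {ι : Type*} (s : Finset ι) (F : ι → Equiv.Perm (Fin n) → ℝ) :
    permAvg (fun τ => ∑ i ∈ s, F i τ) = ∑ i ∈ s, permAvg (F i) := by
  simp only [permAvg]
  rw [Finset.sum_comm, Finset.mul_sum]

theorem permAvg_mono {F G : Equiv.Perm (Fin n) → ℝ} (h : ∀ τ, F τ ≤ G τ) :
    permAvg F ≤ permAvg G :=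
  mul_le_mul_of_nonneg_left (Finset.sum_le_sum fun τ _ => h τ) (by positivity)

theorem permAvg_abs_le (F : Equiv.Perm (Fin n) → ℝ) : |permAvg F| ≤ permAvg fun τ => |F τ| := by
  rw [permAvg, permAvg, abs_mul, abs_of_nonneg (by positivity : (0 : ℝ) ≤ (n.factorial : ℝ)⁻¹)]
  exact mul_le_mul_of_nonneg_left (Finset.abs_sum_le_sum_abs _ _) (by positivity)

theorem abs_permAvg_le {F G : Equiv.Perm (Fin n) → ℝ} (h : ∀ τ, |F τ| ≤ G τ) :
    |permAvg F| ≤ permAvg G :=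
  (permAvg_abs_le F).trans (permAvg_mono h)

theorem permAvg_const (a : ℝ) : permAvg (fun _ : Equiv.Perm (Fin n) => a) = a := by
  have : (n.factorial : ℝ) ≠ 0 := by positivity
  simp [permAvg, Fintype.card_perm, this]

theorem permAvg_mul_right (F : Equiv.Perm (Fin n) → ℝ) (σ : Equiv.Perm (Fin n)) :
    permAvg (fun τ => F (τ * σ)) = permAvg F := by
  rw [permAvg, permAvg]
  congr 1
  exact Equiv.sum_comp (Equiv.mulRight σ) F

/-- Right translation preserves the uniform law on the group, so it may be averaged over the
transpositions of `i` with all `j`, including the trivial one `j = i`. After this step the value at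
`i` is `τ j` with `j` uniform and independent of `τ`. -/
theorem permAvg_resample (F : Equiv.Perm (Fin n) → ℝ) (i : Fin n) :
    permAvg F = 1 / (n : ℝ) * ∑ j, permAvg fun τ => F (τ * Equiv.swap i j) := by
  have hn : (n : ℝ) ≠ 0 := by
    have : 0 < n := (Nat.zero_le _).trans_lt i.2
    positivity
  simp only [permAvg_mul_right]
  simp
  field_simp

theorem permAvg_apply (φ : Fin n → ℝ) (i : Fin n) :
    permAvg (fun τ => φ (τ i)) = 1 / (n : ℝ) * ∑ k, φ k := by
  rw [permAvg_resample _ i, ← permAvg_sum]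
  congr 1
  simp only [Equiv.Perm.mul_apply, Equiv.swap_apply_left]
  simp only [Equiv.sum_comp, permAvg_const]

/-- A further position contributes at most its average over the unused values. -/
theorem permAvg_mul_apply_le {χ : Fin n → ℝ} (hχ : ∀ k, 0 ≤ χ k) (S : Finset (Fin n))
    {Φ : Equiv.Perm (Fin n) → ℝ} (hΦ0 : ∀ τ, 0 ≤ Φ τ)
    (hΦ : ∀ (τ : Equiv.Perm (Fin n)) (b b' : Fin n), b ∉ S → b' ∉ S →
      Φ (τ * Equiv.swap b b') = Φ τ) {b : Fin n} (hb : b ∉ S) :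
    ((n : ℝ) - S.card) * permAvg (fun τ => χ (τ b) * Φ τ) ≤ (∑ k, χ k) * permAvg Φ := by
  -- All positions outside `S` contribute equally, by exchanging `b` and `b'`. There are `n - |S|`
  -- of them, and together their values of `χ` sum to at most the full sum since `τ` is injective.
  have h1 : ∀ b' ∈ Sᶜ, permAvg (fun τ => χ (τ b') * Φ τ) = permAvg (fun τ => χ (τ b) * Φ τ) := by
    intro b' hb'
    rw [← permAvg_mul_right _ (Equiv.swap b b')]
    simp only [Equiv.Perm.mul_apply, Equiv.swap_apply_right]
    simp only [hΦ _ b b' hb (Finset.mem_compl.1 hb')]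
  have h2 : ((n : ℝ) - S.card) * permAvg (fun τ => χ (τ b) * Φ τ)
      = ∑ b' ∈ Sᶜ, permAvg (fun τ => χ (τ b') * Φ τ) := by
    rw [Finset.sum_congr rfl h1, Finset.sum_const, nsmul_eq_mul, Finset.card_compl,
      Fintype.card_fin, Nat.cast_sub (by simpa using Finset.card_le_univ S)]
  rw [h2, ← permAvg_sum, ← permAvg_const_mul]
  refine permAvg_mono fun τ => ?_
  rw [← Finset.sum_mul]
  refine mul_le_mul_of_nonneg_right ?_ (hΦ0 τ)
  rw [← Equiv.sum_comp τ χ]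
  exact Finset.sum_le_sum_of_subset_of_nonneg (Finset.subset_univ _) fun _ _ _ => hχ _

theorem permAvg_two_le (hn : 2 ≤ n) {φ ψ : Fin n → ℝ} (hφ : ∀ k, 0 ≤ φ k) (hψ : ∀ k, 0 ≤ ψ k)
    {p q : Fin n} (hpq : p ≠ q) :
    permAvg (fun τ => φ (τ p) * ψ (τ q)) ≤
      1 / ((n : ℝ) * (n - 1)) * ((∑ k, φ k) * ∑ k, ψ k) := by
  have h := permAvg_mul_apply_le hφ {q} (Φ := fun τ => ψ (τ q)) (fun τ => hψ _)
    (fun τ b b' hb hb' => by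
      simp only [Finset.mem_singleton] at hb hb'
      simp [Equiv.swap_apply_of_ne_of_ne (Ne.symm hb) (Ne.symm hb')]) (b := p) (by simpa using hpq)
  rw [permAvg_apply, Finset.card_singleton, Nat.cast_one] at h
  have hn' : (2 : ℝ) ≤ n := by exact_mod_cast hn
  have h1 : 0 < (n : ℝ) - 1 := by linarith
  rw [one_div, ← div_eq_inv_mul, le_div_iff₀ (by positivity)]
  have : (n : ℝ) * ((∑ k, φ k) * (1 / (n : ℝ) * ∑ k, ψ k)) = (∑ k, φ k) * ∑ k, ψ k := by
    field_simp
  rw [← this]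
  nlinarith

/-- The natural constant is `1 / (n (n - 1) (n - 2))`. Three distinct positions force `n ≥ 3`, and
then it is at most `(9 / 2) / n³`, with equality at `n = 3`. -/
theorem permAvg_three_le {φ ψ χ : Fin n → ℝ} (hφ : ∀ k, 0 ≤ φ k)
    (hψ : ∀ k, 0 ≤ ψ k) (hχ : ∀ k, 0 ≤ χ k) {p q r : Fin n} (hpq : p ≠ q) (hpr : p ≠ r)
    (hqr : q ≠ r) :
    permAvg (fun τ => φ (τ p) * (ψ (τ q) * χ (τ r))) ≤
      9 / 2 / (n : ℝ) ^ 3 * ((∑ k, φ k) * ((∑ k, ψ k) * ∑ k, χ k)) := by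
  have hn : 3 ≤ n := by
    have := Finset.card_le_univ ({p, q, r} : Finset (Fin n))
    rwa [Finset.card_eq_three.2 ⟨p, q, r, hpq, hpr, hqr, rfl⟩, Fintype.card_fin] at this
  have h := permAvg_mul_apply_le hφ {q, r} (Φ := fun τ => ψ (τ q) * χ (τ r))
    (fun τ => mul_nonneg (hψ _) (hχ _))
    (fun τ b b' hb hb' => by
      simp only [Finset.mem_insert, Finset.mem_singleton, not_or] at hb hb'
      simp [Equiv.swap_apply_of_ne_of_ne (Ne.symm hb.1) (Ne.symm hb'.1),
        Equiv.swap_apply_of_ne_of_ne (Ne.symm hb.2) (Ne.symm hb'.2)]) (b := p)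
    (by simp [hpq, hpr])
  rw [Finset.card_pair hqr] at h
  have h2 := permAvg_two_le (by omega) hψ hχ hqr
  have hn' : (3 : ℝ) ≤ n := by exact_mod_cast hn
  have h1 : 0 < (n : ℝ) - 1 := by linarith
  have h3 : 0 < (n : ℝ) - 2 := by linarith
  push_cast at h
  have hs : 0 ≤ ∑ k, φ k := Finset.sum_nonneg fun k _ => hφ k
  have hs2 : 0 ≤ ∑ k, ψ k := Finset.sum_nonneg fun k _ => hψ k
  have hs3 : 0 ≤ ∑ k, χ k := Finset.sum_nonneg fun k _ => hχ k
  have h4 := h.trans (mul_le_mul_of_nonneg_left h2 hs)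
  rw [← le_div_iff₀' h3] at h4
  refine h4.trans ?_
  have e : (∑ k, φ k) * (1 / ((n : ℝ) * (n - 1)) * ((∑ k, ψ k) * ∑ k, χ k)) / ((n : ℝ) - 2)
      = 1 / ((n : ℝ) * (n - 1) * (n - 2)) * ((∑ k, φ k) * ((∑ k, ψ k) * ∑ k, χ k)) := by
    field_simp
  rw [e]
  refine mul_le_mul_of_nonneg_right ?_ (by positivity)
  rw [div_div, div_le_div_iff₀ (by positivity) (by positivity)]
  -- This is `9 n (n - 1) (n - 2) - 2 n³`, factored.
  have h5 : 0 ≤ (n : ℝ) * (((n : ℝ) - 3) * (7 * n - 6)) :=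
    mul_nonneg (by positivity) (mul_nonneg (by linarith) (by linarith))
  nlinarith

/-- After resampling, the first factor is `φ (τ j)`, whose sum over `j` is the constant `∑ k, φ k`.
If the second factor were exactly `Ψ' τ` for every `j`, the average would factor; the error is what
the transposition does to `Ψ`. -/
theorem permAvg_decouple {φ : Fin n → ℝ} {Ψ Ψ' : Equiv.Perm (Fin n) → ℝ} (i : Fin n)
    {δ : Fin n → Equiv.Perm (Fin n) → ℝ}
    (h : ∀ j τ, |Ψ (τ * Equiv.swap i j) - Ψ' τ| ≤ δ j τ) :
    |permAvg (fun τ => φ (τ i) * Ψ τ) - 1 / (n : ℝ) * (∑ k, φ k) * permAvg Ψ'| ≤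
      1 / (n : ℝ) * ∑ j, permAvg fun τ => |φ (τ j)| * δ j τ := by
  have e : permAvg (fun τ => φ (τ i) * Ψ τ) - 1 / (n : ℝ) * (∑ k, φ k) * permAvg Ψ'
      = 1 / (n : ℝ) * ∑ j, permAvg fun τ => φ (τ j) * (Ψ (τ * Equiv.swap i j) - Ψ' τ) := by
    rw [permAvg_resample _ i]
    simp only [mul_sub, permAvg_sub, Finset.sum_sub_distrib]
    rw [← permAvg_sum _ fun j τ => φ (τ j) * Ψ' τ]
    simp only [← Finset.sum_mul, Equiv.sum_comp, permAvg_const_mul, Equiv.Perm.mul_apply,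
      Equiv.swap_apply_left]
    ring
  rw [e, abs_mul, abs_of_nonneg (by positivity : (0 : ℝ) ≤ 1 / (n : ℝ))]
  refine mul_le_mul_of_nonneg_left ((Finset.abs_sum_le_sum_abs _ _).trans
    (Finset.sum_le_sum fun j _ => abs_permAvg_le fun τ => ?_)) (by positivity)
  rw [abs_mul]
  exact mul_le_mul_of_nonneg_left (h j τ) (abs_nonneg _)

end PermAvg

/-! ### Combinatorial estimates for permutation statistics -/

section PermEstimates

theorem sum_linear_comb {ι : Type*} (s : Finset ι) (a b : ℝ) (F G : ι → ℝ) :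
    ∑ j ∈ s, (a * F j + b * G j) = a * ∑ j ∈ s, F j + b * ∑ j ∈ s, G j := by
  rw [Finset.sum_add_distrib, Finset.mul_sum, Finset.mul_sum]

variable {n : ℕ} {κ : ℝ} {c m m₂ m₃ : Fin n → Fin n → ℝ}

/-- The source of the diagonal covariances. In the application `h` is the mean of `H i i` at the
full vector and `b` its mean with coordinate `i` set to zero, both given the permutation. -/
theorem permAvg_diag_le (hn : 2 ≤ n) (hκ : 0 ≤ κ) (hm : ∀ i k, 0 ≤ m i k) (hm₂ : ∀ i k, 0 ≤ m₂ i k)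
    (i : Fin n) {b h : Equiv.Perm (Fin n) → ℝ}
    (hb : ∀ j τ, |b (τ * Equiv.swap i j) - h τ| ≤
      κ * (m i (τ i) + if j = i then 0 else m j (τ i) + m j (τ j))) :
    |permAvg (fun τ => m₂ i (τ i) * b τ) - 1 / (n : ℝ) * (∑ k, m₂ i k) * permAvg h| ≤
      κ * (1 / (n : ℝ) ^ 2 * ((∑ k, m₂ i k) * ∑ k, m i k)
        + 1 / ((n : ℝ) ^ 2 * (n - 1)) * ∑ j, (∑ k, m₂ i k) * ∑ k, m j k
        + 1 / (n : ℝ) ^ 2 * ∑ j, ∑ k, m₂ i k * m j k) := by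
  have hn' : (2 : ℝ) ≤ n := by exact_mod_cast hn
  have h1 : 0 < (n : ℝ) - 1 := by linarith
  refine (permAvg_decouple i hb).trans ?_
  have e1 : ∑ j, permAvg (fun τ => m₂ i (τ j) * m i (τ i))
      = (∑ k, m₂ i k) * (1 / (n : ℝ) * ∑ k, m i k) := by
    rw [← permAvg_sum]
    simp only [← Finset.sum_mul, Equiv.sum_comp]
    rw [permAvg_const_mul, permAvg_apply]
  have e2 : ∀ j, permAvg (fun τ => m₂ i (τ j) * if j = i then 0 else m j (τ i) + m j (τ j)) ≤
      1 / ((n : ℝ) * (n - 1)) * ((∑ k, m₂ i k) * ∑ k, m j k)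
        + 1 / (n : ℝ) * ∑ k, m₂ i k * m j k := fun j => by
    have s1 : 0 ≤ ∑ k, m₂ i k := Finset.sum_nonneg fun k _ => hm₂ i k
    have s2 : 0 ≤ ∑ k, m j k := Finset.sum_nonneg fun k _ => hm j k
    have s3 : 0 ≤ ∑ k, m₂ i k * m j k :=
      Finset.sum_nonneg fun k _ => mul_nonneg (hm₂ i k) (hm j k)
    by_cases hji : j = i
    · simp only [hji, if_true, mul_zero, permAvg_const]
      subst hji
      positivity
    · simp only [hji, if_false, mul_add, permAvg_add]
      refine add_le_add (permAvg_two_le hn (hm₂ i) (hm j) hji) (le_of_eq ?_)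
      exact permAvg_apply (fun k => m₂ i k * m j k) j
  have e3 : ∑ j, permAvg (fun τ => |m₂ i (τ j)| *
      (κ * (m i (τ i) + if j = i then 0 else m j (τ i) + m j (τ j))))
      = κ * (∑ j, permAvg (fun τ => m₂ i (τ j) * m i (τ i)) +
        ∑ j, permAvg (fun τ => m₂ i (τ j) * if j = i then 0 else m j (τ i) + m j (τ j))) := by
    rw [← Finset.sum_add_distrib, Finset.mul_sum]
    refine Finset.sum_congr rfl fun j _ => ?_
    rw [← permAvg_add, ← permAvg_const_mul]
    congr 1
    ext τ
    rw [abs_of_nonneg (hm₂ _ _)]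
    ring
  rw [e3, e1]
  have e4 := Finset.sum_le_sum fun j (_ : j ∈ Finset.univ) => e2 j
  rw [sum_linear_comb] at e4
  rw [mul_left_comm]
  refine mul_le_mul_of_nonneg_left ?_ hκ
  refine (mul_le_mul_of_nonneg_left (add_le_add_right e4 _) (by positivity)).trans (le_of_eq ?_)
  field_simp
  ring

/-- Because row `i` of `c` sums to zero, `∑ j, c i (τ j) * a τ` vanishes and may be subtracted after
resampling. What remains is the increment of `a` under the transposition. Its first order part, `c j
(τ i) - c j (τ j)` times a derivative `q`, is kept, and the second order part goes into the error.
-/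
theorem permAvg_linear_le (hn : 2 ≤ n) (hκ : 0 ≤ κ) (hm₂ : ∀ i k, 0 ≤ m₂ i k)
    (hc : ∀ i k, |c i k| ≤ m i k) (hc0 : ∀ i, ∑ k, c i k = 0)
    (i : Fin n) {a : Equiv.Perm (Fin n) → ℝ} {q : Fin n → Equiv.Perm (Fin n) → ℝ}
    (ha : ∀ j, j ≠ i → ∀ τ, |a (τ * Equiv.swap i j) - a τ - (c j (τ i) - c j (τ j)) * q j τ| ≤
      κ * (m₂ j (τ i) + m₂ j (τ j))) :
    |permAvg (fun τ => c i (τ i) * a τ) - 1 / (n : ℝ) * ∑ j ∈ Finset.univ.erase i,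
        permAvg (fun τ => c i (τ j) * (c j (τ i) - c j (τ j)) * q j τ)| ≤
      κ * (1 / ((n : ℝ) ^ 2 * (n - 1)) * ∑ j, (∑ k, m i k) * ∑ k, m₂ j k
        + 1 / (n : ℝ) ^ 2 * ∑ j, ∑ k, m i k * m₂ j k) := by
  have hm : ∀ i k, 0 ≤ m i k := fun i k => (abs_nonneg _).trans (hc i k)
  have hn' : (2 : ℝ) ≤ n := by exact_mod_cast hn
  have h1 : 0 < (n : ℝ) - 1 := by linarith
  have e0 : permAvg (fun τ => c i (τ i) * a τ) = 1 / (n : ℝ) * ∑ j ∈ Finset.univ.erase i,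
      permAvg (fun τ => c i (τ j) * (a (τ * Equiv.swap i j) - a τ)) := by
    have z : ∑ j, permAvg (fun τ => c i (τ j) * a τ) = 0 := by
      rw [← permAvg_sum]
      simp only [← Finset.sum_mul, Equiv.sum_comp, hc0, zero_mul, permAvg_const]
    rw [permAvg_resample _ i, ← sub_zero (∑ j, permAvg _), ← z, ← Finset.sum_sub_distrib,
      ← Finset.sum_erase (a := i) Finset.univ]
    · simp only [← permAvg_sub, Equiv.Perm.mul_apply, Equiv.swap_apply_left, ← mul_sub]
    · simp only [Equiv.swap_self, ← Equiv.Perm.one_def, mul_one, sub_self]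
  rw [e0, ← mul_sub, ← Finset.sum_sub_distrib, abs_mul,
    abs_of_nonneg (by positivity : (0 : ℝ) ≤ 1 / (n : ℝ))]
  have e1 : ∀ j ∈ Finset.univ.erase i,
      |permAvg (fun τ => c i (τ j) * (a (τ * Equiv.swap i j) - a τ))
        - permAvg (fun τ => c i (τ j) * (c j (τ i) - c j (τ j)) * q j τ)| ≤
      κ * (1 / ((n : ℝ) * (n - 1)) * ((∑ k, m i k) * ∑ k, m₂ j k)
        + 1 / (n : ℝ) * ∑ k, m i k * m₂ j k) := fun j hj => by
    have hj' := Finset.ne_of_mem_erase hj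
    rw [← permAvg_sub]
    refine (abs_permAvg_le (G := fun τ => κ * (m i (τ j) * m₂ j (τ i) + m i (τ j) * m₂ j (τ j)))
      fun τ => ?_).trans ?_
    · rw [mul_assoc, ← mul_sub, abs_mul, ← mul_add, mul_left_comm]
      exact mul_le_mul (hc _ _) (ha j hj' τ) (abs_nonneg _) (hm _ _)
    · rw [permAvg_const_mul, permAvg_add]
      refine mul_le_mul_of_nonneg_left (add_le_add (permAvg_two_le hn (hm i) (hm₂ j) hj')
        (le_of_eq ?_)) hκ
      exact permAvg_apply (fun k => m i k * m₂ j k) j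
  have e2 := (Finset.abs_sum_le_sum_abs _ _).trans (Finset.sum_le_sum e1)
  have e3 := e2.trans (Finset.sum_le_sum_of_subset_of_nonneg (Finset.erase_subset _ _)
    fun j _ _ => mul_nonneg hκ (add_nonneg (mul_nonneg (by positivity) (mul_nonneg
      (Finset.sum_nonneg fun k _ => hm _ _) (Finset.sum_nonneg fun k _ => hm₂ _ _)))
      (mul_nonneg (by positivity) (Finset.sum_nonneg fun k _ => mul_nonneg (hm _ _) (hm₂ _ _)))))
  rw [← Finset.mul_sum, sum_linear_comb] at e3
  refine (mul_le_mul_of_nonneg_left e3 (by positivity)).trans (le_of_eq ?_)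
  field_simp

/-- The difference on the left has a part with both rows at position `j`, and a cross part `c i (τ
j) * c j (τ i)`. In the cross part `j` is exchanged with every `b ≠ i`. As row `i` sums to zero and
`q` is invariant under the swap of `i` and `j`, this gives `-1 / (n - 1)` times the same-position
part, plus a remainder. The total coefficient is `-(1 + 1 / (n - 1)) = -n / (n - 1)`. -/
theorem permAvg_two_point_eq (hn : 2 ≤ n) (hc0 : ∀ i, ∑ k, c i k = 0) {i j : Fin n} (hij : j ≠ i)
    {q : Equiv.Perm (Fin n) → ℝ} (hq : ∀ τ, q (τ * Equiv.swap i j) = q τ) :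
    permAvg (fun τ => c i (τ j) * (c j (τ i) - c j (τ j)) * q τ)
      = -((n : ℝ) / (n - 1)) * permAvg (fun τ => c i (τ j) * c j (τ j) * q τ)
        + 1 / ((n : ℝ) - 1) * ∑ b ∈ Finset.univ.erase i,
          permAvg (fun τ => c i (τ b) * c j (τ i) * (q (τ * Equiv.swap j b) - q τ)) := by
  have hn' : (2 : ℝ) ≤ n := by exact_mod_cast hn
  have h1 : (n : ℝ) - 1 ≠ 0 := by linarith
  have e1 : ∀ b ∈ Finset.univ.erase i, permAvg (fun τ => c i (τ j) * c j (τ i) * q τ)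
      = permAvg (fun τ => c i (τ b) * c j (τ i) * q (τ * Equiv.swap j b)) := fun b hb => by
    rw [← permAvg_mul_right _ (Equiv.swap j b)]
    simp only [Equiv.Perm.mul_apply, Equiv.swap_apply_left,
      Equiv.swap_apply_of_ne_of_ne hij.symm (Finset.ne_of_mem_erase hb).symm]
  have e2 : ((n : ℝ) - 1) * permAvg (fun τ => c i (τ j) * c j (τ i) * q τ)
      = ∑ b ∈ Finset.univ.erase i,
        permAvg (fun τ => c i (τ b) * c j (τ i) * q (τ * Equiv.swap j b)) := by
    rw [← Finset.sum_congr rfl e1, Finset.sum_const, Finset.card_erase_of_mem (Finset.mem_univ _),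
      Finset.card_univ, Fintype.card_fin, nsmul_eq_mul, Nat.cast_sub (by omega)]
    simp
  have e3 : ∑ b ∈ Finset.univ.erase i, permAvg (fun τ => c i (τ b) * c j (τ i) * q τ)
      = -permAvg (fun τ => c i (τ j) * c j (τ j) * q τ) := by
    have z : ∑ b, permAvg (fun τ => c i (τ b) * c j (τ i) * q τ) = 0 := by
      rw [← permAvg_sum]
      simp only [← Finset.sum_mul, Equiv.sum_comp, hc0, zero_mul, permAvg_const]
    rw [← Finset.add_sum_erase _ _ (Finset.mem_univ i)] at z
    rw [← permAvg_mul_right (fun τ => c i (τ j) * c j (τ j) * q τ) (Equiv.swap i j)]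
    simp only [Equiv.Perm.mul_apply, Equiv.swap_apply_right, hq]
    linarith
  have e4 : ∑ b ∈ Finset.univ.erase i,
      permAvg (fun τ => c i (τ b) * c j (τ i) * (q (τ * Equiv.swap j b) - q τ))
      = ((n : ℝ) - 1) * permAvg (fun τ => c i (τ j) * c j (τ i) * q τ)
        + permAvg (fun τ => c i (τ j) * c j (τ j) * q τ) := by
    simp only [mul_sub, permAvg_sub, Finset.sum_sub_distrib]
    rw [e2, e3]
    ring
  rw [e4]
  simp only [mul_sub, sub_mul, permAvg_sub]
  field_simp
  ring

theorem permAvg_offdiag_le (hn : 2 ≤ n) (hκ : 0 ≤ κ) (hc : ∀ i k, |c i k| ≤ m i k)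
    {i j : Fin n} {q h : Equiv.Perm (Fin n) → ℝ}
    (hq : ∀ b τ, |q (τ * Equiv.swap j b) - h τ| ≤
      κ * (m i (τ i) + m j (τ j) + if b = j then 0 else m b (τ j) + m b (τ b))) :
    |permAvg (fun τ => c i (τ j) * c j (τ j) * q τ)
        - 1 / (n : ℝ) * (∑ k, c i k * c j k) * permAvg h| ≤
      κ * (1 / (n : ℝ) ^ 2 * ((∑ k, m i k * m j k) * (∑ k, m i k + ∑ k, m j k))
        + 1 / ((n : ℝ) ^ 2 * (n - 1)) * ∑ b, (∑ k, m i k * m j k) * ∑ k, m b k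
        + 1 / (n : ℝ) ^ 2 * ∑ b, ∑ k, m i k * m j k * m b k) := by
  have hm : ∀ i k, 0 ≤ m i k := fun i k => (abs_nonneg _).trans (hc i k)
  have hmm : ∀ k, 0 ≤ m i k * m j k := fun k => mul_nonneg (hm _ _) (hm _ _)
  have hn' : (2 : ℝ) ≤ n := by exact_mod_cast hn
  have h1 : 0 < (n : ℝ) - 1 := by linarith
  refine (permAvg_decouple (φ := fun k => c i k * c j k) j hq).trans ?_
  have e1 : ∑ b, permAvg (fun τ => m i (τ b) * m j (τ b) * (m i (τ i) + m j (τ j)))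
      = (∑ k, m i k * m j k) * (1 / (n : ℝ) * (∑ k, m i k + ∑ k, m j k)) := by
    rw [← permAvg_sum]
    simp only [← Finset.sum_mul]
    have : ∀ τ : Equiv.Perm (Fin n), ∑ b, m i (τ b) * m j (τ b) = ∑ k, m i k * m j k :=
      fun τ => Equiv.sum_comp τ fun k => m i k * m j k
    simp only [this]
    rw [permAvg_const_mul, permAvg_add, permAvg_apply, permAvg_apply]
    ring
  have e2 : ∀ b, permAvg (fun τ => m i (τ b) * m j (τ b) *
        if b = j then 0 else m b (τ j) + m b (τ b)) ≤
      1 / ((n : ℝ) * (n - 1)) * ((∑ k, m i k * m j k) * ∑ k, m b k)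
        + 1 / (n : ℝ) * ∑ k, m i k * m j k * m b k := fun b => by
    have s1 : 0 ≤ ∑ k, m i k * m j k := Finset.sum_nonneg fun k _ => hmm k
    have s2 : 0 ≤ ∑ k, m b k := Finset.sum_nonneg fun k _ => hm b k
    have s3 : 0 ≤ ∑ k, m i k * m j k * m b k :=
      Finset.sum_nonneg fun k _ => mul_nonneg (hmm k) (hm b k)
    by_cases hbj : b = j
    · simp only [hbj, if_true, mul_zero, permAvg_const]
      subst hbj
      positivity
    · simp only [hbj, if_false, mul_add, permAvg_add]
      refine add_le_add (permAvg_two_le hn hmm (hm b) hbj) (le_of_eq ?_)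
      exact permAvg_apply (fun k => m i k * m j k * m b k) b
  have e3 : ∀ b, permAvg (fun τ => |c i (τ b) * c j (τ b)| *
      (κ * (m i (τ i) + m j (τ j) + if b = j then 0 else m b (τ j) + m b (τ b)))) ≤
      κ * (permAvg (fun τ => m i (τ b) * m j (τ b) * (m i (τ i) + m j (τ j))) +
        permAvg (fun τ => m i (τ b) * m j (τ b) *
          if b = j then 0 else m b (τ j) + m b (τ b))) := fun b => by
    rw [← permAvg_add, ← permAvg_const_mul]
    refine permAvg_mono fun τ => ?_
    have g0 : 0 ≤ m i (τ i) + m j (τ j) + if b = j then 0 else m b (τ j) + m b (τ b) := by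
      have := hm i (τ i)
      have := hm j (τ j)
      have := hm b (τ j)
      have := hm b (τ b)
      split_ifs <;> linarith
    rw [← mul_add, mul_left_comm]
    refine mul_le_mul_of_nonneg_left (mul_le_mul_of_nonneg_right ?_ g0) hκ
    rw [abs_mul]
    exact mul_le_mul (hc _ _) (hc _ _) (abs_nonneg _) (hm _ _)
  have e4 := (Finset.sum_le_sum fun b (_ : b ∈ Finset.univ) => (e3 b).trans
    (mul_le_mul_of_nonneg_left (add_le_add_right (e2 b) _) hκ))
  rw [← Finset.mul_sum, Finset.sum_add_distrib, e1, sum_linear_comb] at e4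
  refine (mul_le_mul_of_nonneg_left e4 (by positivity)).trans (le_of_eq ?_)
  field_simp
  ring

/-- The increment of `q` contributes an entry of row `b`, so each term is a product of entries of
three rows. The entry at `τ j` yields three distinct positions, the one at `τ b` shares its position
with row `i` and yields two. -/
theorem permAvg_remainder_le (hn : 2 ≤ n) (hκ : 0 ≤ κ) (hc : ∀ i k, |c i k| ≤ m i k)
    {i j : Fin n} (hij : j ≠ i) {q : Equiv.Perm (Fin n) → ℝ}
    (hq : ∀ b, b ≠ i → b ≠ j → ∀ τ, |q (τ * Equiv.swap j b) - q τ| ≤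
      κ * (m b (τ j) + m b (τ b))) :
    |∑ b ∈ Finset.univ.erase i,
        permAvg (fun τ => c i (τ b) * c j (τ i) * (q (τ * Equiv.swap j b) - q τ))| ≤
      κ * (9 / 2 / (n : ℝ) ^ 3 * ∑ b, (∑ k, m i k) * ((∑ k, m j k) * ∑ k, m b k)
        + 1 / ((n : ℝ) * (n - 1)) * ∑ b, (∑ k, m i k * m b k) * ∑ k, m j k) := by
  have hm : ∀ i k, 0 ≤ m i k := fun i k => (abs_nonneg _).trans (hc i k)
  have hs : ∀ i, 0 ≤ ∑ k, m i k := fun i => Finset.sum_nonneg fun k _ => hm i k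
  have hs' : ∀ i b, 0 ≤ ∑ k, m i k * m b k := fun i b =>
    Finset.sum_nonneg fun k _ => mul_nonneg (hm i k) (hm b k)
  have hn' : (2 : ℝ) ≤ n := by exact_mod_cast hn
  have h1 : 0 < (n : ℝ) - 1 := by linarith
  have e1 : ∀ b ∈ Finset.univ.erase i,
      |permAvg (fun τ => c i (τ b) * c j (τ i) * (q (τ * Equiv.swap j b) - q τ))| ≤
      κ * (9 / 2 / (n : ℝ) ^ 3 * ((∑ k, m i k) * ((∑ k, m j k) * ∑ k, m b k))
        + 1 / ((n : ℝ) * (n - 1)) * ((∑ k, m i k * m b k) * ∑ k, m j k)) := fun b hb => by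
    have hbi := Finset.ne_of_mem_erase hb
    by_cases hbj : b = j
    · subst hbj
      have g1 := hs i
      have g2 := hs b
      have g3 := hs' i b
      simp only [Equiv.swap_self, ← Equiv.Perm.one_def, mul_one, sub_self, mul_zero,
        permAvg_const, abs_zero]
      positivity
    · refine (abs_permAvg_le (G := fun τ => κ * (m i (τ b) * (m j (τ i) * m b (τ j))
        + m i (τ b) * m b (τ b) * m j (τ i))) fun τ => ?_).trans ?_
      · have g := mul_le_mul (mul_le_mul (hc i (τ b)) (hc j (τ i)) (abs_nonneg _) (hm _ _))
          (hq b hbi hbj τ) (abs_nonneg _) (mul_nonneg (hm _ _) (hm _ _))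
        rw [abs_mul, abs_mul]
        exact g.trans (le_of_eq (by ring))
      · rw [permAvg_const_mul, permAvg_add]
        refine mul_le_mul_of_nonneg_left (add_le_add ?_ ?_) hκ
        · exact permAvg_three_le (hm i) (hm j) (hm b) hbi hbj hij.symm
        · exact permAvg_two_le hn (φ := fun k => m i k * m b k)
            (fun k => mul_nonneg (hm i k) (hm b k)) (hm j) hbi
  have e3 := ((Finset.abs_sum_le_sum_abs _ _).trans (Finset.sum_le_sum e1)).trans
    (Finset.sum_le_sum_of_subset_of_nonneg (Finset.erase_subset _ _)
    fun b _ _ => mul_nonneg hκ (add_nonneg (mul_nonneg (by positivity) (mul_nonneg (hs i)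
      (mul_nonneg (hs j) (hs b)))) (mul_nonneg (by positivity) (mul_nonneg (hs' i b) (hs j)))))
  rwa [← Finset.mul_sum, sum_linear_comb] at e3

end PermEstimates

/-! ### Integration by parts for functions of a permutation -/

section PermStein

variable {n : ℕ}

/-- The covariance of `X_{iπ(i)}` and `X_{jπ(j)}` in terms of the means `c` and the second
moments `m₂`. -/
def permCov (c m₂ : Fin n → Fin n → ℝ) (i j : Fin n) : ℝ :=
  if i = j then 1 / (n : ℝ) * ∑ k, m₂ i k else -(1 / ((n : ℝ) * (n - 1))) * ∑ k, c i k * c j k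

/-- The contribution of the pair of rows `i, j` to `permError`. -/
def pairError (m : Fin n → Fin n → ℝ) (i j : Fin n) : ℝ :=
  (n : ℝ) / (n - 1) * (1 / (n : ℝ) ^ 2 * ((∑ k, m i k * m j k) * (∑ k, m i k + ∑ k, m j k))
      + 1 / ((n : ℝ) ^ 2 * (n - 1)) * ∑ b, (∑ k, m i k * m j k) * ∑ k, m b k
      + 1 / (n : ℝ) ^ 2 * ∑ b, ∑ k, m i k * m j k * m b k)
    + 1 / ((n : ℝ) - 1) * (9 / 2 / (n : ℝ) ^ 3 *
        ∑ b, (∑ k, m i k) * ((∑ k, m j k) * ∑ k, m b k)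
      + 1 / ((n : ℝ) * (n - 1)) * ∑ b, (∑ k, m i k * m b k) * ∑ k, m j k)

/-- The error in the approximate integration by parts formula for `(X_{iπ(i)})_i`, where `m`, `m₂`
and `m₃` are the absolute moments of the array. -/
def permError (m m₂ m₃ : Fin n → Fin n → ℝ) : ℝ :=
  ∑ i, (1 / (n : ℝ) * ∑ k, m₃ i k
    + (1 / (n : ℝ) ^ 2 * ((∑ k, m₂ i k) * ∑ k, m i k)
      + 1 / ((n : ℝ) ^ 2 * (n - 1)) * ∑ j, (∑ k, m₂ i k) * ∑ k, m j k
      + 1 / (n : ℝ) ^ 2 * ∑ j, ∑ k, m₂ i k * m j k)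
    + (1 / ((n : ℝ) ^ 2 * (n - 1)) * ∑ j, (∑ k, m i k) * ∑ k, m₂ j k
      + 1 / (n : ℝ) ^ 2 * ∑ j, ∑ k, m i k * m₂ j k)
    + 1 / (n : ℝ) * ∑ j, pairError m i j)

variable {κ : ℝ} {c m m₂ m₃ : Fin n → Fin n → ℝ}

theorem pairError_nonneg (hn : 2 ≤ n) (hm : ∀ i k, 0 ≤ m i k) (i j : Fin n) :
    0 ≤ pairError m i j := by
  have hn' : (2 : ℝ) ≤ n := by exact_mod_cast hn
  have h1 : 0 < (n : ℝ) - 1 := by linarith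
  have hs : ∀ i, 0 ≤ ∑ k, m i k := fun i => Finset.sum_nonneg fun k _ => hm i k
  have hs2 : ∀ i b, 0 ≤ ∑ k, m i k * m b k := fun i b =>
    Finset.sum_nonneg fun k _ => mul_nonneg (hm i k) (hm b k)
  have a1 := mul_nonneg (hs2 i j) (add_nonneg (hs i) (hs j))
  have a2 : 0 ≤ ∑ b, (∑ k, m i k * m j k) * ∑ k, m b k :=
    Finset.sum_nonneg fun b _ => mul_nonneg (hs2 i j) (hs b)
  have a3 : 0 ≤ ∑ b, ∑ k, m i k * m j k * m b k :=
    Finset.sum_nonneg fun b _ => Finset.sum_nonneg fun k _ =>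
      mul_nonneg (mul_nonneg (hm _ _) (hm _ _)) (hm _ _)
  have a4 : 0 ≤ ∑ b, (∑ k, m i k) * ((∑ k, m j k) * ∑ k, m b k) :=
    Finset.sum_nonneg fun b _ => mul_nonneg (hs i) (mul_nonneg (hs j) (hs b))
  have a5 : 0 ≤ ∑ b, (∑ k, m i k * m b k) * ∑ k, m j k :=
    Finset.sum_nonneg fun b _ => mul_nonneg (hs2 i b) (hs j)
  unfold pairError
  positivity

/-- The coefficient `-n / (n - 1)` of the two-point identity times the factor `1 / n` from
decoupling gives `-1 / (n - 1)`, which is `n` times the off-diagonal covariance. -/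
theorem permAvg_pair_le (hn : 2 ≤ n) (hκ : 0 ≤ κ) (hc : ∀ i k, |c i k| ≤ m i k)
    (hc0 : ∀ i, ∑ k, c i k = 0) {i j : Fin n} (hij : j ≠ i) {q h : Equiv.Perm (Fin n) → ℝ}
    (hsw : ∀ τ, q (τ * Equiv.swap i j) = q τ)
    (hqq : ∀ b, b ≠ i → b ≠ j → ∀ τ, |q (τ * Equiv.swap j b) - q τ| ≤
      κ * (m b (τ j) + m b (τ b)))
    (hqh : ∀ τ, |q τ - h τ| ≤ κ * (m i (τ i) + m j (τ j))) :
    |permAvg (fun τ => c i (τ j) * (c j (τ i) - c j (τ j)) * q τ)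
      - -(1 / ((n : ℝ) - 1)) * (∑ k, c i k * c j k) * permAvg h| ≤ κ * pairError m i j := by
  have hm : ∀ i k, 0 ≤ m i k := fun i k => (abs_nonneg _).trans (hc i k)
  have hn' : (2 : ℝ) ≤ n := by exact_mod_cast hn
  have h1 : 0 < (n : ℝ) - 1 := by linarith
  have E := permAvg_offdiag_le hn hκ hc (i := i) (j := j) (q := q) (h := h) fun b τ => by
    have g := hqh τ
    have g1 := mul_nonneg hκ (add_nonneg (hm b (τ j)) (hm b (τ b)))
    by_cases hbj : b = j
    · subst hbj
      simpa [Equiv.swap_self, ← Equiv.Perm.one_def] using g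
    · by_cases hbi : b = i
      · subst hbi
        -- For `b = i` the transposition leaves `q` unchanged, so the bound on `q - h` alone
        -- suffices.
        rw [Equiv.swap_comm, hsw, if_neg hbj, mul_add]
        linarith
      · have g2 := hqq b hbi hbj τ
        rw [if_neg hbj, mul_add]
        calc _ = |(q (τ * Equiv.swap j b) - q τ) + (q τ - h τ)| := by congr 1; ring
          _ ≤ _ := (abs_add_le _ _).trans (by linarith)
  have R := permAvg_remainder_le hn hκ hc hij hqq
  rw [permAvg_two_point_eq hn hc0 hij hsw]
  unfold pairError
  rw [abs_le] at E R ⊢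
  have p1 : 0 ≤ (n : ℝ) / (n - 1) := by positivity
  have p2 : 0 ≤ 1 / ((n : ℝ) - 1) := by positivity
  have E1 := mul_le_mul_of_nonneg_left E.1 p1
  have E2 := mul_le_mul_of_nonneg_left E.2 p1
  have R1 := mul_le_mul_of_nonneg_left R.1 p2
  have R2 := mul_le_mul_of_nonneg_left R.2 p2
  have e : (n : ℝ) / (n - 1) * (1 / (n : ℝ) * (∑ k, c i k * c j k) * permAvg h)
      = 1 / ((n : ℝ) - 1) * (∑ k, c i k * c j k) * permAvg h := by
    field_simp
  constructor <;> linarith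

/-- The combinatorial core, free of probability. For a fixed permutation and the associated vector
`w`, the intended meaning, after averaging over the array, is: `I i` is the mean of `w_i f_i(w)`, `a
i` and `b i` are those of `f_i` and `H_ii` with coordinate `i` set to zero, `q i j` is that of
`H_ij` with coordinates `i` and `j` set to zero, and `h i j` is that of `H_ij(w)`. -/
theorem abs_sum_permAvg_sub_le (hn : 2 ≤ n) (hκ : 0 ≤ κ) (hm₂ : ∀ i k, 0 ≤ m₂ i k)
    (hc : ∀ i k, |c i k| ≤ m i k)
    (hc0 : ∀ i, ∑ k, c i k = 0) {I a b : Fin n → Equiv.Perm (Fin n) → ℝ}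
    {q h : Fin n → Fin n → Equiv.Perm (Fin n) → ℝ}
    (hI : ∀ i τ, |I i τ - (c i (τ i) * a i τ + m₂ i (τ i) * b i τ)| ≤ κ * m₃ i (τ i))
    (ha : ∀ i j, j ≠ i → ∀ τ, |a i (τ * Equiv.swap i j) - a i τ
      - (c j (τ i) - c j (τ j)) * q i j τ| ≤ κ * (m₂ j (τ i) + m₂ j (τ j)))
    (hb : ∀ i j τ, |b i (τ * Equiv.swap i j) - h i i τ| ≤
      κ * (m i (τ i) + if j = i then 0 else m j (τ i) + m j (τ j)))
    (hsw : ∀ i j, j ≠ i → ∀ τ, q i j (τ * Equiv.swap i j) = q i j τ)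
    (hqq : ∀ i j, j ≠ i → ∀ b, b ≠ i → b ≠ j → ∀ τ, |q i j (τ * Equiv.swap j b) - q i j τ| ≤
      κ * (m b (τ j) + m b (τ b)))
    (hqh : ∀ i j, j ≠ i → ∀ τ, |q i j τ - h i j τ| ≤ κ * (m i (τ i) + m j (τ j))) :
    |∑ i, permAvg (I i) - ∑ i, ∑ j, permCov c m₂ i j * permAvg (h i j)| ≤
      κ * permError m m₂ m₃ := by
  have hm : ∀ i k, 0 ≤ m i k := fun i k => (abs_nonneg _).trans (hc i k)
  have hn' : (2 : ℝ) ≤ n := by exact_mod_cast hn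
  have h1 : 0 < (n : ℝ) - 1 := by linarith
  rw [← Finset.sum_sub_distrib, permError, Finset.mul_sum]
  refine (Finset.abs_sum_le_sum_abs _ _).trans (Finset.sum_le_sum fun i _ => ?_)
  have A : |permAvg (I i) - (permAvg (fun τ => c i (τ i) * a i τ)
      + permAvg (fun τ => m₂ i (τ i) * b i τ))| ≤ κ * (1 / (n : ℝ) * ∑ k, m₃ i k) := by
    rw [← permAvg_add, ← permAvg_sub, ← permAvg_apply (m₃ i) i, ← permAvg_const_mul]
    exact abs_permAvg_le (hI i)
  have B := permAvg_diag_le hn hκ hm hm₂ i (hb i)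
  have C := permAvg_linear_le hn hκ hm₂ hc hc0 i (ha i)
  have D : |1 / (n : ℝ) * ∑ j ∈ Finset.univ.erase i,
        permAvg (fun τ => c i (τ j) * (c j (τ i) - c j (τ j)) * q i j τ)
      - ∑ j ∈ Finset.univ.erase i, permCov c m₂ i j * permAvg (h i j)| ≤
      κ * (1 / (n : ℝ) * ∑ j, pairError m i j) := by
    have e : ∑ j ∈ Finset.univ.erase i, permCov c m₂ i j * permAvg (h i j)
        = 1 / (n : ℝ) * ∑ j ∈ Finset.univ.erase i,
          -(1 / ((n : ℝ) - 1)) * (∑ k, c i k * c j k) * permAvg (h i j) := by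
      rw [Finset.mul_sum]
      refine Finset.sum_congr rfl fun j hj => ?_
      rw [permCov, if_neg (Finset.ne_of_mem_erase hj).symm]
      field_simp
    rw [e, ← mul_sub, ← Finset.sum_sub_distrib, abs_mul,
      abs_of_nonneg (by positivity : (0 : ℝ) ≤ 1 / (n : ℝ)), mul_left_comm]
    refine mul_le_mul_of_nonneg_left ?_ (by positivity)
    refine (Finset.abs_sum_le_sum_abs _ _).trans ((Finset.sum_le_sum fun j hj =>
      permAvg_pair_le hn hκ hc hc0 (Finset.ne_of_mem_erase hj)
        (hsw i j (Finset.ne_of_mem_erase hj)) (hqq i j (Finset.ne_of_mem_erase hj))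
        (hqh i j (Finset.ne_of_mem_erase hj))).trans ?_)
    rw [← Finset.mul_sum]
    exact mul_le_mul_of_nonneg_left (Finset.sum_le_sum_of_subset_of_nonneg
      (Finset.erase_subset _ _) fun j _ _ => pairError_nonneg hn hm i j) hκ
  rw [← Finset.add_sum_erase _ _ (Finset.mem_univ i), permCov, if_pos rfl]
  rw [abs_le] at A B C D ⊢
  constructor <;> linarith [A.1, A.2, B.1, B.2, C.1, C.2, D.1, D.2]

end PermStein

/-! ### Independent coordinates -/

section Independence

theorem integral_mul_of_dependsOn {ι : Type*} [Fintype ι] [DecidableEq ι] {Q : Measure (ι → ℝ)}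
    [IsProbabilityMeasure Q] (hQ : iIndepFun (fun (p : ι) (x : ι → ℝ) => x p) Q) (S : Finset ι)
    {φ ψ : (ι → ℝ) → ℝ} (hφ : Measurable φ) (hψ : Measurable ψ) (hφS : DependsOn φ (S : Set ι))
    (hψS : DependsOn ψ ((Sᶜ : Finset ι) : Set ι)) :
    ∫ x, φ x * ψ x ∂Q = (∫ x, φ x ∂Q) * ∫ x, ψ x ∂Q := by
  -- A function depending only on the coordinates in `T` equals itself after restriction to `T` and
  -- extension by zero. This exhibits it as a measurable function of the restricted family.
  have ext_meas : ∀ T : Finset ι,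
      Measurable fun (r : T → ℝ) (i : ι) => if h : i ∈ T then r ⟨i, h⟩ else 0 := fun T => by
    refine measurable_pi_lambda _ fun i => ?_
    by_cases h : i ∈ T
    · simp only [h, dite_true]
      exact measurable_pi_apply _
    · simp only [h, dite_false]
      exact measurable_const
  have h := (hQ.indepFun_finset S Sᶜ disjoint_compl_right fun i => measurable_pi_apply i).comp
    (hφ.comp (ext_meas S)) (hψ.comp (ext_meas Sᶜ))
  have e1 : (φ ∘ fun (r : S → ℝ) (i : ι) => if h : i ∈ S then r ⟨i, h⟩ else 0) ∘
      (fun (x : ι → ℝ) (i : S) => x i) = φ := by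
    funext x
    exact hφS fun i hi => by simp [Finset.mem_coe.1 hi]
  have e2 : (ψ ∘ fun (r : (Sᶜ : Finset ι) → ℝ) (i : ι) => if h : i ∈ Sᶜ then r ⟨i, h⟩ else 0) ∘
      (fun (x : ι → ℝ) (i : (Sᶜ : Finset ι)) => x i) = ψ := by
    funext x
    exact hψS fun i hi => by
      have := Finset.mem_coe.1 hi
      simp only [this, dite_true]
  rw [e1, e2] at h
  exact h.integral_fun_mul_eq_mul_integral hφ.aestronglyMeasurable hψ.aestronglyMeasurable

end Independence

/-! ### Smooth fields evaluated at random vectors -/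

namespace IsSmoothField

variable {n : ℕ} {κ : ℝ} {f : Fin n → (Fin n → ℝ) → ℝ} {H : Fin n → Fin n → (Fin n → ℝ) → ℝ}
  {α : Type*} [MeasurableSpace α] {Q : Measure α} [IsProbabilityMeasure Q]

theorem memLp_comp (h : IsSmoothField κ f H) (i : Fin n) {w : α → Fin n → ℝ} {p : ℝ≥0∞}
    (hw : ∀ j, MemLp (fun x => w x j) p Q) : MemLp (fun x => f i (w x)) p Q := by
  obtain ⟨B, hB0, hB⟩ := h.growth
  have hwm : AEMeasurable w Q :=
    aemeasurable_pi_lambda _ fun j => (hw j).aestronglyMeasurable.aemeasurable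
  refine MemLp.mono' (g := fun x => B * (1 + ∑ j, |w x j|)) ?_
    ((h.continuous_field i).measurable.comp_aemeasurable hwm).aestronglyMeasurable
    (ae_of_all _ fun x => hB i (w x))
  have h1 : MemLp (fun x => ∑ j, |w x j|) p Q := memLp_finsetSum _ fun j _ => (hw j).norm
  have h2 : MemLp (fun x => 1 + ∑ j, |w x j|) p Q := (memLp_const (1 : ℝ)).add h1
  exact h2.const_mul B

theorem integrable_jacobian_comp (h : IsSmoothField κ f H) (i j : Fin n) {w : α → Fin n → ℝ}
    (hw : AEMeasurable w Q) : Integrable (fun x => H i j (w x)) Q := by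
  obtain ⟨B, hB0, hB⟩ := h.bounded
  exact Integrable.of_bound
    ((h.continuous_jacobian i j).measurable.comp_aemeasurable hw).aestronglyMeasurable B
    (ae_of_all _ fun x => hB _ _ _)

theorem abs_integral_jacobian_sub_le (h : IsSmoothField κ f H) (i j : Fin n)
    {w w' : α → Fin n → ℝ} (hw : AEMeasurable w Q) (hw' : AEMeasurable w' Q) {d : α → ℝ}
    (hd : Integrable d Q) (hwd : ∀ x, ∑ m, |w x m - w' x m| ≤ d x) :
    |∫ x, H i j (w x) ∂Q - ∫ x, H i j (w' x) ∂Q| ≤ κ * ∫ x, d x ∂Q := by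
  rw [← integral_sub (h.integrable_jacobian_comp i j hw) (h.integrable_jacobian_comp i j hw'),
    ← integral_const_mul]
  refine (Real.norm_eq_abs _).symm.trans_le
    (norm_integral_le_of_norm_le (hd.const_mul κ) (ae_of_all _ fun x => ?_))
  exact (h.lipschitz i j _ _).trans (mul_le_mul_of_nonneg_left (hwd x) h.nonneg)

end IsSmoothField

/-! ### Approximate integration by parts for the permutation statistic -/

section PermStatistic

variable {n : ℕ}

/-- The vector `(x_{iτ(i)})_i`. -/
def permVec (τ : Equiv.Perm (Fin n)) (x : Fin n × Fin n → ℝ) : Fin n → ℝ := fun i => x (i, τ i)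

/-- The entries in row `i`. -/
def rowSet (i : Fin n) : Finset (Fin n × Fin n) := Finset.univ.filter fun p => p.1 = i

theorem measurable_permVec (τ : Equiv.Perm (Fin n)) : Measurable (permVec τ) :=
  measurable_pi_lambda _ fun _ => measurable_pi_apply _

variable {Q : Measure (Fin n × Fin n → ℝ)} [IsProbabilityMeasure Q] {κ : ℝ}
  {f : Fin n → (Fin n → ℝ) → ℝ} {H : Fin n → Fin n → (Fin n → ℝ) → ℝ}

omit [IsProbabilityMeasure Q] in
theorem memLp_update_permVec {p : ℝ≥0∞} (hp : ∀ e, MemLp (fun x : Fin n × Fin n → ℝ => x e) p Q)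
    (τ : Equiv.Perm (Fin n)) (i j : Fin n) :
    MemLp (fun x => Function.update (permVec τ x) i 0 j) p Q := by
  by_cases h : j = i
  · subst h
    simp
  · simp only [Function.update_of_ne h]
    exact hp (j, τ j)

theorem Measurable.update_const {α : Type*} [MeasurableSpace α] {w : α → Fin n → ℝ}
    (hw : Measurable w) (i : Fin n) (a : ℝ) : Measurable fun x => Function.update (w x) i a := by
  refine measurable_pi_lambda _ fun j => ?_
  by_cases h : j = i
  · subst h
    simp
  · simp only [Function.update_of_ne h]
    exact (measurable_pi_apply j).comp hw

theorem measurable_update_permVec (τ : Equiv.Perm (Fin n)) (i : Fin n) :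
    Measurable fun x => Function.update (permVec τ x) i 0 :=
  (measurable_permVec τ).update_const i 0

theorem update_permVec_congr (τ : Equiv.Perm (Fin n)) (i : Fin n) {x y : Fin n × Fin n → ℝ}
    (h : ∀ p ∈ (((rowSet i)ᶜ : Finset _) : Set (Fin n × Fin n)), x p = y p) :
    Function.update (permVec τ x) i 0 = Function.update (permVec τ y) i 0 := by
  funext m
  by_cases hm : m = i
  · subst hm; simp
  · simp only [Function.update_of_ne hm]
    exact h _ (by simp [rowSet, hm])

theorem integral_row_mul (hQ : iIndepFun (fun (p : Fin n × Fin n) (x : Fin n × Fin n → ℝ) => x p) Q)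
    (i k : Fin n) {φ : ℝ → ℝ} (hφ : Measurable φ) {ψ : (Fin n × Fin n → ℝ) → ℝ}
    (hψ : Measurable ψ)
    (h : DependsOn ψ (((rowSet i)ᶜ : Finset _) : Set (Fin n × Fin n))) :
    ∫ x, φ (x (i, k)) * ψ x ∂Q = (∫ x, φ (x (i, k)) ∂Q) * ∫ x, ψ x ∂Q :=
  integral_mul_of_dependsOn hQ (rowSet i) (hφ.comp (measurable_pi_apply _)) hψ
    (fun x y h => by rw [h (i, k) (by simp [rowSet])]) h

theorem permVec_eq_add_single (τ : Equiv.Perm (Fin n)) (i : Fin n) (x : Fin n × Fin n → ℝ) :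
    permVec τ x = Function.update (permVec τ x) i 0 + Pi.single i (x (i, τ i)) := by
  funext m
  by_cases hm : m = i
  · subst hm; simp [permVec]
  · simp [hm]

/-- Expand `f i` in its own coordinate around zero. The vector with coordinate `i` set to zero
involves only the other rows, so it is independent of `x (i, τ i)` and both Taylor terms factor. The
quadratic remainder, multiplied by the entry, gives the third moment. -/
theorem abs_integral_mul_field_sub_le (hf : IsSmoothField κ f H)
    (hQ : iIndepFun (fun (p : Fin n × Fin n) (x : Fin n × Fin n → ℝ) => x p) Q)
    (h3 : ∀ p, MemLp (fun x : Fin n × Fin n → ℝ => x p) 3 Q) (i : Fin n)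
    (τ : Equiv.Perm (Fin n)) :
    |∫ x, x (i, τ i) * f i (permVec τ x) ∂Q
      - ((∫ x, x (i, τ i) ∂Q) * ∫ x, f i (Function.update (permVec τ x) i 0) ∂Q
        + (∫ x, |x (i, τ i)| ^ 2 ∂Q) * ∫ x, H i i (Function.update (permVec τ x) i 0) ∂Q)| ≤
      κ * ∫ x, |x (i, τ i)| ^ 3 ∂Q := by
  have h2 : ∀ p, MemLp (fun x : Fin n × Fin n → ℝ => x p) 2 Q := fun p =>
    (h3 p).mono_exponent (by norm_num)
  have m1 := measurable_update_permVec (n := n) τ i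
  rw [← integral_row_mul hQ i (τ i) (φ := fun t => t) measurable_id
      (ψ := fun x => f i (Function.update (permVec τ x) i 0))
      ((hf.continuous_field i).measurable.comp m1)
      (fun x y h => by dsimp only; rw [update_permVec_congr τ i h]),
    ← integral_row_mul hQ i (τ i) (φ := fun t => |t| ^ 2) (by fun_prop)
      (ψ := fun x => H i i (Function.update (permVec τ x) i 0))
      ((hf.continuous_jacobian i i).measurable.comp m1)
      (fun x y h => by dsimp only; rw [update_permVec_congr τ i h])]
  have i1 : Integrable (fun x => x (i, τ i) * f i (permVec τ x)) Q :=
    (h2 _).integrable_mul (hf.memLp_comp i fun j => h2 _)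
  have i2 : Integrable (fun x => x (i, τ i) * f i (Function.update (permVec τ x) i 0)) Q :=
    (h2 _).integrable_mul (hf.memLp_comp i fun j => memLp_update_permVec h2 τ i j)
  obtain ⟨B, hB0, hB⟩ := hf.bounded
  have i3 : Integrable (fun x => |x (i, τ i)| ^ 2 *
      H i i (Function.update (permVec τ x) i 0)) Q := by
    refine Integrable.mul_bdd (c := B) ?_
      ((hf.continuous_jacobian i i).measurable.comp m1).aestronglyMeasurable
      (ae_of_all _ fun x => hB _ _ _)
    simpa using (h2 (i, τ i)).integrable_sq
  have i5 : Integrable (fun x => x (i, τ i) * f i (Function.update (permVec τ x) i 0)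
      + |x (i, τ i)| ^ 2 * H i i (Function.update (permVec τ x) i 0)) Q := i2.add i3
  rw [← integral_add i2 i3, ← integral_sub i1 i5, ← integral_const_mul]
  have i4 : Integrable (fun x : Fin n × Fin n → ℝ => |x (i, τ i)| ^ 3) Q := by
    simpa using (h3 (i, τ i)).integrable_norm_pow (by norm_num)
  refine (Real.norm_eq_abs _).symm.trans_le
    (norm_integral_le_of_norm_le (i4.const_mul κ) (ae_of_all _ fun x => ?_))
  have t := hf.taylor i i (Function.update (permVec τ x) i 0) (x (i, τ i))
  rw [← permVec_eq_add_single] at t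
  have e : x (i, τ i) * f i (permVec τ x) - (x (i, τ i) * f i (Function.update (permVec τ x) i 0)
      + |x (i, τ i)| ^ 2 * H i i (Function.update (permVec τ x) i 0))
      = x (i, τ i) * (f i (permVec τ x) - f i (Function.update (permVec τ x) i 0)
        - x (i, τ i) * H i i (Function.update (permVec τ x) i 0)) := by
    rw [sq_abs]; ring
  simp only [Real.norm_eq_abs]
  rw [e, abs_mul]
  calc _ ≤ |x (i, τ i)| * (κ * x (i, τ i) ^ 2) := mul_le_mul_of_nonneg_left t (abs_nonneg _)
    _ = κ * |x (i, τ i)| ^ 3 := by rw [← sq_abs]; ring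

theorem update_permVec_swap (τ : Equiv.Perm (Fin n)) {i j : Fin n} (hij : j ≠ i)
    (x : Fin n × Fin n → ℝ) :
    Function.update (permVec (τ * Equiv.swap i j) x) i 0
      = Function.update (Function.update (permVec τ x) i 0) j 0 + Pi.single j (x (j, τ i)) := by
  funext m
  by_cases hm : m = i
  · subst hm
    simp [hij.symm]
  · by_cases hmj : m = j
    · subst hmj
      simp [hm, permVec]
    · simp [hm, hmj, permVec, Equiv.swap_apply_of_ne_of_ne hm hmj]

theorem update_permVec_eq (τ : Equiv.Perm (Fin n)) {i j : Fin n} (hij : j ≠ i)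
    (x : Fin n × Fin n → ℝ) :
    Function.update (permVec τ x) i 0
      = Function.update (Function.update (permVec τ x) i 0) j 0 + Pi.single j (x (j, τ j)) := by
  funext m
  by_cases hmj : m = j
  · subst hmj
    simp [hij, permVec]
  · simp [hmj]

/-- Once coordinate `i` is set to zero, the transposition only changes coordinate `j`, from `x (j, τ
j)` to `x (j, τ i)`. Both values are expanded around zero in that coordinate, and row `j` is
independent of the common base point. -/
theorem abs_integral_field_swap_sub_le (hf : IsSmoothField κ f H)
    (hQ : iIndepFun (fun (p : Fin n × Fin n) (x : Fin n × Fin n → ℝ) => x p) Q)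
    (h2 : ∀ p, MemLp (fun x : Fin n × Fin n → ℝ => x p) 2 Q) {i j : Fin n} (hij : j ≠ i)
    (τ : Equiv.Perm (Fin n)) :
    |∫ x, f i (Function.update (permVec (τ * Equiv.swap i j) x) i 0) ∂Q
      - ∫ x, f i (Function.update (permVec τ x) i 0) ∂Q
      - ((∫ x, x (j, τ i) ∂Q) - ∫ x, x (j, τ j) ∂Q) *
        ∫ x, H i j (Function.update (Function.update (permVec τ x) i 0) j 0) ∂Q| ≤
      κ * (∫ x, |x (j, τ i)| ^ 2 ∂Q + ∫ x, |x (j, τ j)| ^ 2 ∂Q) := by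
  have h1 : ∀ p, Integrable (fun x : Fin n × Fin n → ℝ => x p) Q := fun p =>
    (h2 p).integrable (by norm_num)
  have mq : Measurable fun x => Function.update (Function.update (permVec (n := n) τ x) i 0) j 0 :=
    (measurable_update_permVec τ i).update_const j 0
  have dq : ∀ {x y : Fin n × Fin n → ℝ},
      (∀ p ∈ (((rowSet j)ᶜ : Finset _) : Set (Fin n × Fin n)), x p = y p) →
      Function.update (Function.update (permVec τ x) i 0) j 0 =
        Function.update (Function.update (permVec τ y) i 0) j 0 := fun {x y} h => by
    rw [Function.update_comm hij.symm, Function.update_comm hij.symm, update_permVec_congr τ j h]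
  have ind : ∀ k, ∫ x, x (j, k) * H i j (Function.update (Function.update (permVec τ x) i 0) j 0) ∂Q
      = (∫ x, x (j, k) ∂Q) *
        ∫ x, H i j (Function.update (Function.update (permVec τ x) i 0) j 0) ∂Q := fun k =>
    integral_row_mul hQ j k (φ := fun t => t) measurable_id
      ((hf.continuous_jacobian i j).measurable.comp mq)
      (fun x y h => congrArg (H i j) (dq h))
  obtain ⟨B, hB0, hB⟩ := hf.bounded
  have i3 : ∀ k, Integrable (fun x => x (j, k) *
      H i j (Function.update (Function.update (permVec τ x) i 0) j 0)) Q := fun k =>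
    Integrable.mul_bdd (c := B) (h1 _)
      ((hf.continuous_jacobian i j).measurable.comp mq).aestronglyMeasurable
      (ae_of_all _ fun x => hB _ _ _)
  have i1 : Integrable (fun x => f i (Function.update (permVec (τ * Equiv.swap i j) x) i 0)) Q :=
    (hf.memLp_comp i fun l => memLp_update_permVec h2 _ i l).integrable (by norm_num)
  have i2 : Integrable (fun x => f i (Function.update (permVec τ x) i 0)) Q :=
    (hf.memLp_comp i fun l => memLp_update_permVec h2 _ i l).integrable (by norm_num)
  have i4 : ∀ k, Integrable (fun x : Fin n × Fin n → ℝ => |x (j, k)| ^ 2) Q := fun k => by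
    simpa using (h2 (j, k)).integrable_sq
  have i5 : Integrable (fun x => f i (Function.update (permVec (τ * Equiv.swap i j) x) i 0)
      - f i (Function.update (permVec τ x) i 0)) Q := i1.sub i2
  have i6 : Integrable (fun x =>
      x (j, τ i) * H i j (Function.update (Function.update (permVec τ x) i 0) j 0)
      - x (j, τ j) * H i j (Function.update (Function.update (permVec τ x) i 0) j 0)) Q :=
    (i3 _).sub (i3 _)
  rw [sub_mul, ← ind, ← ind, ← integral_sub i1 i2, ← integral_sub (i3 _) (i3 _),
    ← integral_sub i5 i6, ← integral_add (i4 _) (i4 _),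
    ← integral_const_mul]
  refine (Real.norm_eq_abs _).symm.trans_le
    (norm_integral_le_of_norm_le (((i4 _).add (i4 _)).const_mul κ) (ae_of_all _ fun x => ?_))
  have t1 := hf.taylor i j (Function.update (Function.update (permVec τ x) i 0) j 0) (x (j, τ i))
  have t2 := hf.taylor i j (Function.update (Function.update (permVec τ x) i 0) j 0) (x (j, τ j))
  rw [← update_permVec_swap τ hij] at t1
  rw [← update_permVec_eq τ hij] at t2
  simp only [Real.norm_eq_abs, sq_abs]
  rw [abs_le] at *
  constructor <;> linarith

theorem abs_integral_jacobian_swap_sub_le (hf : IsSmoothField κ f H)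
    (h1 : ∀ p, Integrable (fun x : Fin n × Fin n → ℝ => x p) Q) (i j : Fin n)
    (τ : Equiv.Perm (Fin n)) :
    |∫ x, H i i (Function.update (permVec (τ * Equiv.swap i j) x) i 0) ∂Q
      - ∫ x, H i i (permVec τ x) ∂Q| ≤
      κ * (∫ x, |x (i, τ i)| ∂Q
        + if j = i then 0 else ∫ x, |x (j, τ i)| ∂Q + ∫ x, |x (j, τ j)| ∂Q) := by
  have key := hf.abs_integral_jacobian_sub_le i i (Q := Q)
    (measurable_update_permVec (τ * Equiv.swap i j) i).aemeasurable
    (measurable_permVec τ).aemeasurable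
    (d := fun x => |x (i, τ i)| + if j = i then 0 else |x (j, τ i)| + |x (j, τ j)|)
    (by
      refine (h1 _).abs.add ?_
      split_ifs
      · exact integrable_zero _ _ _
      · exact (h1 _).abs.add (h1 _).abs)
    (fun x => by
      refine (Finset.sum_le_sum (g := fun m => (if m = i then |x (i, τ i)| else 0)
        + if m = j then (if j = i then 0 else |x (j, τ i)| + |x (j, τ j)|) else 0)
        fun m _ => ?_).trans (by simp [Finset.sum_add_distrib])
      by_cases hm : m = i
      · subst hm
        by_cases hmj : m = j
        · subst hmj; simp [permVec]
        · simp [permVec, hmj]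
      · by_cases hmj : m = j
        · subst hmj
          simpa [hm, permVec] using abs_sub (x (m, τ i)) (x (m, τ m))
        · simp [hm, hmj, permVec, Equiv.swap_apply_of_ne_of_ne hm hmj])
  refine key.trans (le_of_eq ?_)
  by_cases hji : j = i
  · simp [hji]
  · simp only [hji, if_false]
    have g : Integrable (fun x : Fin n × Fin n → ℝ => |x (j, τ i)| + |x (j, τ j)|) Q :=
      (h1 _).abs.add (h1 _).abs
    rw [integral_add (h1 _).abs g, integral_add (h1 _).abs (h1 _).abs]

theorem update_update_permVec_swap (τ : Equiv.Perm (Fin n)) {i j : Fin n} (hij : j ≠ i)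
    (x : Fin n × Fin n → ℝ) :
    Function.update (Function.update (permVec (τ * Equiv.swap i j) x) i 0) j 0
      = Function.update (Function.update (permVec τ x) i 0) j 0 := by
  funext m
  by_cases hmj : m = j
  · subst hmj; simp
  · by_cases hm : m = i
    · subst hm; simp [hij.symm]
    · simp [hm, hmj, permVec, Equiv.swap_apply_of_ne_of_ne hm hmj]

/-- Coordinates `i` and `j` are zero on both sides, so the transposition is felt only in coordinate
`b`. -/
theorem abs_integral_jacobian_far_swap_sub_le (hf : IsSmoothField κ f H)
    (h1 : ∀ p, Integrable (fun x : Fin n × Fin n → ℝ => x p) Q) {i j b : Fin n}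
    (hbi : b ≠ i) (hbj : b ≠ j) (τ : Equiv.Perm (Fin n)) :
    |∫ x, H i j (Function.update (Function.update (permVec (τ * Equiv.swap j b) x) i 0) j 0) ∂Q
      - ∫ x, H i j (Function.update (Function.update (permVec τ x) i 0) j 0) ∂Q| ≤
      κ * (∫ x, |x (b, τ j)| ∂Q + ∫ x, |x (b, τ b)| ∂Q) := by
  rw [← integral_add (h1 _).abs (h1 _).abs]
  refine hf.abs_integral_jacobian_sub_le i j (Q := Q)
    ((measurable_update_permVec _ i).update_const j 0).aemeasurable
    ((measurable_update_permVec _ i).update_const j 0).aemeasurable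
    ((h1 _).abs.add (h1 _).abs) (fun x => ?_)
  rw [Finset.sum_eq_single b]
  · simpa [hbi, hbj, permVec] using abs_sub (x (b, τ j)) (x (b, τ b))
  · intro m _ hm
    by_cases hmj : m = j
    · subst hmj; simp
    · by_cases hmi : m = i
      · subst hmi; simp [hmj]
      · simp [hmi, hmj, permVec, Equiv.swap_apply_of_ne_of_ne hmj hm]
  · simp

theorem abs_integral_jacobian_update_sub_le (hf : IsSmoothField κ f H)
    (h1 : ∀ p, Integrable (fun x : Fin n × Fin n → ℝ => x p) Q) (i j : Fin n)
    (τ : Equiv.Perm (Fin n)) :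
    |∫ x, H i j (Function.update (Function.update (permVec τ x) i 0) j 0) ∂Q
      - ∫ x, H i j (permVec τ x) ∂Q| ≤
      κ * (∫ x, |x (i, τ i)| ∂Q + ∫ x, |x (j, τ j)| ∂Q) := by
  rw [← integral_add (h1 _).abs (h1 _).abs]
  refine hf.abs_integral_jacobian_sub_le i j (Q := Q)
    ((measurable_update_permVec _ i).update_const j 0).aemeasurable
    (measurable_permVec τ).aemeasurable
    ((h1 _).abs.add (h1 _).abs) (fun x => ?_)
  refine (Finset.sum_le_sum (g := fun m => (if m = i then |x (i, τ i)| else 0)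
    + if m = j then |x (j, τ j)| else 0) fun m _ => ?_).trans (by simp [Finset.sum_add_distrib])
  by_cases hmj : m = j
  · subst hmj
    have : 0 ≤ if m = i then |x (i, τ i)| else 0 := by split_ifs <;> positivity
    simpa [permVec] using this
  · by_cases hmi : m = i
    · subst hmi; simp [hmj, permVec]
    · simp [hmi, hmj]

/-- The law of `(X_{iπ(i)})_i`, where `X` has law `Q` and `π` is an independent uniform
permutation. -/
def permLaw (Q : Measure (Fin n × Fin n → ℝ)) : Measure (Fin n → ℝ) :=
  ∑ τ : Equiv.Perm (Fin n), (n.factorial : ℝ≥0∞)⁻¹ • Q.map (permVec τ)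

omit [IsProbabilityMeasure Q] in
theorem integrable_permLaw {F : (Fin n → ℝ) → ℝ} (hF : Measurable F)
    (hFi : ∀ τ, Integrable (fun x => F (permVec τ x)) Q) : Integrable F (permLaw Q) := by
  refine integrable_finsetSum_measure.2 fun τ _ =>
    Integrable.smul_measure ?_ (by simp [Nat.factorial_ne_zero])
  exact (integrable_map_measure hF.aestronglyMeasurable
      (measurable_permVec τ).aemeasurable).2 (hFi τ)

omit [IsProbabilityMeasure Q] in
theorem integral_permLaw {F : (Fin n → ℝ) → ℝ} (hF : Measurable F)
    (hFi : ∀ τ, Integrable (fun x => F (permVec τ x)) Q) :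
    ∫ y, F y ∂permLaw Q = permAvg fun τ => ∫ x, F (permVec τ x) ∂Q := by
  rw [permLaw, integral_finsetSum_measure, permAvg, Finset.mul_sum]
  · refine Finset.sum_congr rfl fun τ _ => ?_
    rw [integral_smul_measure, integral_map (measurable_permVec τ).aemeasurable
      hF.aestronglyMeasurable]
    simp
  · intro τ _
    refine Integrable.smul_measure ?_ (by simp [Nat.factorial_ne_zero])
    exact (integrable_map_measure hF.aestronglyMeasurable
      (measurable_permVec τ).aemeasurable).2 (hFi τ)

theorem approxStein_permLaw (hn : 2 ≤ n)
    (hQ : iIndepFun (fun (p : Fin n × Fin n) (x : Fin n × Fin n → ℝ) => x p) Q)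
    (h3 : ∀ p, MemLp (fun x : Fin n × Fin n → ℝ => x p) 3 Q)
    (hc0 : ∀ i, ∑ k, ∫ x, x (i, k) ∂Q = 0) :
    ApproxStein (permLaw Q)
      (permCov (fun i k => ∫ x, x (i, k) ∂Q) fun i k => ∫ x, |x (i, k)| ^ 2 ∂Q)
      (permError (fun i k => ∫ x, |x (i, k)| ∂Q) (fun i k => ∫ x, |x (i, k)| ^ 2 ∂Q)
        fun i k => ∫ x, |x (i, k)| ^ 3 ∂Q) := by
  intro κ f H hf
  have h2 : ∀ p, MemLp (fun x : Fin n × Fin n → ℝ => x p) 2 Q := fun p =>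
    (h3 p).mono_exponent (by norm_num)
  have h1 : ∀ p, Integrable (fun x : Fin n × Fin n → ℝ => x p) Q := fun p =>
    (h2 p).integrable (by norm_num)
  have i1 : ∀ (τ : Equiv.Perm (Fin n)) i, Integrable (fun x => x (i, τ i) * f i (permVec τ x)) Q :=
    fun τ i => (h2 _).integrable_mul (hf.memLp_comp i fun j => h2 _)
  rw [integral_permLaw (F := fun y => ∑ i, y i * f i y)
    (Finset.measurable_fun_sum _ fun i _ =>
      (measurable_pi_apply i).mul (hf.continuous_field i).measurable)
    (fun τ => integrable_finsetSum _ fun i _ => i1 τ i)]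
  have e : ∀ τ : Equiv.Perm (Fin n), ∫ x, ∑ i, permVec τ x i * f i (permVec τ x) ∂Q
      = ∑ i, ∫ x, x (i, τ i) * f i (permVec τ x) ∂Q := fun τ =>
    integral_finsetSum _ fun i _ => i1 τ i
  simp only [e]
  rw [permAvg_sum]
  simp only [fun i j => integral_permLaw (Q := Q) (hf.continuous_jacobian i j).measurable
    fun τ => hf.integrable_jacobian_comp i j (measurable_permVec τ).aemeasurable]
  -- The integrals over the array for fixed `τ` are the functions of the permutation required by the
  -- combinatorial core; each hypothesis there is one of the preceding estimates.
  exact abs_sum_permAvg_sub_le hn hf.nonneg (fun i k => integral_nonneg fun x => by positivity)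
    (fun i k => abs_integral_le_integral_abs) hc0
    (a := fun i τ => ∫ x, f i (Function.update (permVec τ x) i 0) ∂Q)
    (b := fun i τ => ∫ x, H i i (Function.update (permVec τ x) i 0) ∂Q)
    (q := fun i j τ => ∫ x, H i j (Function.update (Function.update (permVec τ x) i 0) j 0) ∂Q)
    (fun i τ => abs_integral_mul_field_sub_le hf hQ h3 i τ)
    (fun i j hij τ => abs_integral_field_swap_sub_le hf hQ h2 hij τ)
    (fun i j τ => abs_integral_jacobian_swap_sub_le hf h1 i j τ)
    (fun i j hij τ => by simp only [update_update_permVec_swap τ hij])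
    (fun i j _ b hbi hbj τ => abs_integral_jacobian_far_swap_sub_le hf h1 hbi hbj τ)
    (fun i j _ τ => abs_integral_jacobian_update_sub_le hf h1 i j τ)

end PermStatistic

/-! ### Gaussian integration by parts in several variables -/

section GaussianPi

variable {ι : Type*} [Fintype ι] [DecidableEq ι]

/-- Resampling one coordinate leaves a product law unchanged. This allows one coordinate to be
integrated first, reducing Gaussian integration by parts to dimension one. -/
theorem measurePreserving_update (μ : ι → Measure ℝ) [∀ i, IsProbabilityMeasure (μ i)] (p : ι) :
    MeasurePreserving (fun q : (ι → ℝ) × ℝ => Function.update q.1 p q.2)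
      ((Measure.pi μ).prod (μ p)) (Measure.pi μ) := by
  have hm : Measurable fun q : (ι → ℝ) × ℝ => Function.update q.1 p q.2 := by
    refine measurable_pi_lambda _ fun i => ?_
    by_cases h : i = p
    · subst h
      simpa using measurable_snd
    · simp only [Function.update_of_ne h]
      exact (measurable_pi_apply i).comp measurable_fst
  refine ⟨hm, (Measure.pi_eq fun s hs => ?_).symm⟩
  rw [Measure.map_apply hm (MeasurableSet.univ_pi hs)]
  have e : (fun q : (ι → ℝ) × ℝ => Function.update q.1 p q.2) ⁻¹' (Set.univ.pi s)
      = (Set.univ.pi (Function.update s p Set.univ)) ×ˢ s p := by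
    ext ⟨z, t⟩
    simp only [Set.mem_preimage, Set.mem_pi, Set.mem_univ, true_imp_iff, Set.mem_prod]
    constructor
    · intro h
      refine ⟨fun i => ?_, by simpa using h p⟩
      by_cases hi : i = p
      · subst hi; simp
      · simpa [hi] using h i
    · rintro ⟨h1, h2⟩ i
      by_cases hi : i = p
      · subst hi; simpa using h2
      · simpa [hi] using h1 i
  rw [e, Measure.prod_prod, Measure.pi_pi, ← Finset.prod_erase_mul _ _ (Finset.mem_univ p),
    ← Finset.prod_erase_mul _ (fun i => μ i (s i)) (Finset.mem_univ p)]
  simp only [Function.update_self, measure_univ, mul_one]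
  congr 1
  exact Finset.prod_congr rfl fun i hi => by
    rw [Function.update_of_ne (Finset.ne_of_mem_erase hi)]

theorem integral_coord_mul_gaussian_pi (p : ι) {F F' : (ι → ℝ) → ℝ}
    (hF : ∀ z t, HasDerivAt (fun t => F (Function.update z p t)) (F' (Function.update z p t)) t)
    (hFi : Integrable F (Measure.pi fun _ => gaussianReal 0 1))
    (hF'i : Integrable F' (Measure.pi fun _ => gaussianReal 0 1))
    (hFt : Integrable (fun z => z p * F z) (Measure.pi fun _ => gaussianReal 0 1)) :
    ∫ z, z p * F z ∂Measure.pi (fun _ => gaussianReal 0 1)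
      = ∫ z, F' z ∂Measure.pi (fun _ => gaussianReal 0 1) := by
  have mp := measurePreserving_update (fun _ : ι => gaussianReal 0 1) p
  have key : ∀ {Φ : (ι → ℝ) → ℝ}, Integrable Φ (Measure.pi fun _ => gaussianReal 0 1) →
      ∫ z, Φ z ∂Measure.pi (fun _ => gaussianReal 0 1) = ∫ z, ∫ t, Φ (Function.update z p t)
        ∂gaussianReal 0 1 ∂Measure.pi (fun _ => gaussianReal 0 1) := fun {Φ} hΦ => by
    have hi := mp.integrable_comp_of_integrable hΦ
    have e : ∫ z, Φ z ∂Measure.pi (fun _ => gaussianReal 0 1)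
        = ∫ z, Φ z ∂(((Measure.pi fun _ : ι => gaussianReal 0 1).prod (gaussianReal 0 1)).map
          fun q : (ι → ℝ) × ℝ => Function.update q.1 p q.2) := by rw [mp.map_eq]
    rw [e, integral_map mp.measurable.aemeasurable (by rw [mp.map_eq]; exact hΦ.1)]
    exact integral_prod _ hi
  rw [key hFt, key hF'i]
  have a1 := (mp.integrable_comp_of_integrable hFi).prod_right_ae
  have a2 := (mp.integrable_comp_of_integrable hF'i).prod_right_ae
  have a3 := (mp.integrable_comp_of_integrable hFt).prod_right_ae
  refine integral_congr_ae ?_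
  filter_upwards [a1, a2, a3] with z b1 b2 b3
  simp only [Function.comp_def, Function.update_self] at b1 b2 b3 ⊢
  exact integral_id_mul_gaussianReal (hF z) b1 b2 b3

end GaussianPi

/-! ### Approximate integration by parts for the Gaussian mixture -/

section Mixture

variable {n : ℕ}

/-- The centred entries `z_{il} - (1/n) ∑_j z_{jl}`. -/
def colCentered (z : Fin n × Fin n → ℝ) (p : Fin n × Fin n) : ℝ :=
  z p - 1 / (n : ℝ) * ∑ j, z (j, p.2)

/-- The vector `Ẑ` as a function of the arrays `x` and `z`. -/
def mixVec (x z : Fin n × Fin n → ℝ) (i : Fin n) : ℝ :=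
  1 / √((n : ℝ) - 1) * ∑ l, x (i, l) * colCentered z (i, l)

/-- The coefficient of `z_p` in `mixVec x z i`. -/
def mixCoef (x : Fin n × Fin n → ℝ) (p : Fin n × Fin n) (i : Fin n) : ℝ :=
  1 / √((n : ℝ) - 1) * (x (i, p.2) * ((if p.1 = i then 1 else 0) - 1 / (n : ℝ)))

theorem mixVec_eq_sum (x z : Fin n × Fin n → ℝ) (i : Fin n) :
    mixVec x z i = ∑ p, z p * mixCoef x p i := by
  have e : ∀ l, ∑ a, z (a, l) * mixCoef x (a, l) i
      = 1 / √((n : ℝ) - 1) * (x (i, l) * colCentered z (i, l)) := fun l => by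
    have : ∀ a, z (a, l) * mixCoef x (a, l) i = 1 / √((n : ℝ) - 1) * (x (i, l) *
        ((if a = i then z (a, l) else 0) - 1 / (n : ℝ) * z (a, l))) := fun a => by
      unfold mixCoef
      split_ifs <;> ring
    simp only [this, ← Finset.mul_sum, Finset.sum_sub_distrib, Finset.sum_ite_eq', Finset.mem_univ,
      if_true, colCentered]
  rw [Fintype.sum_prod_type_right]
  simp only [e, mixVec, Finset.mul_sum]

theorem mixVec_update (x z : Fin n × Fin n → ℝ) (p : Fin n × Fin n) (t : ℝ) :
    mixVec x (Function.update z p t) = mixVec x (Function.update z p 0) + t • mixCoef x p := by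
  funext i
  rw [Pi.add_apply, mixVec_eq_sum, mixVec_eq_sum, ← Finset.add_sum_erase _ _ (Finset.mem_univ p),
    ← Finset.add_sum_erase (a := p) Finset.univ
      (fun q => Function.update z p 0 q * mixCoef x q i) (Finset.mem_univ p)]
  have e : ∀ s : ℝ, ∑ q ∈ Finset.univ.erase p, Function.update z p s q * mixCoef x q i
      = ∑ q ∈ Finset.univ.erase p, z q * mixCoef x q i := fun s =>
    Finset.sum_congr rfl fun q hq => by rw [Function.update_of_ne (Finset.ne_of_mem_erase hq)]
  simp only [e, Function.update_self, Pi.smul_apply, smul_eq_mul]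
  ring

/-- The covariance of `Ẑ` given `X'' = x`. Centring each column of `Z` is a projection with entries
`δ_ij - 1 / n`; divided by `n - 1` it gives `1 / n` on the diagonal and `-1 / (n (n - 1))` off it,
precisely the weights in `permCov`. -/
theorem sum_mixCoef_mul (hn : 2 ≤ n) (x : Fin n × Fin n → ℝ) (i j : Fin n) :
    ∑ p, mixCoef x p i * mixCoef x p j
      = (if i = j then 1 / (n : ℝ) else -(1 / ((n : ℝ) * (n - 1)))) * ∑ l, x (i, l) * x (j, l) := by
  have hn' : (2 : ℝ) ≤ n := by exact_mod_cast hn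
  have h1 : 0 < (n : ℝ) - 1 := by linarith
  have hs : (1 / √((n : ℝ) - 1)) * (1 / √((n : ℝ) - 1)) = 1 / ((n : ℝ) - 1) := by
    rw [div_mul_div_comm, one_mul, Real.mul_self_sqrt h1.le]
  have e1 : ∀ a l, mixCoef x (a, l) i * mixCoef x (a, l) j
      = 1 / ((n : ℝ) - 1) * (x (i, l) * x (j, l))
      * (((if a = i then 1 else 0) - 1 / (n : ℝ)) * ((if a = j then 1 else 0) - 1 / (n : ℝ))) :=
    fun a l => by
      rw [← hs]
      unfold mixCoef
      ring
  have e2 : ∑ a : Fin n, (((if a = i then 1 else 0) - 1 / (n : ℝ)) *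
      ((if a = j then 1 else 0) - 1 / (n : ℝ))) = (if i = j then 1 else 0) - 1 / (n : ℝ) := by
    have : ∀ a : Fin n, ((if a = i then (1 : ℝ) else 0) - 1 / (n : ℝ)) *
        ((if a = j then 1 else 0) - 1 / (n : ℝ)) = (if a = i then (if i = j then 1 else 0) else 0)
        - (if a = i then 1 / (n : ℝ) else 0) - (if a = j then 1 / (n : ℝ) else 0)
        + 1 / (n : ℝ) * (1 / (n : ℝ)) := fun a => by
      by_cases h : a = i
      · subst h
        by_cases h' : a = j <;> simp [h'] <;> ring
      · by_cases h' : a = j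
        · subst h'
          simp [h]
          ring
        · simp [h, h']
    simp only [this, Finset.sum_add_distrib, Finset.sum_sub_distrib, Finset.sum_ite_eq',
      Finset.mem_univ, if_true, Finset.sum_const, Finset.card_univ, Fintype.card_fin, nsmul_eq_mul]
    field_simp
    ring
  rw [Fintype.sum_prod_type_right]
  simp only [e1, ← Finset.mul_sum, e2]
  rw [← Finset.sum_mul, ← Finset.mul_sum]
  by_cases h : i = j
  · simp only [h, if_true]
    field_simp
  · simp only [h, if_false]
    field_simp
    ring

/-- The joint law of an array with law `Q` and an independent array of i.i.d. standard normal
variables. -/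
abbrev gaussProd (Q : Measure (Fin n × Fin n → ℝ)) :
    Measure ((Fin n × Fin n → ℝ) × (Fin n × Fin n → ℝ)) :=
  Q.prod (Measure.pi fun _ => gaussianReal 0 1)

theorem measurable_mixVec :
    Measurable fun q : (Fin n × Fin n → ℝ) × (Fin n × Fin n → ℝ) => mixVec q.1 q.2 := by
  refine measurable_pi_lambda _ fun i => ?_
  unfold mixVec colCentered
  fun_prop

theorem memLp_gaussian_coord (p : Fin n × Fin n) :
    MemLp (fun z : Fin n × Fin n → ℝ => z p) 2
      (Measure.pi fun _ : Fin n × Fin n => gaussianReal 0 1) := by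
  have := (memLp_id_gaussianReal (μ := 0) (v := 1) 2).comp_measurePreserving
    (measurePreserving_eval (fun _ : Fin n × Fin n => gaussianReal 0 1) p)
  exact_mod_cast this

theorem integral_gaussian_mul (p q : Fin n × Fin n) :
    ∫ z : Fin n × Fin n → ℝ, z p * z q ∂Measure.pi (fun _ => gaussianReal 0 1)
      = if p = q then 1 else 0 := by
  have hL := memLp_gaussian_coord (n := n)
  rw [integral_coord_mul_gaussian_pi p (F := fun z => z q) (F' := fun _ => if p = q then 1 else 0)
    (fun z t => ?_) ((hL q).integrable (by norm_num)) (integrable_const _)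
    ((hL p).integrable_mul (hL q))]
  · simp
  · by_cases h : p = q
    · subst h
      simp only [if_true, Function.update_self]
      exact hasDerivAt_id t
    · simp only [h, if_false, Function.update_of_ne (Ne.symm h)]
      exact hasDerivAt_const _ _

theorem memLp_colCentered (p : Fin n × Fin n) :
    MemLp (fun z => colCentered z p) 2
      (Measure.pi fun _ : Fin n × Fin n => gaussianReal 0 1) := by
  have h : MemLp (fun z : Fin n × Fin n → ℝ => ∑ j, z (j, p.2)) 2
      (Measure.pi fun _ : Fin n × Fin n => gaussianReal 0 1) :=
    memLp_finsetSum _ fun j _ => memLp_gaussian_coord (j, p.2)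
  exact (memLp_gaussian_coord p).sub (h.const_mul (1 / (n : ℝ)))

/-- The variance of a centred entry is `1 - 1 / n`, and `|t| ≤ (1 + t²) / 2`. -/
theorem integral_abs_colCentered_le (p : Fin n × Fin n) :
    ∫ z, |colCentered z p| ∂Measure.pi (fun _ : Fin n × Fin n => gaussianReal 0 1) ≤ 1 := by
  have hn : (n : ℝ) ≠ 0 := by
    have : 0 < n := (Nat.zero_le _).trans_lt p.1.2
    positivity
  have hL := memLp_gaussian_coord (n := n)
  have hi : ∀ a b, Integrable (fun z : Fin n × Fin n → ℝ => z a * z b)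
      (Measure.pi fun _ => gaussianReal 0 1) := fun a b => (hL a).integrable_mul (hL b)
  have hsq : ∫ z, colCentered z p ^ 2 ∂Measure.pi (fun _ : Fin n × Fin n => gaussianReal 0 1)
      = 1 - 1 / (n : ℝ) := by
    have e : ∀ z : Fin n × Fin n → ℝ, colCentered z p ^ 2 = z p * z p
        - 2 / (n : ℝ) * ∑ j, z p * z (j, p.2)
        + 1 / (n : ℝ) ^ 2 * ∑ j, ∑ k, z (j, p.2) * z (k, p.2) := fun z => by
      rw [← Finset.mul_sum, ← Finset.sum_mul_sum, colCentered]
      field_simp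
      ring
    have i1 : Integrable (fun z : Fin n × Fin n → ℝ => 2 / (n : ℝ) * ∑ j, z p * z (j, p.2))
        (Measure.pi fun _ => gaussianReal 0 1) :=
      (integrable_finsetSum _ fun j _ => hi _ _).const_mul _
    have i2 : Integrable (fun z : Fin n × Fin n → ℝ =>
        1 / (n : ℝ) ^ 2 * ∑ j, ∑ k, z (j, p.2) * z (k, p.2))
        (Measure.pi fun _ => gaussianReal 0 1) :=
      (integrable_finsetSum _ fun j _ => integrable_finsetSum _ fun k _ => hi _ _).const_mul _
    have i3 : Integrable (fun z : Fin n × Fin n → ℝ => z p * z p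
        - 2 / (n : ℝ) * ∑ j, z p * z (j, p.2)) (Measure.pi fun _ => gaussianReal 0 1) :=
      (hi p p).sub i1
    simp only [e]
    rw [integral_add i3 i2, integral_sub (hi p p) i1, integral_const_mul, integral_const_mul,
      integral_finsetSum _ fun j _ => hi _ _,
      integral_finsetSum _ fun j _ => integrable_finsetSum _ fun k _ => hi _ _]
    simp only [fun j => integral_finsetSum
      (μ := Measure.pi fun _ : Fin n × Fin n => gaussianReal 0 1)
      Finset.univ fun k (_ : k ∈ Finset.univ) => hi (j, p.2) (k, p.2), integral_gaussian_mul]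
    have e3 : ∀ j : Fin n, (p = (j, p.2)) ↔ j = p.1 := fun j => by
      constructor
      · intro h; rw [h]
      · rintro rfl; rfl
    simp [e3]
    field_simp
    ring
  have hc := memLp_colCentered p
  calc ∫ z, |colCentered z p| ∂Measure.pi (fun _ : Fin n × Fin n => gaussianReal 0 1)
      ≤ ∫ z, (1 + colCentered z p ^ 2) / 2 ∂Measure.pi
          (fun _ : Fin n × Fin n => gaussianReal 0 1) :=
        integral_mono (hc.integrable (by norm_num)).abs
          (((integrable_const 1).add hc.integrable_sq).div_const 2) fun z => by
            have := sq_nonneg (|colCentered z p| - 1)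
            simp only
            rw [← sq_abs (colCentered z p)]
            linarith
    _ = (1 + (1 - 1 / (n : ℝ))) / 2 := by
        rw [integral_div, integral_add (integrable_const 1) hc.integrable_sq, hsq]
        simp
    _ ≤ 1 := by
        have : 0 ≤ 1 / (n : ℝ) := by positivity
        linarith

end Mixture

/-! ### Replacing the random covariance of the mixture by its mean -/

section MixtureStein

variable {n : ℕ} {Q : Measure (Fin n × Fin n → ℝ)} [IsProbabilityMeasure Q] {κ : ℝ}
  {f : Fin n → (Fin n → ℝ) → ℝ} {H : Fin n → Fin n → (Fin n → ℝ) → ℝ}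

/-- Setting the coordinates in `S` to zero. -/
def zeroOn (S : Finset (Fin n × Fin n)) (x : Fin n × Fin n → ℝ) : Fin n × Fin n → ℝ :=
  fun p => if p ∈ S then 0 else x p

theorem measurable_zeroOn (S : Finset (Fin n × Fin n)) : Measurable (zeroOn S) := by
  refine measurable_pi_lambda _ fun p => ?_
  by_cases h : p ∈ S
  · simp [zeroOn, h]
  · simp only [zeroOn, h, if_false]
    exact measurable_pi_apply p

theorem zeroOn_congr (S : Finset (Fin n × Fin n)) {x y : Fin n × Fin n → ℝ}
    (h : ∀ p ∈ ((Sᶜ : Finset _) : Set (Fin n × Fin n)), x p = y p) : zeroOn S x = zeroOn S y := by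
  funext p
  by_cases hp : p ∈ S
  · simp [zeroOn, hp]
  · simp only [zeroOn, hp, if_false]
    exact h p (by simpa using hp)

theorem sum_abs_mixVec_zeroOn_le (S : Finset (Fin n × Fin n)) (x z : Fin n × Fin n → ℝ) :
    ∑ i, |mixVec x z i - mixVec (zeroOn S x) z i| ≤
      1 / √((n : ℝ) - 1) * ∑ p ∈ S, |x p| * |colCentered z p| := by
  have e : ∀ i, |mixVec x z i - mixVec (zeroOn S x) z i| ≤ 1 / √((n : ℝ) - 1) *
      ∑ l, if (i, l) ∈ S then |x (i, l)| * |colCentered z (i, l)| else 0 := fun i => by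
    rw [mixVec, mixVec, ← mul_sub, ← Finset.sum_sub_distrib, abs_mul,
      abs_of_nonneg (by positivity : 0 ≤ 1 / √((n : ℝ) - 1))]
    refine mul_le_mul_of_nonneg_left ((Finset.abs_sum_le_sum_abs _ _).trans
      (Finset.sum_le_sum fun l _ => ?_)) (by positivity)
    by_cases h : (i, l) ∈ S
    · simp [zeroOn, h, abs_mul]
    · simp [zeroOn, h]
  refine (Finset.sum_le_sum fun i _ => e i).trans (le_of_eq ?_)
  rw [← Finset.mul_sum, ← Fintype.sum_prod_type' fun i l =>
    if (i, l) ∈ S then |x (i, l)| * |colCentered z (i, l)| else 0]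
  simp

/-- Setting the entries `a` and `b` to zero makes the Jacobian independent of `x a * x b`. The
replacement is paid for twice, in the mean of the product and in the product of the means, each time
by the Lipschitz property; hence the two kinds of moments in the bound. -/
theorem abs_integral_decouple_le (hf : IsSmoothField κ f H)
    (hQ : iIndepFun (fun (p : Fin n × Fin n) (x : Fin n × Fin n → ℝ) => x p) Q)
    (h3 : ∀ p, MemLp (fun x : Fin n × Fin n → ℝ => x p) 3 Q) (i j : Fin n)
    (a b : Fin n × Fin n) (z : Fin n × Fin n → ℝ)
    (habc : ∀ c, Integrable (fun x : Fin n × Fin n → ℝ => |x a * x b| * |x c|) Q) :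
    |∫ x, x a * x b * H i j (mixVec x z) ∂Q
      - (∫ x, x a * x b ∂Q) * ∫ x, H i j (mixVec x z) ∂Q| ≤
      κ * (1 / √((n : ℝ) - 1) * (|colCentered z a| *
          (∫ x, |x a * x b| * |x a| ∂Q + (∫ x, |x a * x b| ∂Q) * ∫ x, |x a| ∂Q)
        + |colCentered z b| *
          (∫ x, |x a * x b| * |x b| ∂Q + (∫ x, |x a * x b| ∂Q) * ∫ x, |x b| ∂Q))) := by
  have h2 : ∀ p, MemLp (fun x : Fin n × Fin n → ℝ => x p) 2 Q := fun p =>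
    (h3 p).mono_exponent (by norm_num)
  have h1 : ∀ p, Integrable (fun x : Fin n × Fin n → ℝ => x p) Q := fun p =>
    (h2 p).integrable (by norm_num)
  have hab : Integrable (fun x : Fin n × Fin n → ℝ => x a * x b) Q := (h2 a).integrable_mul (h2 b)
  obtain ⟨B, hB0, hB⟩ := hf.bounded
  let S : Finset (Fin n × Fin n) := {a, b}
  have mw : Measurable fun x => mixVec (n := n) x z :=
    measurable_mixVec.comp (measurable_id.prodMk measurable_const)
  have mw0 : Measurable fun x => mixVec (zeroOn S x) z := mw.comp (measurable_zeroOn S)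
  have mH : Measurable fun x => H i j (mixVec x z) :=
    (hf.continuous_jacobian i j).measurable.comp mw
  have mH0 : Measurable fun x => H i j (mixVec (zeroOn S x) z) :=
    (hf.continuous_jacobian i j).measurable.comp mw0
  let δ : (Fin n × Fin n → ℝ) → ℝ := fun x =>
    1 / √((n : ℝ) - 1) * (|x a| * |colCentered z a| + |x b| * |colCentered z b|)
  have hδ : ∀ x, ∑ m, |mixVec x z m - mixVec (zeroOn S x) z m| ≤ δ x := fun x => by
    refine (sum_abs_mixVec_zeroOn_le S x z).trans (mul_le_mul_of_nonneg_left ?_ (by positivity))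
    by_cases h : a = b
    · subst h
      have : 0 ≤ |x a| * |colCentered z a| := by positivity
      simpa [S] using this
    · rw [Finset.sum_pair h]
  have iδ : Integrable δ Q :=
    (((h1 a).abs.mul_const _).add ((h1 b).abs.mul_const _)).const_mul _
  have iδ' : Integrable (fun x => |x a * x b| * δ x) Q := by
    refine ((((habc a).mul_const |colCentered z a|).add
      ((habc b).mul_const |colCentered z b|)).const_mul (1 / √((n : ℝ) - 1))).congr
      (ae_of_all _ fun x => ?_)
    simp only [δ, Pi.add_apply]
    ring
  have ind : ∫ x, x a * x b * H i j (mixVec (zeroOn S x) z) ∂Q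
      = (∫ x, x a * x b ∂Q) * ∫ x, H i j (mixVec (zeroOn S x) z) ∂Q :=
    integral_mul_of_dependsOn hQ S (φ := fun x => x a * x b)
      ((measurable_pi_apply a).mul (measurable_pi_apply b)) mH0
      (fun x y h => congrArg₂ (· * ·) (h a (by simp [S])) (h b (by simp [S])))
      (fun x y h => congrArg (fun w => H i j (mixVec w z)) (zeroOn_congr S h))
  have i1 : Integrable (fun x => x a * x b * H i j (mixVec x z)) Q :=
    hab.mul_bdd (c := B) mH.aestronglyMeasurable (ae_of_all _ fun x => hB _ _ _)
  have i2 : Integrable (fun x => x a * x b * H i j (mixVec (zeroOn S x) z)) Q :=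
    hab.mul_bdd (c := B) mH0.aestronglyMeasurable (ae_of_all _ fun x => hB _ _ _)
  have b1 : |∫ x, x a * x b * H i j (mixVec x z) ∂Q
      - ∫ x, x a * x b * H i j (mixVec (zeroOn S x) z) ∂Q| ≤ κ * ∫ x, |x a * x b| * δ x ∂Q := by
    rw [← integral_sub i1 i2, ← integral_const_mul]
    refine (Real.norm_eq_abs _).symm.trans_le
      (norm_integral_le_of_norm_le (iδ'.const_mul κ) (ae_of_all _ fun x => ?_))
    rw [← mul_sub, norm_mul, mul_left_comm]
    exact mul_le_mul_of_nonneg_left ((hf.lipschitz i j _ _).trans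
      (mul_le_mul_of_nonneg_left (hδ x) hf.nonneg)) (norm_nonneg _)
  have b2 := hf.abs_integral_jacobian_sub_le i j (Q := Q) mw.aemeasurable mw0.aemeasurable iδ hδ
  have b3 : |∫ x, x a * x b ∂Q| ≤ ∫ x, |x a * x b| ∂Q := abs_integral_le_integral_abs
  have b4 : |(∫ x, x a * x b ∂Q) * (∫ x, H i j (mixVec x z) ∂Q
      - ∫ x, H i j (mixVec (zeroOn S x) z) ∂Q)| ≤ (∫ x, |x a * x b| ∂Q) * (κ * ∫ x, δ x ∂Q) := by
    rw [abs_mul]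
    exact mul_le_mul b3 b2 (abs_nonneg _) (integral_nonneg fun x => abs_nonneg _)
  have e1 : ∫ x, δ x ∂Q = 1 / √((n : ℝ) - 1) * ((∫ x, |x a| ∂Q) * |colCentered z a|
      + (∫ x, |x b| ∂Q) * |colCentered z b|) := by
    rw [integral_const_mul, integral_add ((h1 a).abs.mul_const _) ((h1 b).abs.mul_const _),
      integral_mul_const, integral_mul_const]
  have e2 : ∫ x, |x a * x b| * δ x ∂Q = 1 / √((n : ℝ) - 1) *
      ((∫ x, |x a * x b| * |x a| ∂Q) * |colCentered z a|
      + (∫ x, |x a * x b| * |x b| ∂Q) * |colCentered z b|) := by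
    rw [← integral_mul_const, ← integral_mul_const,
      ← integral_add ((habc a).mul_const _) ((habc b).mul_const _), ← integral_const_mul]
    refine integral_congr_ae (ae_of_all _ fun x => ?_)
    simp only [δ]
    ring
  rw [e1] at b4
  rw [e2, ind] at b1
  rw [mul_sub] at b4
  rw [abs_le] at b1 b4 ⊢
  constructor <;> linarith [b1.1, b1.2, b4.1, b4.2]

theorem abs_integral_gaussProd_decouple_le (hf : IsSmoothField κ f H)
    (hQ : iIndepFun (fun (p : Fin n × Fin n) (x : Fin n × Fin n → ℝ) => x p) Q)
    (h3 : ∀ p, MemLp (fun x : Fin n × Fin n → ℝ => x p) 3 Q) (i j : Fin n)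
    (a b : Fin n × Fin n)
    (habc : ∀ c, Integrable (fun x : Fin n × Fin n → ℝ => |x a * x b| * |x c|) Q) :
    |∫ q, q.1 a * q.1 b * H i j (mixVec q.1 q.2) ∂gaussProd Q
      - (∫ x, x a * x b ∂Q) * ∫ q, H i j (mixVec q.1 q.2) ∂gaussProd Q| ≤
      κ * (1 / √((n : ℝ) - 1) *
          ((∫ x, |x a * x b| * |x a| ∂Q + (∫ x, |x a * x b| ∂Q) * ∫ x, |x a| ∂Q)
        + (∫ x, |x a * x b| * |x b| ∂Q + (∫ x, |x a * x b| ∂Q) * ∫ x, |x b| ∂Q))) := by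
  have h2 : ∀ p, MemLp (fun x : Fin n × Fin n → ℝ => x p) 2 Q := fun p =>
    (h3 p).mono_exponent (by norm_num)
  have hab : Integrable (fun x : Fin n × Fin n → ℝ => x a * x b) Q := (h2 a).integrable_mul (h2 b)
  obtain ⟨B, hB0, hB⟩ := hf.bounded
  have iH : Integrable (fun q : (Fin n × Fin n → ℝ) × (Fin n × Fin n → ℝ) =>
      H i j (mixVec q.1 q.2)) (gaussProd Q) :=
    hf.integrable_jacobian_comp i j measurable_mixVec.aemeasurable
  have iabH : Integrable (fun q : (Fin n × Fin n → ℝ) × (Fin n × Fin n → ℝ) =>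
      q.1 a * q.1 b * H i j (mixVec q.1 q.2)) (gaussProd Q) :=
    (hab.comp_fst _).mul_bdd (c := B) iH.1 (ae_of_all _ fun q => hB _ _ _)
  rw [integral_prod_symm _ iH, integral_prod_symm _ iabH, ← integral_const_mul,
    ← integral_sub iabH.integral_prod_right (iH.integral_prod_right.const_mul _)]
  set A := ∫ x, |x a * x b| * |x a| ∂Q + (∫ x, |x a * x b| ∂Q) * ∫ x, |x a| ∂Q
  set A' := ∫ x, |x a * x b| * |x b| ∂Q + (∫ x, |x a * x b| ∂Q) * ∫ x, |x b| ∂Q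
  have hA : 0 ≤ A := add_nonneg (integral_nonneg fun x => by positivity)
    (mul_nonneg (integral_nonneg fun x => by positivity) (integral_nonneg fun x => by positivity))
  have hA' : 0 ≤ A' := add_nonneg (integral_nonneg fun x => by positivity)
    (mul_nonneg (integral_nonneg fun x => by positivity) (integral_nonneg fun x => by positivity))
  have ic : ∀ p, Integrable (fun z => |colCentered z p|)
      (Measure.pi fun _ : Fin n × Fin n => gaussianReal 0 1) := fun p =>
    ((memLp_colCentered p).integrable (by norm_num)).abs
  refine (Real.norm_eq_abs _).symm.trans_le ((norm_integral_le_of_norm_le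
    (((((ic a).mul_const A).add ((ic b).mul_const A')).const_mul (1 / √((n : ℝ) - 1))).const_mul κ)
    (ae_of_all _ fun z => abs_integral_decouple_le hf hQ h3 i j a b z habc)).trans ?_)
  rw [integral_const_mul, integral_const_mul]
  refine mul_le_mul_of_nonneg_left (mul_le_mul_of_nonneg_left ?_ (by positivity)) hf.nonneg
  have := integral_add ((ic a).mul_const A) ((ic b).mul_const A')
  simp only [Pi.add_apply] at this ⊢
  rw [this, integral_mul_const, integral_mul_const]
  exact add_le_add (mul_le_of_le_one_left hA (integral_abs_colCentered_le a))
    (mul_le_of_le_one_left hA' (integral_abs_colCentered_le b))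

omit [IsProbabilityMeasure Q] in
theorem memLp_mixVec (h2 : ∀ p, MemLp (fun x : Fin n × Fin n → ℝ => x p) 2 Q) (i : Fin n) :
    MemLp (fun q : (Fin n × Fin n → ℝ) × (Fin n × Fin n → ℝ) => mixVec q.1 q.2 i) 2
      (gaussProd Q) := by
  have h : ∀ l, MemLp (fun q : (Fin n × Fin n → ℝ) × (Fin n × Fin n → ℝ) =>
      q.1 (i, l) * colCentered q.2 (i, l)) 2 (gaussProd Q) := fun l => by
    rw [memLp_two_iff_integrable_sq]
    · simp only [mul_pow]
      exact (h2 (i, l)).integrable_sq.mul_prod (memLp_colCentered (i, l)).integrable_sq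
    · refine Measurable.aestronglyMeasurable ?_
      unfold colCentered
      fun_prop
  have hs : MemLp (fun q : (Fin n × Fin n → ℝ) × (Fin n × Fin n → ℝ) =>
      ∑ l, q.1 (i, l) * colCentered q.2 (i, l)) 2 (gaussProd Q) := memLp_finsetSum _ fun l _ => h l
  exact hs.const_mul _

omit [IsProbabilityMeasure Q] in
theorem memLp_coord_mul_mixCoef (h2 : ∀ p, MemLp (fun x : Fin n × Fin n → ℝ => x p) 2 Q)
    (p : Fin n × Fin n) (i : Fin n) :
    MemLp (fun q : (Fin n × Fin n → ℝ) × (Fin n × Fin n → ℝ) => q.2 p * mixCoef q.1 p i) 2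
      (gaussProd Q) := by
  rw [memLp_two_iff_integrable_sq]
  · have e : ∀ q : (Fin n × Fin n → ℝ) × (Fin n × Fin n → ℝ), (q.2 p * mixCoef q.1 p i) ^ 2
        = (1 / √((n : ℝ) - 1) * ((if p.1 = i then 1 else 0) - 1 / (n : ℝ))) ^ 2 *
          (q.1 (i, p.2) ^ 2 * q.2 p ^ 2) := fun q => by
      unfold mixCoef
      ring
    simp only [e]
    exact ((h2 (i, p.2)).integrable_sq.mul_prod (memLp_gaussian_coord p).integrable_sq).const_mul _
  · refine Measurable.aestronglyMeasurable ?_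
    unfold mixCoef
    fun_prop

theorem integral_coord_mul_field (hf : IsSmoothField κ f H) (p : Fin n × Fin n) (i : Fin n)
    (x : Fin n × Fin n → ℝ) :
    ∫ z, z p * f i (mixVec x z) ∂Measure.pi (fun _ : Fin n × Fin n => gaussianReal 0 1)
      = ∫ z, ∑ j, mixCoef x p j * H i j (mixVec x z)
        ∂Measure.pi (fun _ : Fin n × Fin n => gaussianReal 0 1) := by
  have mw : Measurable fun z => mixVec (n := n) x z :=
    measurable_mixVec.comp (measurable_const.prodMk measurable_id)
  have hw : ∀ j, MemLp (fun z => mixVec x z j) 2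
      (Measure.pi fun _ : Fin n × Fin n => gaussianReal 0 1) := fun j => by
    have : MemLp (fun z => ∑ l, x (j, l) * colCentered z (j, l)) 2
        (Measure.pi fun _ : Fin n × Fin n => gaussianReal 0 1) :=
      memLp_finsetSum _ fun l _ => (memLp_colCentered (j, l)).const_mul _
    exact this.const_mul _
  refine integral_coord_mul_gaussian_pi p (F := fun z => f i (mixVec x z))
    (F' := fun z => ∑ j, mixCoef x p j * H i j (mixVec x z)) (fun z t => ?_)
    ((hf.memLp_comp i hw).integrable (by norm_num))
    (integrable_finsetSum _ fun j _ =>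
      (hf.integrable_jacobian_comp i j mw.aemeasurable).const_mul _)
    ((memLp_gaussian_coord p).integrable_mul (hf.memLp_comp i hw))
  have := hf.hasDerivAt_line i (mixVec x (Function.update z p 0)) (mixCoef x p) t
  simp only [← mixVec_update] at this
  exact this

/-- Given `x`, the vector is a linear function of the Gaussian array. Integration by parts in each
`z p` followed by summation over `p` produces the conditional covariance, so no error arises here.
-/
theorem integral_gaussProd_field (hn : 2 ≤ n) (hf : IsSmoothField κ f H)
    (h2 : ∀ p, MemLp (fun x : Fin n × Fin n → ℝ => x p) 2 Q) :
    ∫ q, ∑ i, mixVec q.1 q.2 i * f i (mixVec q.1 q.2) ∂gaussProd Q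
      = ∑ i, ∑ j, (if i = j then 1 / (n : ℝ) else -(1 / ((n : ℝ) * (n - 1)))) *
        ∑ l, ∫ q, q.1 (i, l) * q.1 (j, l) * H i j (mixVec q.1 q.2) ∂gaussProd Q := by
  obtain ⟨B, hB0, hB⟩ := hf.bounded
  have hF : ∀ i, MemLp (fun q : (Fin n × Fin n → ℝ) × (Fin n × Fin n → ℝ) =>
      f i (mixVec q.1 q.2)) 2 (gaussProd Q) := fun i => hf.memLp_comp i (memLp_mixVec h2)
  have iH : ∀ i j, Integrable (fun q : (Fin n × Fin n → ℝ) × (Fin n × Fin n → ℝ) =>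
      H i j (mixVec q.1 q.2)) (gaussProd Q) := fun i j =>
    hf.integrable_jacobian_comp i j measurable_mixVec.aemeasurable
  have ixx : ∀ a b, Integrable (fun q : (Fin n × Fin n → ℝ) × (Fin n × Fin n → ℝ) =>
      q.1 a * q.1 b) (gaussProd Q) := fun a b =>
    Integrable.comp_fst (f := fun x : Fin n × Fin n → ℝ => x a * x b)
      ((h2 a).integrable_mul (h2 b)) _
  have ixxH : ∀ a b i j, Integrable (fun q : (Fin n × Fin n → ℝ) × (Fin n × Fin n → ℝ) =>
      q.1 a * q.1 b * H i j (mixVec q.1 q.2)) (gaussProd Q) := fun a b i j =>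
    (ixx a b).mul_bdd (c := B) (iH i j).1 (ae_of_all _ fun q => hB _ _ _)
  have i1 : ∀ i p, Integrable (fun q : (Fin n × Fin n → ℝ) × (Fin n × Fin n → ℝ) =>
      q.2 p * mixCoef q.1 p i * f i (mixVec q.1 q.2)) (gaussProd Q) := fun i p =>
    (memLp_coord_mul_mixCoef h2 p i).integrable_mul (hF i)
  have icc : ∀ p i j, Integrable (fun q : (Fin n × Fin n → ℝ) × (Fin n × Fin n → ℝ) =>
      mixCoef q.1 p i * mixCoef q.1 p j * H i j (mixVec q.1 q.2)) (gaussProd Q) := fun p i j => by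
    refine ((ixxH (i, p.2) (j, p.2) i j).const_mul (1 / √((n : ℝ) - 1) * (1 / √((n : ℝ) - 1)) *
      (((if p.1 = i then 1 else 0) - 1 / (n : ℝ)) * ((if p.1 = j then 1 else 0) -
        1 / (n : ℝ))))).congr (ae_of_all _ fun q => ?_)
    simp only [mixCoef]
    ring
  have step : ∀ i p, ∫ q, q.2 p * mixCoef q.1 p i * f i (mixVec q.1 q.2) ∂gaussProd Q
      = ∑ j, ∫ q, mixCoef q.1 p i * mixCoef q.1 p j * H i j (mixVec q.1 q.2) ∂gaussProd Q :=
    fun i p => by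
      rw [← integral_finsetSum _ fun j _ => icc p i j, integral_prod _ (i1 i p),
        integral_prod _ (integrable_finsetSum _ fun j _ => icc p i j)]
      refine integral_congr_ae (ae_of_all _ fun x => ?_)
      have := integral_coord_mul_field hf p i x
      have e := congrArg (fun t => mixCoef x p i * t) this
      simp only [← integral_const_mul, Finset.mul_sum] at e
      simp only [mul_assoc] at e ⊢
      rw [← e]
      refine integral_congr_ae (ae_of_all _ fun z => ?_)
      simp only
      ring
  have e0 : ∀ q : (Fin n × Fin n → ℝ) × (Fin n × Fin n → ℝ),
      ∑ i, mixVec q.1 q.2 i * f i (mixVec q.1 q.2)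
      = ∑ i, ∑ p, q.2 p * mixCoef q.1 p i * f i (mixVec q.1 q.2) := fun q =>
    Finset.sum_congr rfl fun i _ => by
      rw [← Finset.sum_mul, ← mixVec_eq_sum]
  simp only [e0]
  rw [integral_finsetSum _ fun i _ => integrable_finsetSum _ fun p _ => i1 i p]
  refine Finset.sum_congr rfl fun i _ => ?_
  rw [integral_finsetSum _ fun p _ => i1 i p]
  simp only [step]
  rw [Finset.sum_comm]
  refine Finset.sum_congr rfl fun j _ => ?_
  rw [← integral_finsetSum _ fun p _ => icc p i j, ← integral_finsetSum _ fun l _ => ixxH _ _ i j,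
    ← integral_const_mul]
  refine integral_congr_ae (ae_of_all _ fun q => ?_)
  simp only
  rw [← Finset.sum_mul, sum_mixCoef_mul hn, mul_assoc, Finset.sum_mul]

end MixtureStein

/-! ### Moment inequalities -/

section Moments

variable {α : Type*} [MeasurableSpace α] {Q : Measure α} [IsProbabilityMeasure Q] {X : α → ℝ}

omit [IsProbabilityMeasure Q] in
theorem integrable_abs_pow_three (h : MemLp X 3 Q) : Integrable (fun x => |X x| ^ 3) Q := by
  simpa using h.integrable_norm_pow (by norm_num)

omit [IsProbabilityMeasure Q] in
theorem integrable_abs_sq (h : MemLp X 2 Q) : Integrable (fun x => |X x| ^ 2) Q := by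
  simpa using h.integrable_sq

theorem sq_integral_abs_le (h : MemLp X 2 Q) : (∫ x, |X x| ∂Q) ^ 2 ≤ ∫ x, |X x| ^ 2 ∂Q := by
  set t := ∫ x, |X x| ∂Q with ht
  have i1 : Integrable (fun x => |X x|) Q := (h.integrable (by norm_num)).abs
  have key : ∫ x, (2 * t * |X x| - t ^ 2) ∂Q ≤ ∫ x, |X x| ^ 2 ∂Q :=
    integral_mono ((i1.const_mul _).sub (integrable_const _)) (integrable_abs_sq h) fun x => by
      have := sq_nonneg (|X x| - t)
      simp only
      nlinarith
  rw [integral_sub (i1.const_mul _) (integrable_const _), integral_const_mul, ← ht] at key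
  simp only [integral_const, probReal_univ, one_smul] at key
  nlinarith

/-- With `y = |X|` and `t = E y`, the pointwise bounds `3 t² y - 2 t³ ≤ y³` and `y² t ≤ (2 y³ + t³)
/ 3` integrate to `t³ ≤ E y³` and `t E y² ≤ (2 E y³ + t³) / 3`, which together give the claim. -/
theorem integral_sq_mul_integral_abs_le (h : MemLp X 3 Q) :
    (∫ x, |X x| ^ 2 ∂Q) * ∫ x, |X x| ∂Q ≤ ∫ x, |X x| ^ 3 ∂Q := by
  set t := ∫ x, |X x| ∂Q with ht
  have t0 : 0 ≤ t := integral_nonneg fun x => abs_nonneg _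
  have h2 : MemLp X 2 Q := h.mono_exponent (by norm_num)
  have i1 : Integrable (fun x => |X x|) Q := (h2.integrable (by norm_num)).abs
  have i3 := integrable_abs_pow_three h
  have k1 : ∫ x, (3 * t ^ 2 * |X x| - 2 * t ^ 3) ∂Q ≤ ∫ x, |X x| ^ 3 ∂Q :=
    integral_mono ((i1.const_mul _).sub (integrable_const _)) i3 fun x => by
      -- `y³ - 3 t² y + 2 t³ = (y + 2 t) (y - t)²`.
      have := mul_nonneg (add_nonneg (abs_nonneg (X x)) (mul_nonneg zero_le_two t0))
        (sq_nonneg (|X x| - t))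
      simp only
      nlinarith
  have k2 : ∫ x, |X x| ^ 2 * t ∂Q ≤ ∫ x, (2 / 3 * |X x| ^ 3 + 1 / 3 * t ^ 3) ∂Q :=
    integral_mono ((integrable_abs_sq h2).mul_const _)
      ((i3.const_mul _).add (integrable_const _)) fun x => by
      -- `2 y³ - 3 t y² + t³ = (2 y + t) (y - t)²`.
      have := mul_nonneg (add_nonneg (mul_nonneg zero_le_two (abs_nonneg (X x))) t0)
        (sq_nonneg (|X x| - t))
      simp only
      nlinarith
  rw [integral_sub (i1.const_mul _) (integrable_const _), integral_const_mul, ← ht] at k1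
  rw [integral_mul_const, integral_add (i3.const_mul _) (integrable_const _),
    integral_const_mul] at k2
  simp only [integral_const, probReal_univ, one_smul] at k1 k2
  nlinarith

omit [IsProbabilityMeasure Q] in
theorem integrable_abs_mul_mul {Y Z : α → ℝ} (hX : MemLp X 3 Q) (hY : MemLp Y 3 Q)
    (hZ : MemLp Z 3 Q) : Integrable (fun x => |X x * Y x| * |Z x|) Q := by
  refine Integrable.mono' (((integrable_abs_pow_three hX).add (integrable_abs_pow_three hY)).add
    (integrable_abs_pow_three hZ)) ((hX.1.mul hY.1).norm.mul hZ.1.norm) (ae_of_all _ fun x => ?_)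
  simp only [Pi.add_apply, Real.norm_eq_abs, abs_mul, abs_abs]
  have a := abs_nonneg (X x)
  have b := abs_nonneg (Y x)
  have c := abs_nonneg (Z x)
  -- The factorization of `2 (a³ + b³ + c³ - 3 a b c)`, which bounds the product by the sum of the
  -- cubes.
  have := mul_nonneg (add_nonneg (add_nonneg a b) c)
    (add_nonneg (add_nonneg (sq_nonneg (|X x| - |Y x|)) (sq_nonneg (|Y x| - |Z x|)))
      (sq_nonneg (|Z x| - |X x|)))
  have a3 := pow_nonneg a 3
  have b3 := pow_nonneg b 3
  have c3 := pow_nonneg c 3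
  nlinarith

end Moments

/-! ### The integration by parts error of the mixture -/

section MixtureStein

variable {n : ℕ} {Q : Measure (Fin n × Fin n → ℝ)} [IsProbabilityMeasure Q]

/-- The law of `Ẑ`. -/
def mixLaw (Q : Measure (Fin n × Fin n → ℝ)) : Measure (Fin n → ℝ) :=
  (gaussProd Q).map fun q => mixVec q.1 q.2

/-- The error in the approximate integration by parts formula for `Ẑ`. -/
def mixError (m m₂ m₃ : Fin n → Fin n → ℝ) : ℝ :=
  1 / √((n : ℝ) - 1) * (4 / (n : ℝ) * ∑ i, ∑ l, m₃ i l
    + 4 / ((n : ℝ) * (n - 1)) * ∑ i, ∑ j, ∑ l, m₂ i l * m j l)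

omit [IsProbabilityMeasure Q] in
theorem integral_coord_mul_coord
    (hQ : iIndepFun (fun (p : Fin n × Fin n) (x : Fin n × Fin n → ℝ) => x p) Q)
    {a b : Fin n × Fin n} (hab : a ≠ b) {φ ψ : ℝ → ℝ} (hφ : Measurable φ) (hψ : Measurable ψ) :
    ∫ x, φ (x a) * ψ (x b) ∂Q = (∫ x, φ (x a) ∂Q) * ∫ x, ψ (x b) ∂Q :=
  ((hQ.indepFun hab).comp hφ hψ).integral_fun_mul_eq_mul_integral
    (hφ.comp (measurable_pi_apply a)).aestronglyMeasurable
    (hψ.comp (measurable_pi_apply b)).aestronglyMeasurable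

theorem mixed_moments_diag_le (h3 : ∀ p, MemLp (fun x : Fin n × Fin n → ℝ => x p) 3 Q)
    (a : Fin n × Fin n) :
    (∫ x, |x a * x a| * |x a| ∂Q + (∫ x, |x a * x a| ∂Q) * ∫ x, |x a| ∂Q)
      + (∫ x, |x a * x a| * |x a| ∂Q + (∫ x, |x a * x a| ∂Q) * ∫ x, |x a| ∂Q) ≤
      4 * ∫ x, |x a| ^ 3 ∂Q := by
  have h := integral_sq_mul_integral_abs_le (h3 a)
  have e1 : ∀ x : Fin n × Fin n → ℝ, |x a * x a| * |x a| = |x a| ^ 3 := fun x => by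
    rw [abs_mul]; ring
  have e2 : ∀ x : Fin n × Fin n → ℝ, |x a * x a| = |x a| ^ 2 := fun x => by rw [abs_mul]; ring
  simp only [e1]
  simp only [e2]
  linarith

theorem mixed_moments_offdiag_le
    (hQ : iIndepFun (fun (p : Fin n × Fin n) (x : Fin n × Fin n → ℝ) => x p) Q)
    (h2 : ∀ p, MemLp (fun x : Fin n × Fin n → ℝ => x p) 2 Q)
    {a b : Fin n × Fin n} (hab : a ≠ b) :
    (∫ x, |x a * x b| * |x a| ∂Q + (∫ x, |x a * x b| ∂Q) * ∫ x, |x a| ∂Q)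
      + (∫ x, |x a * x b| * |x b| ∂Q + (∫ x, |x a * x b| ∂Q) * ∫ x, |x b| ∂Q) ≤
      2 * ((∫ x, |x a| ^ 2 ∂Q) * ∫ x, |x b| ∂Q) + 2 * ((∫ x, |x b| ^ 2 ∂Q) * ∫ x, |x a| ∂Q) := by
  have e1 : ∀ x : Fin n × Fin n → ℝ, |x a * x b| * |x a| = |x a| ^ 2 * |x b| := fun x => by
    rw [abs_mul]; ring
  have e2 : ∀ x : Fin n × Fin n → ℝ, |x a * x b| * |x b| = |x b| ^ 2 * |x a| := fun x => by
    rw [abs_mul]; ring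
  have m1 : Measurable fun t : ℝ => |t| := by fun_prop
  have m2 : Measurable fun t : ℝ => |t| ^ 2 := by fun_prop
  simp only [e1, e2]
  rw [integral_coord_mul_coord hQ hab m2 m1, integral_coord_mul_coord hQ hab.symm m2 m1]
  simp only [abs_mul]
  rw [integral_coord_mul_coord hQ hab m1 m1]
  have ha := sq_integral_abs_le (h2 a)
  have hb := sq_integral_abs_le (h2 b)
  have a0 : 0 ≤ ∫ x : Fin n × Fin n → ℝ, |x a| ∂Q := integral_nonneg fun x => abs_nonneg _
  have b0 : 0 ≤ ∫ x : Fin n × Fin n → ℝ, |x b| ∂Q := integral_nonneg fun x => abs_nonneg _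
  nlinarith [mul_le_mul_of_nonneg_right ha b0, mul_le_mul_of_nonneg_right hb a0]

theorem approxStein_mixLaw (hn : 2 ≤ n)
    (hQ : iIndepFun (fun (p : Fin n × Fin n) (x : Fin n × Fin n → ℝ) => x p) Q)
    (h3 : ∀ p, MemLp (fun x : Fin n × Fin n → ℝ => x p) 3 Q) :
    ApproxStein (mixLaw Q) (permCov (fun i k => ∫ x, x (i, k) ∂Q) fun i k => ∫ x, |x (i, k)| ^ 2 ∂Q)
      (mixError (fun i k => ∫ x, |x (i, k)| ∂Q) (fun i k => ∫ x, |x (i, k)| ^ 2 ∂Q)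
        fun i k => ∫ x, |x (i, k)| ^ 3 ∂Q) := by
  intro κ f H hf
  have h2 : ∀ p, MemLp (fun x : Fin n × Fin n → ℝ => x p) 2 Q := fun p =>
    (h3 p).mono_exponent (by norm_num)
  have hn' : (2 : ℝ) ≤ n := by exact_mod_cast hn
  have h1 : 0 < (n : ℝ) - 1 := by linarith
  have mmap := measurable_mixVec (n := n)
  have eF : ∫ y, ∑ i, y i * f i y ∂mixLaw Q
      = ∫ q, ∑ i, mixVec q.1 q.2 i * f i (mixVec q.1 q.2) ∂gaussProd Q :=
    integral_map mmap.aemeasurable (Measurable.aestronglyMeasurable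
      (Finset.measurable_fun_sum _ fun i _ =>
        (measurable_pi_apply i).mul (hf.continuous_field i).measurable))
  have eH : ∀ i j, ∫ y, H i j y ∂mixLaw Q = ∫ q, H i j (mixVec q.1 q.2) ∂gaussProd Q := fun i j =>
    integral_map mmap.aemeasurable (hf.continuous_jacobian i j).aestronglyMeasurable
  rw [eF, integral_gaussProd_field hn hf h2]
  simp only [eH]
  -- The mean of the conditional covariance is `permCov`: for `i ≠ j` the entries `x (i, l)` and `x
  -- (j, l)` are independent, so the mean of their product is the product of means.
  have eC : ∀ i j, permCov (fun i k => ∫ x, x (i, k) ∂Q) (fun i k => ∫ x, |x (i, k)| ^ 2 ∂Q) i j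
      = (if i = j then 1 / (n : ℝ) else -(1 / ((n : ℝ) * (n - 1)))) *
        ∑ l, ∫ x : Fin n × Fin n → ℝ, x (i, l) * x (j, l) ∂Q := fun i j => by
    unfold permCov
    by_cases h : i = j
    · subst h
      simp only [if_true, sq_abs]
      simp only [sq]
    · simp only [h, if_false]
      congr 1
      refine Finset.sum_congr rfl fun l _ => ?_
      exact (integral_coord_mul_coord hQ (a := (i, l)) (b := (j, l)) (by simp [h])
        (φ := fun t => t) (ψ := fun t => t) measurable_id measurable_id).symm
  set γ := 1 / √((n : ℝ) - 1) with hγ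
  have hγ0 : 0 ≤ γ := by positivity
  have B : ∀ i j, |(if i = j then 1 / (n : ℝ) else -(1 / ((n : ℝ) * (n - 1)))) *
        ∑ l, ∫ q, q.1 (i, l) * q.1 (j, l) * H i j (mixVec q.1 q.2) ∂gaussProd Q
      - permCov (fun i k => ∫ x, x (i, k) ∂Q) (fun i k => ∫ x, |x (i, k)| ^ 2 ∂Q) i j *
        ∫ q, H i j (mixVec q.1 q.2) ∂gaussProd Q| ≤
      κ * (γ * ((if i = j then 4 / (n : ℝ) * ∑ l, ∫ x, |x (i, l)| ^ 3 ∂Q else 0)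
        + 2 / ((n : ℝ) * (n - 1)) * ∑ l, ((∫ x, |x (i, l)| ^ 2 ∂Q) * ∫ x, |x (j, l)| ∂Q
          + (∫ x, |x (j, l)| ^ 2 ∂Q) * ∫ x, |x (i, l)| ∂Q))) := fun i j => by
    rw [eC, mul_assoc, ← mul_sub, Finset.sum_mul, ← Finset.sum_sub_distrib, abs_mul]
    have d : ∀ l, _ := fun l => abs_integral_gaussProd_decouple_le hf hQ h3 i j (i, l) (j, l)
      fun c => integrable_abs_mul_mul (h3 (i, l)) (h3 (j, l)) (h3 c)
    have m0 : ∀ l, 0 ≤ (∫ x, |x (i, l)| ^ 2 ∂Q) * ∫ x, |x (j, l)| ∂Q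
          + (∫ x, |x (j, l)| ^ 2 ∂Q) * ∫ x, |x (i, l)| ∂Q := fun l =>
      add_nonneg (mul_nonneg (integral_nonneg fun x => by positivity)
        (integral_nonneg fun x => by positivity)) (mul_nonneg
        (integral_nonneg fun x => by positivity) (integral_nonneg fun x => by positivity))
    by_cases h : i = j
    · subst h
      simp only [if_true]
      rw [abs_of_nonneg (by positivity)]
      have s := (Finset.abs_sum_le_sum_abs _ Finset.univ).trans (Finset.sum_le_sum fun l _ =>
        (d l).trans (mul_le_mul_of_nonneg_left (mul_le_mul_of_nonneg_left
          (mixed_moments_diag_le h3 (i, l)) hγ0) hf.nonneg))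
      refine (mul_le_mul_of_nonneg_left s (by positivity)).trans ?_
      rw [← Finset.mul_sum, ← Finset.mul_sum, ← Finset.mul_sum, mul_left_comm, mul_left_comm _ γ]
      refine mul_le_mul_of_nonneg_left (mul_le_mul_of_nonneg_left ?_ hγ0) hf.nonneg
      -- For `i = j` the off-diagonal term is added although it is not needed, so that the sum over
      -- all pairs has a uniform form.
      have : 0 ≤ 2 / ((n : ℝ) * (n - 1)) * ∑ l, ((∫ x, |x (i, l)| ^ 2 ∂Q) * ∫ x, |x (i, l)| ∂Q
          + (∫ x, |x (i, l)| ^ 2 ∂Q) * ∫ x, |x (i, l)| ∂Q) :=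
        mul_nonneg (by positivity) (Finset.sum_nonneg fun l _ => m0 l)
      refine le_trans (le_of_eq ?_) (le_add_of_nonneg_right this)
      ring
    · simp only [h, if_false, zero_add]
      rw [abs_neg, abs_of_nonneg (by positivity)]
      have s := (Finset.abs_sum_le_sum_abs _ Finset.univ).trans (Finset.sum_le_sum fun l _ =>
        (d l).trans (mul_le_mul_of_nonneg_left (mul_le_mul_of_nonneg_left
          (mixed_moments_offdiag_le hQ h2 (a := (i, l)) (b := (j, l)) (by simp [h])) hγ0)
          hf.nonneg))
      refine (mul_le_mul_of_nonneg_left s (by positivity)).trans (le_of_eq ?_)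
      simp only [← mul_add, ← Finset.mul_sum]
      ring
  rw [← Finset.sum_sub_distrib]
  simp only [← Finset.sum_sub_distrib]
  refine (Finset.abs_sum_le_sum_abs _ _).trans ((Finset.sum_le_sum fun i _ =>
    (Finset.abs_sum_le_sum_abs _ _).trans (Finset.sum_le_sum fun j _ => B i j)).trans (le_of_eq ?_))
  simp only [← Finset.mul_sum, mixError, Finset.sum_add_distrib, Finset.sum_ite_eq, Finset.mem_univ,
    if_true]
  rw [Finset.sum_comm (f := fun i j => ∑ l, (∫ x, |x (j, l)| ^ 2 ∂Q) * ∫ x, |x (i, l)| ∂Q)]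
  ring

end MixtureStein

/-! ### Comparison of the error terms -/

section ErrorBound

variable {n : ℕ} {m m₂ m₃ c : Fin n → Fin n → ℝ}

/-- `thirdOrderSum` in terms of the moments. -/
def momentSum (m m₂ m₃ c : Fin n → Fin n → ℝ) : ℝ :=
  ∑ i, ∑ j, ∑ k, ∑ l, ∑ u,
    (3 * m₃ i k + 5 * (m i k * m₂ i l) + 7 * (m₂ i k * m j l)
      + 5 * (m₂ i k * m j k) + 16 * (m i k * m i l * m j l) + 2 * (m i u * m i k * m i l)
      + 4 * (m i u * m i l * m j k) + 6 * (m u k * m i k * m j l) + 2 * (m u k * m i k * m j k)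
      + 1 / (n : ℝ) * (2 * m i k + 2 * m j l + 2 * m u k + 2 * m u l)
        * ∑ r, (m₂ i r + |c i r * c j r|))

/-- An index absent from a summand contributes a factor `n`. The summand `2 * (m i u * m i k * m i
l)` and the final one with the inner sum over `r` are nonnegative and are dropped. -/
theorem le_momentSum (hm : ∀ i k, 0 ≤ m i k) (hm₂ : ∀ i k, 0 ≤ m₂ i k) :
    3 * (n : ℝ) ^ 3 * (∑ i, ∑ k, m₃ i k) + 5 * (n : ℝ) ^ 2 * (∑ i, (∑ k, m₂ i k) * ∑ k, m i k)
      + 7 * (n : ℝ) * ((∑ i, ∑ k, m₂ i k) * ∑ i, ∑ k, m i k)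
      + 5 * (n : ℝ) ^ 2 * (∑ i, ∑ j, ∑ k, m₂ i k * m j k)
      + 16 * (n : ℝ) * (∑ i, ∑ j, (∑ k, m i k * m j k) * ∑ k, m i k)
      + 4 * ((∑ i, (∑ k, m i k) ^ 2) * ∑ i, ∑ k, m i k)
      + 6 * ((∑ i, ∑ j, ∑ k, m i k * m j k) * ∑ i, ∑ k, m i k)
      + 2 * (n : ℝ) * (∑ i, ∑ j, ∑ b, ∑ k, m i k * m j k * m b k) ≤ momentSum m m₂ m₃ c := by
  have h1 : ∑ i : Fin n, ∑ _j : Fin n, ∑ k, ∑ _l : Fin n, ∑ _u : Fin n, 3 * m₃ i k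
      = 3 * (n : ℝ) ^ 3 * ∑ i, ∑ k, m₃ i k := by
    simp only [Finset.sum_const, Finset.card_univ, Fintype.card_fin, nsmul_eq_mul, ← Finset.mul_sum]
    ring
  have h2 : ∑ i : Fin n, ∑ _j : Fin n, ∑ k, ∑ l : Fin n, ∑ _u : Fin n, 5 * (m i k * m₂ i l)
      = 5 * (n : ℝ) ^ 2 * ∑ i, (∑ k, m₂ i k) * ∑ k, m i k := by
    simp only [Finset.sum_const, Finset.card_univ, Fintype.card_fin, nsmul_eq_mul, ← Finset.mul_sum,
      ← Finset.sum_mul]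
    simp only [mul_comm (∑ k, m₂ _ k)]
    ring
  have h3 : ∑ i : Fin n, ∑ j : Fin n, ∑ k, ∑ l : Fin n, ∑ _u : Fin n, 7 * (m₂ i k * m j l)
      = 7 * (n : ℝ) * ((∑ i, ∑ k, m₂ i k) * ∑ i, ∑ k, m i k) := by
    simp only [Finset.sum_const, Finset.card_univ, Fintype.card_fin, nsmul_eq_mul, ← Finset.mul_sum,
      ← Finset.sum_mul]
    ring
  have h4 : ∑ i : Fin n, ∑ j : Fin n, ∑ k, ∑ _l : Fin n, ∑ _u : Fin n, 5 * (m₂ i k * m j k)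
      = 5 * (n : ℝ) ^ 2 * ∑ i, ∑ j, ∑ k, m₂ i k * m j k := by
    simp only [Finset.sum_const, Finset.card_univ, Fintype.card_fin, nsmul_eq_mul, ← Finset.mul_sum]
    ring
  have h5 : ∑ i : Fin n, ∑ j : Fin n, ∑ k, ∑ l : Fin n, ∑ _u : Fin n, 16 * (m i k * m i l * m j l)
      = 16 * (n : ℝ) * ∑ i, ∑ j, (∑ k, m i k * m j k) * ∑ k, m i k := by
    have e : ∀ i j, ∑ k, ∑ l : Fin n, ∑ _u : Fin n, 16 * (m i k * m i l * m j l)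
        = 16 * (n : ℝ) * ((∑ k, m i k * m j k) * ∑ k, m i k) := fun i j => by
      rw [Finset.sum_mul_sum, Finset.sum_comm, Finset.mul_sum]
      refine Finset.sum_congr rfl fun l _ => ?_
      rw [Finset.mul_sum]
      refine Finset.sum_congr rfl fun k _ => ?_
      rw [Finset.sum_const, Finset.card_univ, Fintype.card_fin, nsmul_eq_mul]
      ring
    rw [Finset.mul_sum]
    refine Finset.sum_congr rfl fun i _ => ?_
    rw [Finset.mul_sum]
    exact Finset.sum_congr rfl fun j _ => e i j
  have h6 : ∑ i : Fin n, ∑ j : Fin n, ∑ k, ∑ l : Fin n, ∑ u : Fin n, 4 * (m i u * m i l * m j k)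
      = 4 * ((∑ i, (∑ k, m i k) ^ 2) * ∑ i, ∑ k, m i k) := by
    simp only [← Finset.mul_sum, ← Finset.sum_mul, sq]
  have e7 : ∀ i, ∑ k, (∑ u, m u k) * m i k = ∑ b, ∑ k, m i k * m b k := fun i => by
    rw [Finset.sum_comm]
    refine Finset.sum_congr rfl fun k _ => ?_
    rw [Finset.sum_mul]
    exact Finset.sum_congr rfl fun u _ => mul_comm _ _
  have h7 : ∑ i : Fin n, ∑ j : Fin n, ∑ k, ∑ l : Fin n, ∑ u : Fin n, 6 * (m u k * m i k * m j l)
      = 6 * ((∑ i, ∑ j, ∑ k, m i k * m j k) * ∑ i, ∑ k, m i k) := by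
    simp only [← Finset.mul_sum, ← Finset.sum_mul, e7]
  have h8 : ∑ i : Fin n, ∑ j : Fin n, ∑ k, ∑ _l : Fin n, ∑ u : Fin n, 2 * (m u k * m i k * m j k)
      = 2 * (n : ℝ) * ∑ i, ∑ j, ∑ b, ∑ k, m i k * m j k * m b k := by
    have e : ∀ i j, ∑ k, ∑ _l : Fin n, ∑ u : Fin n, 2 * (m u k * m i k * m j k)
        = 2 * (n : ℝ) * ∑ b, ∑ k, m i k * m j k * m b k := fun i j => by
      rw [Finset.sum_comm (f := fun b k => m i k * m j k * m b k), Finset.mul_sum]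
      refine Finset.sum_congr rfl fun k _ => ?_
      rw [Finset.sum_const, Finset.card_univ, Fintype.card_fin, nsmul_eq_mul, Finset.mul_sum,
        Finset.mul_sum]
      exact Finset.sum_congr rfl fun u _ => by ring
    rw [Finset.mul_sum]
    refine Finset.sum_congr rfl fun i _ => ?_
    rw [Finset.mul_sum]
    exact Finset.sum_congr rfl fun j _ => e i j
  rw [← h1, ← h2, ← h3, ← h4, ← h5, ← h6, ← h7, ← h8]
  calc _ = ∑ i, ∑ j, ∑ k, ∑ l, ∑ u, (3 * m₃ i k + 5 * (m i k * m₂ i l) + 7 * (m₂ i k * m j l)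
      + 5 * (m₂ i k * m j k) + 16 * (m i k * m i l * m j l)
      + 4 * (m i u * m i l * m j k) + 6 * (m u k * m i k * m j l)
      + 2 * (m u k * m i k * m j k)) := by
        simp only [Finset.sum_add_distrib]
    _ ≤ _ := ?_
  refine Finset.sum_le_sum fun i _ => Finset.sum_le_sum fun j _ => Finset.sum_le_sum fun k _ =>
    Finset.sum_le_sum fun l _ => Finset.sum_le_sum fun u _ => ?_
  have a1 : 0 ≤ m i u * m i k * m i l := mul_nonneg (mul_nonneg (hm _ _) (hm _ _)) (hm _ _)
  have a2 : 0 ≤ 1 / (n : ℝ) * (2 * m i k + 2 * m j l + 2 * m u k + 2 * m u l)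
        * ∑ r, (m₂ i r + |c i r * c j r|) := by
    have := hm i k
    have := hm j l
    have := hm u k
    have := hm u l
    exact mul_nonneg (by positivity)
      (Finset.sum_nonneg fun r _ => add_nonneg (hm₂ i r) (abs_nonneg _))
  linarith

theorem sum_pairError : ∑ i, ∑ j, pairError m i j =
    (n : ℝ) / (n - 1) * (1 / (n : ℝ) ^ 2 * (2 * ∑ i, ∑ j, (∑ k, m i k * m j k) * ∑ k, m i k)
      + 1 / ((n : ℝ) ^ 2 * (n - 1)) * ((∑ i, ∑ j, ∑ k, m i k * m j k) * ∑ i, ∑ k, m i k)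
      + 1 / (n : ℝ) ^ 2 * ∑ i, ∑ j, ∑ b, ∑ k, m i k * m j k * m b k)
    + 1 / ((n : ℝ) - 1) * (9 / 2 / (n : ℝ) ^ 3 * (∑ i, ∑ k, m i k) ^ 3
      + 1 / ((n : ℝ) * (n - 1)) * ((∑ i, ∑ j, ∑ k, m i k * m j k) * ∑ i, ∑ k, m i k)) := by
  have e1 : ∑ i, ∑ j, (∑ k, m i k * m j k) * (∑ k, m i k + ∑ k, m j k)
      = 2 * ∑ i, ∑ j, (∑ k, m i k * m j k) * ∑ k, m i k := by
    simp only [mul_add, Finset.sum_add_distrib]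
    rw [Finset.sum_comm (f := fun i j => (∑ k, m i k * m j k) * ∑ k, m j k), two_mul]
    congr 1
    refine Finset.sum_congr rfl fun i _ => Finset.sum_congr rfl fun j _ => ?_
    simp only [mul_comm (m j _)]
  have e2 : ∑ i, ∑ j, ∑ b, (∑ k, m i k * m j k) * ∑ k, m b k
      = (∑ i, ∑ j, ∑ k, m i k * m j k) * ∑ i, ∑ k, m i k := by
    simp only [← Finset.mul_sum, ← Finset.sum_mul]
  have e3 : ∑ i, ∑ j, ∑ b, (∑ k, m i k) * ((∑ k, m j k) * ∑ k, m b k) = (∑ i, ∑ k, m i k) ^ 3 := by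
    simp only [← Finset.mul_sum, ← Finset.sum_mul]
    ring
  have e4 : ∑ i, ∑ j, ∑ b, (∑ k, m i k * m b k) * ∑ k, m j k
      = (∑ i, ∑ j, ∑ k, m i k * m j k) * ∑ i, ∑ k, m i k := by
    simp only [← Finset.mul_sum, ← Finset.sum_mul]
  calc _ = (n : ℝ) / (n - 1) * (1 / (n : ℝ) ^ 2 *
          (∑ i, ∑ j, (∑ k, m i k * m j k) * (∑ k, m i k + ∑ k, m j k))
        + 1 / ((n : ℝ) ^ 2 * (n - 1)) * (∑ i, ∑ j, ∑ b, (∑ k, m i k * m j k) * ∑ k, m b k)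
        + 1 / (n : ℝ) ^ 2 * ∑ i, ∑ j, ∑ b, ∑ k, m i k * m j k * m b k)
      + 1 / ((n : ℝ) - 1) * (9 / 2 / (n : ℝ) ^ 3 *
          (∑ i, ∑ j, ∑ b, (∑ k, m i k) * ((∑ k, m j k) * ∑ k, m b k))
        + 1 / ((n : ℝ) * (n - 1)) * ∑ i, ∑ j, ∑ b, (∑ k, m i k * m b k) * ∑ k, m j k) := by
        simp only [pairError, mul_add, Finset.sum_add_distrib, Finset.mul_sum]
    _ = _ := by rw [e1, e2, e3, e4]

theorem permError_eq : permError m m₂ m₃ = 1 / (n : ℝ) * (∑ i, ∑ k, m₃ i k)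
    + 1 / (n : ℝ) ^ 2 * (∑ i, (∑ k, m₂ i k) * ∑ k, m i k)
    + 2 / ((n : ℝ) ^ 2 * (n - 1)) * ((∑ i, ∑ k, m₂ i k) * ∑ i, ∑ k, m i k)
    + 2 / (n : ℝ) ^ 2 * (∑ i, ∑ j, ∑ k, m₂ i k * m j k)
    + 1 / (n : ℝ) * ∑ i, ∑ j, pairError m i j := by
  have e : ∑ i, ∑ j, ∑ k, m i k * m₂ j k = ∑ i, ∑ j, ∑ k, m₂ i k * m j k := by
    rw [Finset.sum_comm]
    simp only [mul_comm (m _ _)]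
  simp only [permError, Finset.sum_add_distrib, ← Finset.mul_sum, ← Finset.sum_mul, e]
  ring

/-- The left side is `√(n - 1)`, and the geometric mean of `n - 1` and `1` is at most `n / 2`. -/
theorem inv_sqrt_mul_le (hn : 2 ≤ n) : 1 / √((n : ℝ) - 1) * ((n : ℝ) - 1) ≤ n / 2 := by
  have hn' : (2 : ℝ) ≤ n := by exact_mod_cast hn
  have h1 : 0 < (n : ℝ) - 1 := by linarith
  have h2 : 0 < √((n : ℝ) - 1) := Real.sqrt_pos.2 h1
  have h3 := Real.sq_sqrt h1.le
  have : 1 / √((n : ℝ) - 1) * ((n : ℝ) - 1) = √((n : ℝ) - 1) := by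
    field_simp
    linarith
  rw [this]
  nlinarith [sq_nonneg (√((n : ℝ) - 1) - 1)]

/-- The factor `2 / 3` is `κ / 3` without `‖g‖ / s³`. Both errors are combinations of eight
nonnegative sums, each of which is matched with the corresponding sum in `le_momentSum`. -/
theorem permError_add_mixError_le (hn : 2 ≤ n) (hm : ∀ i k, 0 ≤ m i k) (hm₂ : ∀ i k, 0 ≤ m₂ i k)
    (hm₃ : ∀ i k, 0 ≤ m₃ i k) :
    2 / 3 * (permError m m₂ m₃ + mixError m m₂ m₃) ≤
      momentSum m m₂ m₃ c / ((n : ℝ) ^ 3 * (n - 1)) := by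
  have hn' : (2 : ℝ) ≤ n := by exact_mod_cast hn
  have h1 : 0 < (n : ℝ) - 1 := by linarith
  have hM := le_momentSum (m₃ := m₃) (c := c) hm hm₂
  rw [permError_eq, sum_pairError, mixError, le_div_iff₀ (by positivity)]
  refine le_trans ?_ hM
  have hγ := inv_sqrt_mul_le hn
  have hγ1 : 1 / √((n : ℝ) - 1) ≤ 1 := by
    rw [div_le_one (Real.sqrt_pos.2 h1)]
    exact Real.one_le_sqrt.2 (by linarith)
  set γ := 1 / √((n : ℝ) - 1)
  have hγ0 : 0 ≤ γ := by positivity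
  have hs : ∀ i, 0 ≤ ∑ k, m i k := fun i => Finset.sum_nonneg fun k _ => hm i k
  have hs₂ : ∀ i, 0 ≤ ∑ k, m₂ i k := fun i => Finset.sum_nonneg fun k _ => hm₂ i k
  have hq : ∀ i j, 0 ≤ ∑ k, m i k * m j k := fun i j =>
    Finset.sum_nonneg fun k _ => mul_nonneg (hm i k) (hm j k)
  have hM0 : 0 ≤ ∑ i, ∑ k, m i k := Finset.sum_nonneg fun i _ => hs i
  have hC : (∑ i, ∑ k, m i k) ^ 2 ≤ n * ∑ i, (∑ k, m i k) ^ 2 := by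
    simpa using sq_sum_le_card_mul_sum_sq (s := Finset.univ) (f := fun i => ∑ k, m i k)
  -- The cube of the total sum, which comes from three distinct positions, has no counterpart in the
  -- moment sum. By Cauchy–Schwarz over the rows it is absorbed by the squared row sums.
  have hC3 : (∑ i, ∑ k, m i k) ^ 3 ≤ n * ((∑ i, (∑ k, m i k) ^ 2) * ∑ i, ∑ k, m i k) := by
    nlinarith [mul_le_mul_of_nonneg_right hC hM0]
  have p3 : 0 ≤ ∑ i, ∑ k, m₃ i k :=
    Finset.sum_nonneg fun i _ => Finset.sum_nonneg fun k _ => hm₃ i k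
  have pa : 0 ≤ ∑ i, (∑ k, m₂ i k) * ∑ k, m i k :=
    Finset.sum_nonneg fun i _ => mul_nonneg (hs₂ i) (hs i)
  have pb : 0 ≤ (∑ i, ∑ k, m₂ i k) * ∑ i, ∑ k, m i k :=
    mul_nonneg (Finset.sum_nonneg fun i _ => hs₂ i) hM0
  have pc : 0 ≤ ∑ i, ∑ j, ∑ k, m₂ i k * m j k := Finset.sum_nonneg fun i _ =>
    Finset.sum_nonneg fun j _ => Finset.sum_nonneg fun k _ => mul_nonneg (hm₂ i k) (hm j k)
  have pd : 0 ≤ ∑ i, ∑ j, (∑ k, m i k * m j k) * ∑ k, m i k := Finset.sum_nonneg fun i _ =>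
    Finset.sum_nonneg fun j _ => mul_nonneg (hq i j) (hs i)
  have pe : 0 ≤ (∑ i, (∑ k, m i k) ^ 2) * ∑ i, ∑ k, m i k :=
    mul_nonneg (Finset.sum_nonneg fun i _ => sq_nonneg _) hM0
  have pf : 0 ≤ (∑ i, ∑ j, ∑ k, m i k * m j k) * ∑ i, ∑ k, m i k :=
    mul_nonneg (Finset.sum_nonneg fun i _ => Finset.sum_nonneg fun j _ => hq i j) hM0
  have pg : 0 ≤ ∑ i, ∑ j, ∑ b, ∑ k, m i k * m j k * m b k := Finset.sum_nonneg fun i _ =>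
    Finset.sum_nonneg fun j _ => Finset.sum_nonneg fun b _ => Finset.sum_nonneg fun k _ =>
      mul_nonneg (mul_nonneg (hm _ _) (hm _ _)) (hm _ _)
  -- From here on the sums are independent nonnegative quantities and only their coefficients,
  -- functions of `n`, are compared. The total sum comes last, as it occurs inside the products.
  generalize (∑ i, ∑ k, m₃ i k) = S₃ at *
  generalize (∑ i, (∑ k, m₂ i k) * ∑ k, m i k) = Sa at *
  generalize (∑ i, ∑ k, m₂ i k) * (∑ i, ∑ k, m i k) = Sb at *
  generalize (∑ i, ∑ j, ∑ k, m₂ i k * m j k) = Sc at *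
  generalize (∑ i, ∑ j, (∑ k, m i k * m j k) * ∑ k, m i k) = Sd at *
  generalize (∑ i, (∑ k, m i k) ^ 2) * (∑ i, ∑ k, m i k) = Se at *
  generalize (∑ i, ∑ j, ∑ k, m i k * m j k) * (∑ i, ∑ k, m i k) = Sf at *
  generalize (∑ i, ∑ j, ∑ b, ∑ k, m i k * m j k * m b k) = Sg at *
  generalize (∑ i, ∑ k, m i k) = M at *
  have q3 : 2 / 3 * (1 / (n : ℝ) * S₃ + γ * (4 / n * S₃)) * ((n : ℝ) ^ 3 * (n - 1)) ≤
      3 * (n : ℝ) ^ 3 * S₃ := by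
    have e : 2 / 3 * (1 / (n : ℝ) * S₃ + γ * (4 / n * S₃)) * ((n : ℝ) ^ 3 * (n - 1))
        = (2 / 3 * ((n : ℝ) ^ 2 * (n - 1)) + 8 / 3 * ((n : ℝ) ^ 2 * (γ * (n - 1)))) * S₃ := by
      field_simp
      ring
    rw [e]
    refine mul_le_mul_of_nonneg_right ?_ p3
    have := mul_le_mul_of_nonneg_left hγ (sq_nonneg (n : ℝ))
    nlinarith [pow_pos (by linarith : (0 : ℝ) < n) 3, pow_pos (by linarith : (0 : ℝ) < n) 2]
  have qa : 2 / 3 * (1 / (n : ℝ) ^ 2 * Sa) * ((n : ℝ) ^ 3 * (n - 1)) ≤ 5 * (n : ℝ) ^ 2 * Sa := by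
    have e : 2 / 3 * (1 / (n : ℝ) ^ 2 * Sa) * ((n : ℝ) ^ 3 * (n - 1))
        = (2 / 3 * (n * (n - 1))) * Sa := by field_simp
    rw [e]
    exact mul_le_mul_of_nonneg_right (by nlinarith) pa
  have qb : 2 / 3 * (2 / ((n : ℝ) ^ 2 * (n - 1)) * Sb) * ((n : ℝ) ^ 3 * (n - 1)) ≤
      7 * (n : ℝ) * Sb := by
    have e : 2 / 3 * (2 / ((n : ℝ) ^ 2 * (n - 1)) * Sb) * ((n : ℝ) ^ 3 * (n - 1))
        = (4 / 3 * n) * Sb := by field_simp; ring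
    rw [e]
    exact mul_le_mul_of_nonneg_right (by linarith) pb
  have qc : 2 / 3 * (2 / (n : ℝ) ^ 2 * Sc + γ * (4 / ((n : ℝ) * (n - 1)) * Sc)) *
      ((n : ℝ) ^ 3 * (n - 1)) ≤ 5 * (n : ℝ) ^ 2 * Sc := by
    have e : 2 / 3 * (2 / (n : ℝ) ^ 2 * Sc + γ * (4 / ((n : ℝ) * (n - 1)) * Sc)) *
        ((n : ℝ) ^ 3 * (n - 1)) = (4 / 3 * (n * (n - 1)) + 8 / 3 * (γ * (n : ℝ) ^ 2)) * Sc := by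
      field_simp
      ring
    rw [e]
    refine mul_le_mul_of_nonneg_right ?_ pc
    have := mul_le_mul_of_nonneg_right hγ1 (sq_nonneg (n : ℝ))
    nlinarith
  have qd : 2 / 3 * (1 / (n : ℝ) * ((n : ℝ) / (n - 1) * (2 / (n : ℝ) ^ 2 * Sd))) *
      ((n : ℝ) ^ 3 * (n - 1)) ≤ 16 * (n : ℝ) * Sd := by
    have e : 2 / 3 * (1 / (n : ℝ) * ((n : ℝ) / (n - 1) * (2 / (n : ℝ) ^ 2 * Sd))) *
        ((n : ℝ) ^ 3 * (n - 1)) = (4 / 3 * n) * Sd := by field_simp; ring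
    rw [e]
    exact mul_le_mul_of_nonneg_right (by linarith) pd
  have qe : 2 / 3 * (1 / (n : ℝ) * (1 / ((n : ℝ) - 1) * (9 / 2 / (n : ℝ) ^ 3 * M ^ 3))) *
      ((n : ℝ) ^ 3 * (n - 1)) ≤ 4 * Se := by
    have e : 2 / 3 * (1 / (n : ℝ) * (1 / ((n : ℝ) - 1) * (9 / 2 / (n : ℝ) ^ 3 * M ^ 3))) *
        ((n : ℝ) ^ 3 * (n - 1)) = 3 * (M ^ 3 / n) := by field_simp; ring
    have : M ^ 3 / n ≤ Se := by
      rw [div_le_iff₀ (by linarith)]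
      linarith
    rw [e]
    linarith
  have qf : 2 / 3 * (1 / (n : ℝ) * ((n : ℝ) / (n - 1) * (1 / ((n : ℝ) ^ 2 * (n - 1)) * Sf)
      + 1 / ((n : ℝ) - 1) * (1 / ((n : ℝ) * (n - 1)) * Sf))) *
        ((n : ℝ) ^ 3 * (n - 1)) ≤ 6 * Sf := by
    have e : 2 / 3 * (1 / (n : ℝ) * ((n : ℝ) / (n - 1) * (1 / ((n : ℝ) ^ 2 * (n - 1)) * Sf)
        + 1 / ((n : ℝ) - 1) * (1 / ((n : ℝ) * (n - 1)) * Sf))) * ((n : ℝ) ^ 3 * (n - 1))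
        = (4 / 3 * (n / (n - 1))) * Sf := by field_simp; ring
    have : (n : ℝ) / (n - 1) ≤ 2 := by
      rw [div_le_iff₀ h1]
      linarith
    rw [e]
    exact mul_le_mul_of_nonneg_right (by linarith) pf
  have qg : 2 / 3 * (1 / (n : ℝ) * ((n : ℝ) / (n - 1) * (1 / (n : ℝ) ^ 2 * Sg))) *
      ((n : ℝ) ^ 3 * (n - 1)) ≤ 2 * (n : ℝ) * Sg := by
    have e : 2 / 3 * (1 / (n : ℝ) * ((n : ℝ) / (n - 1) * (1 / (n : ℝ) ^ 2 * Sg))) *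
        ((n : ℝ) ^ 3 * (n - 1)) = (2 / 3 * n) * Sg := by field_simp
    rw [e]
    exact mul_le_mul_of_nonneg_right (by linarith) pg
  calc _ = _ := by ring
    _ ≤ _ := add_le_add (add_le_add (add_le_add (add_le_add (add_le_add (add_le_add
      (add_le_add q3 qa) qb) qc) qd) qe) qf) qg

end ErrorBound

/-! ### Test functions along linear combinations of paths -/

section TestFunction

variable {g : CadlagSpace → ℝ}

theorem normM1_nonneg (g : CadlagSpace → ℝ) : 0 ≤ normM1 g := ENNReal.toReal_nonneg

theorem MemM1.ofReal_normM1 (hg : MemM1 g) : ENNReal.ofReal (normM1 g) = eNormM1 g :=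
  ENNReal.ofReal_toReal hg.2.ne

theorem MemM1.norm_fderiv_le (hg : MemM1 g) (w : CadlagSpace) : ‖fderiv ℝ g w‖ ≤ normM1 g := by
  have h : ‖fderiv ℝ g w‖ₑ ≤ ENNReal.ofReal (normM1 g) := by
    rw [hg.ofReal_normM1]
    refine (le_iSup (fun w => ‖fderiv ℝ g w‖ₑ) w).trans ?_
    exact le_add_left le_rfl |>.trans (le_add_right le_rfl) |>.trans (le_add_right le_rfl)
  rwa [← ofReal_norm, ENNReal.ofReal_le_ofReal_iff (normM1_nonneg g)] at h

theorem abs_apply_le_of_diagNorm_le {B : CadlagSpace →L[ℝ] CadlagSpace →L[ℝ] ℝ} {b : ℝ}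
    (hb : 0 ≤ b) (hB : diagNorm B ≤ ENNReal.ofReal b) (h : CadlagSpace) :
    |B h h| ≤ b * ‖h‖ ^ 2 := by
  rcases eq_or_ne h 0 with rfl | hh
  · rw [(B 0).map_zero, abs_zero]
    positivity
  have h0 : 0 < ‖h‖ := norm_pos_iff.2 hh
  have h1 : ‖‖h‖⁻¹ • h‖ = 1 := norm_smul_inv_norm hh
  have h2 : ‖B (‖h‖⁻¹ • h) (‖h‖⁻¹ • h)‖ₑ ≤ ENNReal.ofReal b :=
    (le_iSup₂ (f := fun (h : CadlagSpace) (_ : ‖h‖ = 1) => ‖B h h‖ₑ) _ h1).trans hB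
  rw [← ofReal_norm, ENNReal.ofReal_le_ofReal_iff hb, Real.norm_eq_abs] at h2
  simp only [map_smul, smul_apply, smul_eq_mul, abs_mul, abs_inv, abs_norm] at h2
  rw [← mul_assoc, ← mul_inv, ← sq, inv_mul_le_iff₀ (by positivity)] at h2
  linarith

/-- The norm in `M¹` controls a form only on the diagonal. Polarization recovers its off-diagonal
values, at the cost of the factor 2. -/
theorem abs_apply_le_of_symmetric {B : CadlagSpace →L[ℝ] CadlagSpace →L[ℝ] ℝ} {b r : ℝ}
    (hb : 0 ≤ b) (hB : diagNorm B ≤ ENNReal.ofReal b) (hs : ∀ h k, B h k = B k h)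
    {h k : CadlagSpace} (hh : ‖h‖ ≤ r) (hk : ‖k‖ ≤ r) : |B h k| ≤ 2 * b * r ^ 2 := by
  have e : 4 * B h k = B (h + k) (h + k) - B (h - k) (h - k) := by
    simp only [map_add, map_sub, add_apply, sub_apply]
    rw [hs k h]
    ring
  have e1 := abs_apply_le_of_diagNorm_le hb hB (h + k)
  have e2 := abs_apply_le_of_diagNorm_le hb hB (h - k)
  have n1 : ‖h + k‖ ^ 2 ≤ (2 * r) ^ 2 :=
    pow_le_pow_left₀ (norm_nonneg _) ((norm_add_le h k).trans (by linarith)) 2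
  have n2 : ‖h - k‖ ^ 2 ≤ (2 * r) ^ 2 :=
    pow_le_pow_left₀ (norm_nonneg _) ((norm_sub_le h k).trans (by linarith)) 2
  have m1 := mul_le_mul_of_nonneg_left n1 hb
  have m2 := mul_le_mul_of_nonneg_left n2 hb
  rw [abs_le] at *
  constructor <;> linarith

theorem MemM1.diagNorm_le (hg : MemM1 g) (w : CadlagSpace) :
    diagNorm (secondDeriv g w) ≤ ENNReal.ofReal (normM1 g) := by
  rw [hg.ofReal_normM1]
  refine (le_iSup (fun w => diagNorm (secondDeriv g w)) w).trans ?_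
  exact le_add_left le_rfl |>.trans (le_add_right le_rfl)

theorem MemM1.diagNorm_sub_le (hg : MemM1 g) (w h : CadlagSpace) :
    diagNorm (secondDeriv g (w + h) - secondDeriv g w) ≤ ENNReal.ofReal (normM1 g * ‖h‖) := by
  rcases eq_or_ne h 0 with rfl | hh
  · simp [diagNorm]
  have h0 : ‖h‖ₑ ≠ 0 := enorm_ne_zero.2 hh
  have : diagNorm (secondDeriv g (w + h) - secondDeriv g w) / ‖h‖ₑ ≤ eNormM1 g := by
    refine le_trans ?_ (le_add_left le_rfl)
    exact (le_iSup (fun _ : h ≠ 0 => diagNorm (secondDeriv g (w + h) - secondDeriv g w) / ‖h‖ₑ) hh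
      ).trans ((le_iSup (fun h => ⨆ _ : h ≠ 0,
        diagNorm (secondDeriv g (w + h) - secondDeriv g w) / ‖h‖ₑ) h).trans
      (le_iSup (fun w => ⨆ h, ⨆ _ : h ≠ 0,
        diagNorm (secondDeriv g (w + h) - secondDeriv g w) / ‖h‖ₑ) w))
  rw [ENNReal.div_le_iff h0 (by simp), ← hg.ofReal_normM1, ← ofReal_norm,
    ← ENNReal.ofReal_mul (normM1_nonneg g)] at this
  exact this

theorem MemM1.secondDeriv_comm (hg : MemM1 g) (w h k : CadlagSpace) :
    secondDeriv g w h k = secondDeriv g w k h :=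
  second_derivative_symmetric (fun y => (hg.1.differentiable y).hasFDerivAt)
    (hg.1.differentiable_fderiv w).hasFDerivAt h k

theorem MemM1.abs_sub_zero_le (hg : MemM1 g) (w : CadlagSpace) :
    |g w - g 0| ≤ normM1 g * ‖w‖ := by
  have := convex_univ.norm_image_sub_le_of_norm_fderiv_le (f := g) (𝕜 := ℝ) (C := normM1 g)
    (fun x _ => hg.1.differentiable x) (fun x _ => hg.norm_fderiv_le x) (Set.mem_univ 0)
    (Set.mem_univ w)
  simpa using this

variable {n : ℕ}

/-- The linear map `a ↦ ∑ i, a i • v i`. -/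
def combine (v : Fin n → CadlagSpace) : (Fin n → ℝ) →L[ℝ] CadlagSpace :=
  ∑ i, (ContinuousLinearMap.proj (R := ℝ) (φ := fun _ : Fin n => ℝ) i).smulRight (v i)

theorem combine_apply (v : Fin n → CadlagSpace) (a : Fin n → ℝ) :
    combine v a = ∑ i, a i • v i := by
  simp [combine]

theorem norm_combine_le {v : Fin n → CadlagSpace} {r : ℝ} (hv : ∀ i, ‖v i‖ ≤ r) (a : Fin n → ℝ) :
    ‖combine v a‖ ≤ r * ∑ i, |a i| := by
  rw [combine_apply, Finset.mul_sum]
  refine norm_sum_le_of_le _ fun i _ => ?_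
  rw [norm_smul, Real.norm_eq_abs, mul_comm]
  exact mul_le_mul_of_nonneg_right (hv i) (abs_nonneg _)

theorem MemM1.hasFDerivAt_combine (hg : MemM1 g) (v : Fin n → CadlagSpace) (a : Fin n → ℝ) :
    HasFDerivAt (fun a => g (combine v a)) (∑ i, fderiv ℝ g (combine v a) (v i) •
      ContinuousLinearMap.proj (R := ℝ) (φ := fun _ : Fin n => ℝ) i) a := by
  refine (((hg.1.differentiable (combine v a)).hasFDerivAt).comp a
    (combine v).hasFDerivAt).congr_fderiv ?_
  ext h
  simp [combine_apply, mul_comm]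

theorem MemM1.hasFDerivAt_fderiv_combine (hg : MemM1 g) (v : Fin n → CadlagSpace) (w : CadlagSpace)
    (a : Fin n → ℝ) : HasFDerivAt (fun a => fderiv ℝ g (combine v a) w)
      (∑ j, secondDeriv g (combine v a) (v j) w •
        ContinuousLinearMap.proj (R := ℝ) (φ := fun _ : Fin n => ℝ) j) a := by
  have h : HasFDerivAt (fun a => fderiv ℝ g (combine v a))
      ((secondDeriv g (combine v a)).comp (combine v)) a :=
    HasFDerivAt.comp (g := fderiv ℝ g) a (hg.1.differentiable_fderiv (combine v a)).hasFDerivAt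
      (combine v).hasFDerivAt
  refine (h.clm_apply (hasFDerivAt_const w a)).congr_fderiv ?_
  ext h
  simp [combine_apply, mul_comm]

theorem MemM1.abs_secondDeriv_le (hg : MemM1 g) {h k : CadlagSpace} {r : ℝ} (hh : ‖h‖ ≤ r)
    (hk : ‖k‖ ≤ r) (w : CadlagSpace) : |secondDeriv g w h k| ≤ 2 * normM1 g * r ^ 2 :=
  abs_apply_le_of_symmetric (normM1_nonneg g) (hg.diagNorm_le _) (hg.secondDeriv_comm _) hh hk

theorem MemM1.abs_secondDeriv_sub_le (hg : MemM1 g) {h k : CadlagSpace} {r : ℝ} (hh : ‖h‖ ≤ r)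
    (hk : ‖k‖ ≤ r) (w d : CadlagSpace) :
    |secondDeriv g (w + d) h k - secondDeriv g w h k| ≤ 2 * (normM1 g * ‖d‖) * r ^ 2 :=
  abs_apply_le_of_symmetric (B := secondDeriv g (w + d) - secondDeriv g w)
    (mul_nonneg (normM1_nonneg g) (norm_nonneg d)) (hg.diagNorm_sub_le w d) (fun h k => by
      simp only [sub_apply, hg.secondDeriv_comm _ h k]) hh hk

/-- The field is the gradient of `a ↦ g (combine v a)`. In the Lipschitz constant, `r²` comes from
the two directions `v i`, `v j` and one more `r` from the displacement of the path. -/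
theorem MemM1.isSmoothField (hg : MemM1 g) {v : Fin n → CadlagSpace} {r : ℝ} (hr : 0 ≤ r)
    (hv : ∀ i, ‖v i‖ ≤ r) :
    IsSmoothField (2 * normM1 g * r ^ 3) (fun i a => fderiv ℝ g (combine v a) (v i))
      (fun i j a => secondDeriv g (combine v a) (v j) (v i)) where
  nonneg := mul_nonneg (mul_nonneg zero_le_two (normM1_nonneg g)) (pow_nonneg hr 3)
  hasFDerivAt i a := hg.hasFDerivAt_fderiv_combine v (v i) a
  bounded := ⟨2 * normM1 g * r ^ 2,
    mul_nonneg (mul_nonneg zero_le_two (normM1_nonneg g)) (sq_nonneg r),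
    fun i j _ => hg.abs_secondDeriv_le (hv j) (hv i) _⟩
  lipschitz i j x y := by
    have h1 := hg.abs_secondDeriv_sub_le (hv j) (hv i) (combine v y) (combine v (x - y))
    rw [← map_add, add_sub_cancel] at h1
    refine h1.trans ?_
    have h2 := mul_le_mul_of_nonneg_left (norm_combine_le hv (x - y))
      (mul_nonneg (mul_nonneg zero_le_two (normM1_nonneg g)) (sq_nonneg r))
    simp only [Pi.sub_apply] at h2
    linarith

theorem norm_jump_le (a : ℝ) : ‖jump a‖ ≤ 1 := by
  rw [CadlagSpace.norm_eq_iSup]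
  refine ciSup_le fun t => ?_
  change |if a ≤ (t : ℝ) then (1 : ℝ) else 0| ≤ 1
  split_ifs <;> simp

/-- The path with a jump of height `1 / s` at `(i + 1) / n`. -/
def scaledJump (s : ℝ) (i : Fin n) : CadlagSpace := (1 / s) • jump (((i : ℕ) + 1 : ℝ) / n)

theorem norm_scaledJump_le {s : ℝ} (hs : 0 < s) (i : Fin n) : ‖scaledJump s i‖ ≤ 1 / s := by
  rw [scaledJump, norm_smul, Real.norm_of_nonneg (by positivity)]
  exact mul_le_of_le_one_right (by positivity) (norm_jump_le _)

theorem combine_scaledJump (s : ℝ) (a : Fin n → ℝ) :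
    combine (scaledJump s) a = (1 / s) • stepPath a := by
  rw [combine_apply, stepPath, Finset.smul_sum]
  exact Finset.sum_congr rfl fun i _ => smul_comm _ _ _

theorem MemM1.abs_combine_le (hg : MemM1 g) {v : Fin n → CadlagSpace} {r : ℝ}
    (hv : ∀ i, ‖v i‖ ≤ r) (a : Fin n → ℝ) :
    |g (combine v a)| ≤ |g 0| + normM1 g * r * ∑ i, |a i| := by
  have h1 := hg.abs_sub_zero_le (combine v a)
  have h2 := mul_le_mul_of_nonneg_left (norm_combine_le hv a) (normM1_nonneg g)
  have h3 := abs_add_le (g (combine v a) - g 0) (g 0)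
  rw [sub_add_cancel] at h3
  linarith

theorem MemM1.abs_fderiv_le (hg : MemM1 g) {v : Fin n → CadlagSpace} {r : ℝ}
    (hv : ∀ i, ‖v i‖ ≤ r) (i : Fin n) (w : CadlagSpace) :
    |fderiv ℝ g w (v i)| ≤ normM1 g * r :=
  ((fderiv ℝ g w).le_opNorm (v i)).trans
    (mul_le_mul (hg.norm_fderiv_le w) (hv i) (norm_nonneg _) (normM1_nonneg g))

end TestFunction

/-! ### Reduction to the laws of the arrays -/

section Reduction

variable {n : ℕ} {Ω : Type*} [MeasurableSpace Ω] {P : Measure Ω} [IsProbabilityMeasure P]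
  {X X'' Z : Fin n → Fin n → Ω → ℝ} {π : Ω → Equiv.Perm (Fin n)}

/-- The law of an array, indexed by pairs. -/
def arrayLaw (P : Measure Ω) (X : Fin n → Fin n → Ω → ℝ) : Measure (Fin n × Fin n → ℝ) :=
  P.map fun ω p => X p.1 p.2 ω

theorem measurable_uncurry_array :
    Measurable fun (x : Fin n → Fin n → ℝ) (p : Fin n × Fin n) => x p.1 p.2 :=
  measurable_pi_lambda _ fun p => (measurable_pi_apply p.2).comp (measurable_pi_apply p.1)

namespace CombinatorialModel

omit [IsProbabilityMeasure P] in
theorem measurable_pair (h : CombinatorialModel P X π X'' Z) :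
    Measurable fun ω (p : Fin n × Fin n) => X p.1 p.2 ω :=
  measurable_pi_lambda _ fun p => h.measurable_X p.1 p.2

theorem isProbabilityMeasure_arrayLaw (h : CombinatorialModel P X π X'' Z) :
    IsProbabilityMeasure (arrayLaw P X) :=
  Measure.isProbabilityMeasure_map h.measurable_pair.aemeasurable

omit [IsProbabilityMeasure P] in
theorem integral_arrayLaw (h : CombinatorialModel P X π X'' Z) {φ : ℝ → ℝ} (hφ : Measurable φ)
    (p : Fin n × Fin n) : ∫ x, φ (x p) ∂(arrayLaw P X) = ∫ ω, φ (X p.1 p.2 ω) ∂P :=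
  integral_map h.measurable_pair.aemeasurable
    (hφ.comp (measurable_pi_apply p)).aestronglyMeasurable

omit [IsProbabilityMeasure P] in
theorem memLp_arrayLaw (h : CombinatorialModel P X π X'' Z) (p : Fin n × Fin n) :
    MemLp (fun x => x p) 3 (arrayLaw P X) :=
  (memLp_map_measure_iff (measurable_pi_apply p).aestronglyMeasurable
    h.measurable_pair.aemeasurable).2 (h.third_moment p.1 p.2)

theorem iIndepFun_arrayLaw (h : CombinatorialModel P X π X'' Z) :
    iIndepFun (fun (p : Fin n × Fin n) (x : Fin n × Fin n → ℝ) => x p) (arrayLaw P X) := by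
  have := h.isProbabilityMeasure_arrayLaw
  have h1 := (iIndepFun_iff_map_fun_eq_pi_map
    (fun p : Fin n × Fin n => (h.measurable_X p.1 p.2).aemeasurable)).1 h.indep_X
  rw [iIndepFun_iff_map_fun_eq_pi_map fun p => (measurable_pi_apply p).aemeasurable]
  change (arrayLaw P X).map id = _
  rw [Measure.map_id, arrayLaw, h1]
  congr 1
  funext p
  rw [← h1, Measure.map_map (measurable_pi_apply p) h.measurable_pair]
  rfl

omit [IsProbabilityMeasure P] in
theorem measurable_perm_vec (h : CombinatorialModel P X π X'' Z) :
    Measurable fun ω i => X i (π ω i) ω := by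
  refine measurable_pi_lambda _ fun i => ?_
  have : Measurable fun q : Ω × Equiv.Perm (Fin n) => X i (q.2 i) q.1 :=
    measurable_from_prod_countable_left fun τ => h.measurable_X i (τ i)
  exact this.comp (measurable_id.prodMk h.measurable_perm)

omit [IsProbabilityMeasure P] in
-- Split the event according to the value of `π`. By independence each piece has probability `1 /
-- n!` times that of the array event.
theorem map_perm_eq (h : CombinatorialModel P X π X'' Z) :
    P.map (fun ω i => X i (π ω i) ω) = permLaw (arrayLaw P X) := by
  have hT := h.measurable_pair
  have hE : ∀ {s : Set (Fin n → ℝ)}, (fun ω i => X i (π ω i) ω) ⁻¹' s =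
      ⋃ τ, (fun ω (p : Fin n × Fin n) => X p.1 p.2 ω) ⁻¹' (permVec τ ⁻¹' s) ∩ π ⁻¹' {τ} := by
    intro s
    ext ω
    simp only [Set.mem_preimage, Set.mem_iUnion, Set.mem_inter_iff, Set.mem_singleton_iff,
      exists_eq_right']
    rfl
  have hI : IndepFun (fun ω (p : Fin n × Fin n) => X p.1 p.2 ω) π P :=
    h.indep_X_perm.comp measurable_uncurry_array measurable_id
  have hm : ∀ (τ : Equiv.Perm (Fin n)) {s : Set (Fin n → ℝ)}, MeasurableSet s →
      MeasurableSet ((fun ω (p : Fin n × Fin n) => X p.1 p.2 ω) ⁻¹' (permVec τ ⁻¹' s)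
        ∩ π ⁻¹' {τ}) := fun τ s hs =>
    (hT (measurable_permVec τ hs)).inter (h.measurable_perm trivial)
  ext s hs
  rw [Measure.map_apply h.measurable_perm_vec hs, hE,
    measure_iUnion (fun τ σ hτσ => ?_) fun τ => hm τ hs,
    tsum_fintype, permLaw, Measure.finsetSum_apply]
  · refine Finset.sum_congr rfl fun τ _ => ?_
    rw [hI.measure_inter_preimage_eq_mul _ _ (measurable_permVec τ hs) trivial, h.uniform_perm,
      Measure.smul_apply, Measure.map_apply (measurable_permVec τ) hs, arrayLaw,
      Measure.map_apply hT (measurable_permVec τ hs), smul_eq_mul, mul_comm]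
  · refine Disjoint.mono Set.inter_subset_right Set.inter_subset_right ?_
    exact Disjoint.preimage _ (Set.disjoint_singleton.2 hτσ)

omit [IsProbabilityMeasure P] in
theorem measurable_zHat (h : CombinatorialModel P X π X'' Z) :
    Measurable fun ω i => zHat X'' Z i ω := by
  refine measurable_pi_lambda _ fun i => Measurable.const_mul (Finset.measurable_sum _ fun l _ =>
    (h.measurable_copy i l).mul ((h.measurable_Z i l).sub
      (Measurable.const_mul (Finset.measurable_sum _ fun j _ => h.measurable_Z j l) _))) _

theorem map_zHat_eq (h : CombinatorialModel P X π X'' Z) :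
    P.map (fun ω i => zHat X'' Z i ω) = mixLaw (arrayLaw P X) := by
  have hT : Measurable fun ω (p : Fin n × Fin n) => X'' p.1 p.2 ω :=
    measurable_pi_lambda _ fun p => h.measurable_copy p.1 p.2
  have hZ : Measurable fun ω (p : Fin n × Fin n) => Z p.1 p.2 ω :=
    measurable_pi_lambda _ fun p => h.measurable_Z p.1 p.2
  have h1 : P.map (fun ω (p : Fin n × Fin n) => X'' p.1 p.2 ω) = arrayLaw P X := by
    have := congrArg (Measure.map fun (x : Fin n → Fin n → ℝ) (p : Fin n × Fin n) =>
      x p.1 p.2) h.copy_law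
    rw [Measure.map_map measurable_uncurry_array (measurable_pi_lambda _ fun i =>
        measurable_pi_lambda _ fun j => h.measurable_copy i j),
      Measure.map_map measurable_uncurry_array (measurable_pi_lambda _ fun i =>
        measurable_pi_lambda _ fun j => h.measurable_X i j)] at this
    exact this
  have h2 : P.map (fun ω (p : Fin n × Fin n) => Z p.1 p.2 ω) =
      Measure.pi fun _ => gaussianReal 0 1 := by
    rw [(iIndepFun_iff_map_fun_eq_pi_map
      (fun p : Fin n × Fin n => (h.measurable_Z p.1 p.2).aemeasurable)).1 h.indep_Z]
    congr 1
    funext p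
    exact h.law_Z p.1 p.2
  have h3 : IndepFun (fun ω (p : Fin n × Fin n) => X'' p.1 p.2 ω)
      (fun ω (p : Fin n × Fin n) => Z p.1 p.2 ω) P :=
    (h.indep_Z_X.comp measurable_uncurry_array
      (measurable_uncurry_array.comp measurable_snd)).symm
  have h4 := (indepFun_iff_map_prod_eq_prod_map_map hT.aemeasurable hZ.aemeasurable).1 h3
  rw [h1, h2] at h4
  rw [mixLaw, gaussProd, ← h4, Measure.map_map measurable_mixVec (hT.prodMk hZ)]
  rfl

end CombinatorialModel

end Reduction

/-! ### Comparison of the two processes -/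

section Comparison

variable {n : ℕ}

/-- A constant field has zero Jacobian and `κ = 0`, so the formula forces the means to vanish. -/
theorem ApproxStein.integral_coord {ν : Measure (Fin n → ℝ)} {C : Fin n → Fin n → ℝ} {ε : ℝ}
    (h : ApproxStein ν C ε) (i : Fin n) : ∫ x, x i ∂ν = 0 := by
  have hf : IsSmoothField 0 (fun (k : Fin n) (_ : Fin n → ℝ) => if k = i then (1 : ℝ) else 0)
      fun _ _ _ => 0 :=
    { nonneg := le_rfl
      hasFDerivAt := fun k x => by simpa using hasFDerivAt_const _ x
      bounded := ⟨0, le_rfl, by simp⟩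
      lipschitz := by simp }
  simpa using h 0 _ _ hf

theorem ApproxStein.covariance_sum {ν : Measure (Fin n → ℝ)} [IsProbabilityMeasure ν]
    {C : Fin n → Fin n → ℝ} {ε : ℝ} (h : ApproxStein ν C ε)
    (hL : ∀ i, MemLp (fun x : Fin n → ℝ => x i) 2 ν) (r : ℝ) (S T : Finset (Fin n)) :
    covariance (fun x => r * ∑ i ∈ S, x i) (fun x => r * ∑ j ∈ T, x j) ν =
      r * (r * ∑ i ∈ S, ∑ j ∈ T, C i j) := by
  rw [covariance_const_mul_left, covariance_const_mul_right, covariance_fun_sum_fun_sum']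
  · congr 2
    refine Finset.sum_congr rfl fun i _ => Finset.sum_congr rfl fun j _ => ?_
    rw [covariance_eq_sub (hL i) (hL j), h.integral_coord, zero_mul, sub_zero]
    exact h.integral_mul i j
  · exact fun i _ => hL i
  · exact fun i _ => hL i

variable {Ω : Type*} [MeasurableSpace Ω] {P : Measure Ω} [IsProbabilityMeasure P]
  {X X'' Z : Fin n → Fin n → Ω → ℝ} {π : Ω → Equiv.Perm (Fin n)}

theorem ApproxStein.covariance_stepPath {C : Fin n → Fin n → ℝ} {ε : ℝ} {W : Ω → Fin n → ℝ}
    (hW : Measurable W) (h : ApproxStein (P.map W) C ε)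
    (hL : ∀ i, MemLp (fun x : Fin n → ℝ => x i) 2 (P.map W)) (r : ℝ) (t u : unitInterval) :
    covariance (fun ω => (r • stepPath (W ω)).1 t) (fun ω => (r • stepPath (W ω)).1 u) P =
      r * (r * ∑ i : Fin n with i.val + 1 ≤ ⌊(n : ℝ) * t⌋₊,
        ∑ j : Fin n with j.val + 1 ≤ ⌊(n : ℝ) * u⌋₊, C i j) := by
  have := Measure.isProbabilityMeasure_map (μ := P) hW.aemeasurable
  have e : ∀ (t : unitInterval) (a : Fin n → ℝ), (r • stepPath a).1 t =
      r * ∑ i : Fin n with i.val + 1 ≤ ⌊(n : ℝ) * t⌋₊, a i := fun t a => by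
    rw [← stepPath_apply]
    rfl
  simp only [e]
  rw [← h.covariance_sum hL, covariance_map_fun]
  · exact Measurable.aestronglyMeasurable (by fun_prop)
  · exact Measurable.aestronglyMeasurable (by fun_prop)
  · exact hW.aemeasurable

theorem memLp_permLaw {Q : Measure (Fin n × Fin n → ℝ)}
    (h2 : ∀ p, MemLp (fun x : Fin n × Fin n → ℝ => x p) 2 Q) (i : Fin n) :
    MemLp (fun x : Fin n → ℝ => x i) 2 (permLaw Q) := by
  rw [memLp_two_iff_integrable_sq (measurable_pi_apply i).aestronglyMeasurable]
  exact integrable_permLaw (by fun_prop) fun τ => (h2 (i, τ i)).integrable_sq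

theorem memLp_mixLaw {Q : Measure (Fin n × Fin n → ℝ)} [IsProbabilityMeasure Q]
    (h2 : ∀ p, MemLp (fun x : Fin n × Fin n → ℝ => x p) 2 Q) (i : Fin n) :
    MemLp (fun x : Fin n → ℝ => x i) 2 (mixLaw Q) :=
  (memLp_map_measure_iff (measurable_pi_apply i).aestronglyMeasurable
    measurable_mixVec.aemeasurable).2 (memLp_mixVec h2 i)

theorem integrable_of_linear_growth {ν : Measure (Fin n → ℝ)} [IsProbabilityMeasure ν]
    (hL : ∀ i, MemLp (fun x : Fin n → ℝ => x i) 2 ν) {F : (Fin n → ℝ) → ℝ} (hF : Measurable F)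
    {K L : ℝ} (hFb : ∀ y, |F y| ≤ K + L * ∑ i, |y i|) : Integrable F ν :=
  ((integrable_const K).add ((integrable_finsetSum _ fun i _ =>
    ((hL i).integrable (by norm_num)).abs).const_mul L)).mono' hF.aestronglyMeasurable
    (ae_of_all _ hFb)

namespace CombinatorialModel

theorem approxStein_perm (h : CombinatorialModel P X π X'' Z) (hn : 2 ≤ n) :
    ApproxStein (P.map fun ω i => X i (π ω i) ω) (permCov (entryMean P X) (absMoment P X 2))
      (permError (absMoment P X 1) (absMoment P X 2) (absMoment P X 3)) := by
  have := h.isProbabilityMeasure_arrayLaw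
  have e0 : ∀ i k, ∫ x, x (i, k) ∂(arrayLaw P X) = entryMean P X i k := fun i k =>
    h.integral_arrayLaw measurable_id (i, k)
  have e1 : ∀ i k, ∫ x, |x (i, k)| ∂(arrayLaw P X) = absMoment P X 1 i k := fun i k => by
    simp only [absMoment, pow_one]
    exact h.integral_arrayLaw (φ := fun t => |t|) (by fun_prop) (i, k)
  have e2 : ∀ d i k, ∫ x, |x (i, k)| ^ d ∂(arrayLaw P X) = absMoment P X d i k := fun d i k =>
    h.integral_arrayLaw (φ := fun t => |t| ^ d) (by fun_prop) (i, k)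
  have := approxStein_permLaw hn h.iIndepFun_arrayLaw h.memLp_arrayLaw fun i => by
    simp only [e0]
    exact h.row_mean i
  simp only [e0, e1, e2] at this
  rw [h.map_perm_eq]
  exact this

theorem approxStein_zHat (h : CombinatorialModel P X π X'' Z) (hn : 2 ≤ n) :
    ApproxStein (P.map fun ω i => zHat X'' Z i ω) (permCov (entryMean P X) (absMoment P X 2))
      (mixError (absMoment P X 1) (absMoment P X 2) (absMoment P X 3)) := by
  have := h.isProbabilityMeasure_arrayLaw
  have e0 : ∀ i k, ∫ x, x (i, k) ∂(arrayLaw P X) = entryMean P X i k := fun i k =>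
    h.integral_arrayLaw measurable_id (i, k)
  have e1 : ∀ i k, ∫ x, |x (i, k)| ∂(arrayLaw P X) = absMoment P X 1 i k := fun i k => by
    simp only [absMoment, pow_one]
    exact h.integral_arrayLaw (φ := fun t => |t|) (by fun_prop) (i, k)
  have e2 : ∀ d i k, ∫ x, |x (i, k)| ^ d ∂(arrayLaw P X) = absMoment P X d i k := fun d i k =>
    h.integral_arrayLaw (φ := fun t => |t| ^ d) (by fun_prop) (i, k)
  have := approxStein_mixLaw hn h.iIndepFun_arrayLaw h.memLp_arrayLaw
  simp only [e0, e1, e2] at this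
  rw [h.map_zHat_eq]
  exact this

theorem memLp_map_perm (h : CombinatorialModel P X π X'' Z) (i : Fin n) :
    MemLp (fun x : Fin n → ℝ => x i) 2 (P.map fun ω i => X i (π ω i) ω) := by
  have := h.isProbabilityMeasure_arrayLaw
  rw [h.map_perm_eq]
  exact memLp_permLaw (fun p => (h.memLp_arrayLaw p).mono_exponent (by norm_num)) i

theorem memLp_map_zHat (h : CombinatorialModel P X π X'' Z) (i : Fin n) :
    MemLp (fun x : Fin n → ℝ => x i) 2 (P.map fun ω i => zHat X'' Z i ω) := by
  have := h.isProbabilityMeasure_arrayLaw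
  rw [h.map_zHat_eq]
  exact memLp_mixLaw (fun p => (h.memLp_arrayLaw p).mono_exponent (by norm_num)) i

theorem covariance_processY_eq (h : CombinatorialModel P X π X'' Z) (hn : 2 ≤ n)
    (t u : unitInterval) :
    covariance (fun ω => (processY P X π ω).1 t) (fun ω => (processY P X π ω).1 u) P =
      covariance (fun ω => (processD P X X'' Z ω).1 t)
        (fun ω => (processD P X X'' Z ω).1 u) P :=
  ((h.approxStein_perm hn).covariance_stepPath h.measurable_perm_vec h.memLp_map_perm _ t u).trans
    ((h.approxStein_zHat hn).covariance_stepPath h.measurable_zHat h.memLp_map_zHat _ t u).symm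

theorem abs_integral_sub_le (h : CombinatorialModel P X π X'' Z) (hn : 2 ≤ n)
    (hs : 0 < scale P X) {g : CadlagSpace → ℝ} (hg : MemM1 g) :
    Integrable (fun ω => g (processY P X π ω)) P ∧
    Integrable (fun ω => g (processD P X X'' Z ω)) P ∧
    |∫ ω, g (processY P X π ω) ∂P - ∫ ω, g (processD P X X'' Z ω) ∂P| ≤
      normM1 g / ((n : ℝ) ^ 3 * ((n : ℝ) - 1) * scale P X ^ 3) * thirdOrderSum P X := by
  set s := scale P X
  have hY := h.measurable_perm_vec
  have hD := h.measurable_zHat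
  have := Measure.isProbabilityMeasure_map (μ := P) hY.aemeasurable
  have := Measure.isProbabilityMeasure_map (μ := P) hD.aemeasurable
  have hv : ∀ i : Fin n, ‖scaledJump s i‖ ≤ 1 / s := norm_scaledJump_le hs
  have hr : 0 ≤ 1 / s := by positivity
  have hGm : Measurable fun a : Fin n → ℝ => g (combine (scaledJump s) a) :=
    (hg.1.continuous.comp (combine (scaledJump s)).continuous).measurable
  have iY := integrable_of_linear_growth h.memLp_map_perm hGm (hg.abs_combine_le hv)
  have iD := integrable_of_linear_growth h.memLp_map_zHat hGm (hg.abs_combine_le hv)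
  have key := (h.approxStein_perm hn).abs_integral_sub_le (h.approxStein_zHat hn)
    (hg.isSmoothField hr hv) (fun i => (h.memLp_map_perm i).integrable (by norm_num))
    (fun i => (h.memLp_map_zHat i).integrable (by norm_num)) (hg.hasFDerivAt_combine _) iY
    fun i x => hg.abs_fderiv_le hv i _
  rw [integral_map hY.aemeasurable hGm.aestronglyMeasurable,
    integral_map hD.aemeasurable hGm.aestronglyMeasurable] at key
  have iY' := (integrable_map_measure hGm.aestronglyMeasurable hY.aemeasurable).1 iY
  have iD' := (integrable_map_measure hGm.aestronglyMeasurable hD.aemeasurable).1 iD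
  simp only [Function.comp_def, combine_scaledJump] at iY' iD' key
  refine ⟨iY', iD', key.trans ?_⟩
  have hm : ∀ d i k, 0 ≤ absMoment P X d i k := fun d i k =>
    integral_nonneg fun ω => by positivity
  have hE := permError_add_mixError_le (c := entryMean P X) hn (hm 1) (hm 2) (hm 3)
  have hK := mul_le_mul_of_nonneg_left hE
    (by have := normM1_nonneg g; positivity : 0 ≤ normM1 g / s ^ 3)
  -- With jumps of size at most `1 / s` the Lipschitz constant is `κ = 2 ‖g‖ / s³`, so `κ / 3` is `2
  -- / 3` times `‖g‖ / s³`.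
  refine le_of_eq_of_le ?_ (hK.trans_eq ?_)
  · field_simp
  · change _ = normM1 g / ((n : ℝ) ^ 3 * ((n : ℝ) - 1) * s ^ 3) *
      momentSum (absMoment P X 1) (absMoment P X 2) (absMoment P X 3) (entryMean P X)
    rw [div_mul_div_comm, div_mul_eq_mul_div, mul_comm (s ^ 3)]

end CombinatorialModel

/-! ### Arrays with uniformly bounded third moments -/

theorem momentSum_nonneg {m m₂ m₃ c : Fin n → Fin n → ℝ} (hm : ∀ i k, 0 ≤ m i k)
    (hm₂ : ∀ i k, 0 ≤ m₂ i k) (hm₃ : ∀ i k, 0 ≤ m₃ i k) : 0 ≤ momentSum m m₂ m₃ c := by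
  refine Finset.sum_nonneg fun i _ => Finset.sum_nonneg fun j _ => Finset.sum_nonneg fun k _ =>
    Finset.sum_nonneg fun l _ => Finset.sum_nonneg fun u _ => ?_
  have := hm i k
  have := hm i l
  have := hm i u
  have := hm j k
  have := hm j l
  have := hm u k
  have := hm u l
  have := hm₂ i k
  have := hm₂ i l
  have := hm₃ i k
  have := Finset.sum_nonneg fun (r : Fin n) (_ : r ∈ Finset.univ) =>
    add_nonneg (hm₂ i r) (abs_nonneg (c i r * c j r))
  positivity

/-- Since `b ≥ 1`, every summand is at most its coefficient times `b³`. The first nine coefficients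
add up to 50, and the last summand is at most `8 b · 2 b² = 16 b³`. -/
theorem momentSum_le {m m₂ m₃ c : Fin n → Fin n → ℝ} {b : ℝ} (hb : 1 ≤ b)
    (hm : ∀ i k, 0 ≤ m i k) (hm₂ : ∀ i k, 0 ≤ m₂ i k) (hmb : ∀ i k, m i k ≤ b)
    (hmb₂ : ∀ i k, m₂ i k ≤ b) (hmb₃ : ∀ i k, m₃ i k ≤ b) (hc : ∀ i k, |c i k| ≤ b) :
    momentSum m m₂ m₃ c ≤ 66 * b ^ 3 * (n : ℝ) ^ 5 := by
  have hb0 : 0 ≤ b := by linarith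
  have h2 : b ≤ b ^ 2 := by nlinarith
  have h3 : b ^ 2 ≤ b ^ 3 := by nlinarith [sq_nonneg b]
  have pm : ∀ {x y : ℝ}, 0 ≤ x → 0 ≤ y → x ≤ b → y ≤ b → x * y ≤ b ^ 2 := fun hx hy hxb hyb => by
    rw [sq]
    exact mul_le_mul hxb hyb hy hb0
  have pm3 : ∀ {x y z : ℝ}, 0 ≤ x → 0 ≤ y → 0 ≤ z → x ≤ b → y ≤ b → z ≤ b →
      x * y * z ≤ b ^ 3 := fun hx hy hz hxb hyb hzb => by
    rw [pow_succ]
    exact mul_le_mul (pm hx hy hxb hyb) hzb hz (by positivity)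
  have hsum : ∀ {F : Fin n → ℝ} {B : ℝ}, (∀ i, F i ≤ B) → ∑ i, F i ≤ n * B := fun {F B} hF => by
    simpa using Finset.sum_le_sum fun i (_ : i ∈ Finset.univ) => hF i
  have main : ∀ i j k l u : Fin n, (3 * m₃ i k + 5 * (m i k * m₂ i l) + 7 * (m₂ i k * m j l)
      + 5 * (m₂ i k * m j k) + 16 * (m i k * m i l * m j l) + 2 * (m i u * m i k * m i l)
      + 4 * (m i u * m i l * m j k) + 6 * (m u k * m i k * m j l) + 2 * (m u k * m i k * m j k)
      + 1 / (n : ℝ) * (2 * m i k + 2 * m j l + 2 * m u k + 2 * m u l)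
        * ∑ r, (m₂ i r + |c i r * c j r|)) ≤ 66 * b ^ 3 := by
    intro i j k l u
    have hn : (0 : ℝ) < n := by exact_mod_cast (Nat.zero_le _).trans_lt i.2
    have t0 : ∑ r, (m₂ i r + |c i r * c j r|) ≤ n * (2 * b ^ 2) := hsum fun r => by
      rw [abs_mul]
      have := pm (abs_nonneg (c i r)) (abs_nonneg (c j r)) (hc i r) (hc j r)
      linarith [hmb₂ i r]
    have t1 : 0 ≤ ∑ r, (m₂ i r + |c i r * c j r|) :=
      Finset.sum_nonneg fun r _ => add_nonneg (hm₂ i r) (abs_nonneg _)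
    have t2 : 1 / (n : ℝ) * (2 * m i k + 2 * m j l + 2 * m u k + 2 * m u l)
        * ∑ r, (m₂ i r + |c i r * c j r|) ≤ 16 * b ^ 3 := by
      have : 1 / (n : ℝ) * (2 * m i k + 2 * m j l + 2 * m u k + 2 * m u l) ≤ 1 / n * (8 * b) :=
        mul_le_mul_of_nonneg_left (by linarith [hmb i k, hmb j l, hmb u k, hmb u l]) (by positivity)
      refine (mul_le_mul this t0 t1 (by positivity)).trans_eq ?_
      field_simp
      ring
    linarith [hmb₃ i k, pm (hm i k) (hm₂ i l) (hmb i k) (hmb₂ i l),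
      pm (hm₂ i k) (hm j l) (hmb₂ i k) (hmb j l), pm (hm₂ i k) (hm j k) (hmb₂ i k) (hmb j k),
      pm3 (hm i k) (hm i l) (hm j l) (hmb i k) (hmb i l) (hmb j l),
      pm3 (hm i u) (hm i k) (hm i l) (hmb i u) (hmb i k) (hmb i l),
      pm3 (hm i u) (hm i l) (hm j k) (hmb i u) (hmb i l) (hmb j k),
      pm3 (hm u k) (hm i k) (hm j l) (hmb u k) (hmb i k) (hmb j l),
      pm3 (hm u k) (hm i k) (hm j k) (hmb u k) (hmb i k) (hmb j k)]
  refine (hsum fun i => hsum fun j => hsum fun k => hsum fun l => hsum fun u =>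
    main i j k l u).trans_eq ?_
  ring

namespace CombinatorialModel

omit [IsProbabilityMeasure P] in
theorem integrable_abs_pow (h : CombinatorialModel P X π X'' Z) (i j : Fin n) :
    Integrable (fun ω => |X i j ω| ^ 3) P := integrable_abs_pow_three (h.third_moment i j)

theorem absMoment_le (h : CombinatorialModel P X π X'' Z) {d : ℕ} (hd : d ≤ 3) (i j : Fin n) :
    absMoment P X d i j ≤ 1 + absMoment P X 3 i j := by
  have hi := h.integrable_abs_pow i j
  have hp : ∀ ω, |X i j ω| ^ d ≤ 1 + |X i j ω| ^ 3 := fun ω => by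
    have h0 := abs_nonneg (X i j ω)
    rcases le_total |X i j ω| 1 with h1 | h1
    · linarith [pow_le_one₀ h0 h1 (n := d), pow_nonneg h0 3]
    · linarith [pow_le_pow_right₀ h1 hd]
  have hb : Integrable (fun ω => 1 + |X i j ω| ^ 3) P := (integrable_const 1).add hi
  have := integral_mono_of_nonneg (ae_of_all _ fun ω => pow_nonneg (abs_nonneg (X i j ω)) d) hb
    (ae_of_all _ hp)
  rw [integral_add (integrable_const 1) hi] at this
  simpa [absMoment] using this

theorem abs_integral_sub_le_of_moment (h : CombinatorialModel P X π X'' Z) (hn : 2 ≤ n) {β c : ℝ}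
    (hc : 0 < c) (hβ : ∀ i j, absMoment P X 3 i j ≤ β) (hs : c * √n ≤ scale P X)
    {g : CadlagSpace → ℝ} (hg : MemM1 g) :
    |∫ ω, g (processY P X π ω) ∂P - ∫ ω, g (processD P X X'' Z ω) ∂P| ≤
      132 * (1 + |β|) ^ 3 / c ^ 3 * normM1 g / √n := by
  have hn' : (2 : ℝ) ≤ n := by exact_mod_cast hn
  have hq : 0 < √(n : ℝ) := Real.sqrt_pos.2 (by linarith)
  have hs0 : 0 < scale P X := lt_of_lt_of_le (by positivity) hs
  refine (h.abs_integral_sub_le hn hs0 hg).2.2.trans ?_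
  have hm : ∀ d i k, 0 ≤ absMoment P X d i k := fun d i k =>
    integral_nonneg fun ω => by positivity
  have hmb : ∀ d, d ≤ 3 → ∀ i k, absMoment P X d i k ≤ 1 + |β| := fun d hd i k => by
    linarith [h.absMoment_le hd i k, hβ i k, le_abs_self β]
  have hT : thirdOrderSum P X ≤ 66 * (1 + |β|) ^ 3 * (n : ℝ) ^ 5 :=
    momentSum_le (m := absMoment P X 1) (m₂ := absMoment P X 2) (m₃ := absMoment P X 3)
      (c := entryMean P X) (by linarith [abs_nonneg β]) (hm 1) (hm 2) (hmb 1 (by norm_num))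
      (hmb 2 (by norm_num)) (hmb 3 le_rfl) fun i k => by
        refine le_trans ?_ (hmb 1 (by norm_num) i k)
        simp only [absMoment, pow_one]
        exact abs_integral_le_integral_abs
  have hK := normM1_nonneg g
  -- From `n - 1 ≥ n / 2`, which doubles 66 to 132. The powers of `n` combine to `n⁵ / (n⁴ ·
  -- n^(3/2)) = 1 / √n`.
  have hden : (n : ℝ) ^ 3 * (n / 2) * (c * √n) ^ 3 ≤
      (n : ℝ) ^ 3 * ((n : ℝ) - 1) * scale P X ^ 3 :=
    mul_le_mul (mul_le_mul_of_nonneg_left (by linarith) (by positivity))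
      (pow_le_pow_left₀ (by positivity) hs 3) (by positivity)
      (mul_nonneg (by positivity) (by linarith))
  calc normM1 g / ((n : ℝ) ^ 3 * ((n : ℝ) - 1) * scale P X ^ 3) * thirdOrderSum P X
      ≤ normM1 g / ((n : ℝ) ^ 3 * (n / 2) * (c * √n) ^ 3) * (66 * (1 + |β|) ^ 3 * (n : ℝ) ^ 5) :=
        mul_le_mul (div_le_div_of_nonneg_left hK (by positivity) hden) hT
          (momentSum_nonneg (c := entryMean P X) (hm 1) (hm 2) (hm 3)) (by positivity)
    _ = 132 * (1 + |β|) ^ 3 / c ^ 3 * normM1 g / √n := by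
        have : (n : ℝ) = √n ^ 2 := (Real.sq_sqrt (by linarith)).symm
        generalize √(n : ℝ) = q at *
        rw [this]
        field_simp
        ring

end CombinatorialModel

end Comparison


end

theorem mainTheorem2 :
    (∀ (n : ℕ) (_ : 2 ≤ n) (Ω : Type v) [MeasurableSpace Ω] (P : Measure Ω)
      [IsProbabilityMeasure P] (X : Fin n → Fin n → Ω → ℝ) (π : Ω → Equiv.Perm (Fin n))
      (X'' Z : Fin n → Fin n → Ω → ℝ),
      CombinatorialModel P X π X'' Z → 0 < scale P X →
      (∀ t u : unitInterval,
        covariance (fun ω => (processY P X π ω).1 t) (fun ω => (processY P X π ω).1 u) P =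
        covariance (fun ω => (processD P X X'' Z ω).1 t)
          (fun ω => (processD P X X'' Z ω).1 u) P) ∧
      ∀ g : CadlagSpace → ℝ, MemM1 g →
        Integrable (fun ω => g (processY P X π ω)) P ∧
        Integrable (fun ω => g (processD P X X'' Z ω)) P ∧
        |∫ ω, g (processY P X π ω) ∂P - ∫ ω, g (processD P X X'' Z ω) ∂P| ≤
          normM1 g / ((n : ℝ) ^ 3 * ((n : ℝ) - 1) * scale P X ^ 3) * thirdOrderSum P X
            + 2 * normM1 g / Real.sqrt n
            + 4 * normM1 g / (3 * n * scale P X ^ 2) * ∑ i, ∑ j, variance (X i j) P) ∧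
    (∀ β c : ℝ, 0 < c → ∃ C : ℝ,
      ∀ (n : ℕ) (_ : 2 ≤ n) (Ω : Type v) [MeasurableSpace Ω] (P : Measure Ω)
        [IsProbabilityMeasure P] (X : Fin n → Fin n → Ω → ℝ) (π : Ω → Equiv.Perm (Fin n))
        (X'' Z : Fin n → Fin n → Ω → ℝ),
        CombinatorialModel P X π X'' Z →
        (∀ i j, absMoment P X 3 i j ≤ β) → c * Real.sqrt n ≤ scale P X →
        ∀ g : CadlagSpace → ℝ, MemM1 g →
          |∫ ω, g (processY P X π ω) ∂P - ∫ ω, g (processD P X X'' Z ω) ∂P| ≤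
            C * normM1 g / Real.sqrt n) := by
  refine ⟨fun n hn Ω _ P _ X π X'' Z h hs => ⟨h.covariance_processY_eq hn, fun g hg => ?_⟩,
    fun β c hc => ⟨132 * (1 + |β|) ^ 3 / c ^ 3, fun n hn Ω _ P _ X π X'' Z h hβ hs g hg =>
      h.abs_integral_sub_le_of_moment hn hc hβ hs hg⟩⟩
  obtain ⟨h1, h2, h3⟩ := h.abs_integral_sub_le hn hs hg
  refine ⟨h1, h2, h3.trans ?_⟩
  have hK := normM1_nonneg g
  have hv : 0 ≤ ∑ i, ∑ j, variance (X i j) P :=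
    Finset.sum_nonneg fun i _ => Finset.sum_nonneg fun j _ => variance_nonneg _ _
  -- The moment sum alone already bounds the difference; the last two terms of the stated bound only
  -- enlarge it.
  have t1 : 0 ≤ 2 * normM1 g / √n := by positivity
  have t2 : 0 ≤ 4 * normM1 g / (3 * n * scale P X ^ 2) * ∑ i, ∑ j, variance (X i j) P := by
    positivity
  linarith
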